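/- Let $k$ be a field of characteristic zero; all objects are $\mathbb Z$-graded, $U[n]^p=U^{n+p}$, and the Koszul sign rule is used. $S(U)$ denotes the free graded commutative algebra on a graded vector space $U$, with its shuffle comultiplication, and $S^n(U)$ its $n$-th symmetric power. For a graded commutative algebra $V$, $V[[\hbar]]$ is the graded algebra of power series in a variable $\hbar$ of degree $2$ ($V[[\hbar]]^p=\prod_n V^{p-2n}\hbar^n$); linear maps of fixed degree $V\to V'[[\hbar]]$ are extended $\hbar$-linearly and continuously to $V[[\hbar]]$. An $L_\infty$-algebra $\mathfrak g$ is a graded vector space with a coderivation $D$ of degree one of the coalgebra $S(\mathfrak g[1])$ such that $D^2=0$, $D(1)=0$. An $L_\infty$-morphism $\mathfrak g\to\mathfrak g'$ is a morphism $F:S(\mathfrak g[1])\to S(\mathfrak g'[1])$ of graded counital coalgebras with $F(1)=1$ and $FD=D'F$. A $BV_\infty$-algebra is a graded commutative algebra $V$ with a linear map $\Delta=\hbar^{-1}\sum_{n\ge1}\hbar^n\Delta_n:V\to V[[\hbar]]$ of degree one, where $\Delta_n$ is a differential operator of order $\le n$, $\Delta^2=0$ and $\Delta(1)=0$. For a linear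 map $\varphi:S(U)\to V[[\hbar]]$ of degree zero with $\varphi(1)=0$ put $\exp(\varphi)(1)=1$ and, for $m\ge1$ and $x_1,\dots,x_m\in U$, $$\exp(\varphi)(x_1\cdots x_m)=\sum_{j=1}^m\frac1{j!}\sum_{i_1+\dots+i_j=m,\ i_r\ge1}\frac1{i_1!\cdots i_j!}\sum_{\sigma\in S_m}\pm\,\varphi(x_{\sigma(1)}\cdots x_{\sigma(i_1)})\cdots\varphi(x_{\sigma(m-i_j+1)}\cdots x_{\sigma(m)}),$$ and let $\log$ be the inverse operation (the same formula with $\frac{(-1)^{j-1}}{j}$ in place of $\frac1{j!}$). A $BV_\infty$-morphism from a $BV_\infty$-algebra $(S(U),\Delta)$ to a $BV_\infty$-algebra $(V,\Delta')$ is a linear map $\varphi=\hbar^{-1}\sum_{n\ge1}\hbar^n\varphi_n:S(U)\to V[[\hbar]]$ of degree zero with $\varphi(1)=0$, $\exp(\varphi)\Delta=\Delta'\exp(\varphi)$ and $\varphi_n=0$ on $S^{m}(U)$ for all $m>n$. Write $\psi\diamond\varphi=\log(\exp(\psi)\circ\exp(\varphi))$. Let $\mathfrak g$ be an $L_\infty$-algebra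 with codifferential $D$ and let $(V,\Delta)$ be a $BV_\infty$-algebra. (1) $S(\mathfrak g[-1])$ is a $BV_\infty$-algebra with $\Delta_{\mathfrak g}=\hbar^{-1}\sum_{n\ge1}\hbar^nD_n$, where $D_n$ is the coderivation extending the component $S^n(\mathfrak g[1])\to\mathfrak g[1]$ of $D$, and $S(\mathfrak g[1])$ is identified with $S(\mathfrak g[-1])$ by double suspension. (2) The brackets $l^\hbar_n(a_1,\dots,a_n)=[[\dots[\Delta,L_{a_1}],\dots],L_{a_n}]1$ on $V[[\hbar]]$, where $L_a$ is the left multiplication by $a$, are divisible by $\hbar^{n-1}$, and the modified brackets $L_n=\hbar^{1-n}l^\hbar_n$, $n\ge1$, make $V[[\hbar]][1]$ an $L_\infty$-algebra. (3) There is a canonical bijection $$\operatorname{Hom}_{BV_\infty}(S(\mathfrak g[-1]),V)\;\cong\;\operatorname{Hom}_{L_\infty}(\mathfrak g,V[[\hbar]][1]),\qquad\varphi\leftrightarrow F,$$ determined by $\varphi|_{S^m}=\hbar^{m-1}f|_{S^m}$ for $m\ge1$, where $f:S(\mathfrak g[1])\to V[[\hbar]][2]$ is the projection of $F$ to the cogenerators.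 (4) The bijection is natural in $\mathfrak g$: an $L_\infty$-morphism $E:\mathfrak g'\to\mathfrak g$ induces the $BV_\infty$-morphism $E_\hbar:S(\mathfrak g'[-1])\to S(\mathfrak g[-1])$ that equals $\hbar^{n-1}$ times the projection of $E$ to the cogenerators on $S^n$ for $n\ge1$ (and $E_\hbar(1)=0$), and if $\varphi$ corresponds to $F$, then $\varphi\diamond E_\hbar$ is a $BV_\infty$-morphism and corresponds to $F\circ E$. (5) The bijection is natural in $V$: a $BV_\infty$-morphism $\psi:S(U)\to V$ from a $BV_\infty$-algebra that is free as a graded commutative algebra induces an $L_\infty$-morphism $\psi_*:S(U)[[\hbar]][1]\to V[[\hbar]][1]$, namely the one obtained by the formula of (3) from $\psi\diamond p_1=\log(\exp(\psi)\circ\mu)$, where $\mu$ is the multiplication map from the symmetric algebra on $S(U)[[\hbar]]$ to $S(U)[[\hbar]]$; and if $\varphi:S(\mathfrak g[-1])\to S(U)$ is a $BV_\infty$-morphism corresponding to $F$, then $\psi\diamond\varphi$ is a $BV_\infty$-morphism and corresponds to $\psi_*\circ F$. -/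

import Mathlib

open DirectSum TensorProduct

noncomputable section

namespace HBV

/-! ### Graded vector spaces -/

/-- The translation `U[n]`, with `U[n]^p = U^{n+p}`, on the same underlying vector space. -/
def shift {k U : Type*} [Field k] [AddCommGroup U] [Module k U] (𝒰 : ℤ → Submodule k U) (n : ℤ) :
    ℤ → Submodule k U := fun p => 𝒰 (n + p)

theorem shift_isInternal {k U : Type*} [Field k] [AddCommGroup U] [Module k U]
    (𝒰 : ℤ → Submodule k U) [Decomposition 𝒰] (n : ℤ) : IsInternal (shift 𝒰 n) := by
  have h := (isInternal_submodule_iff_iSupIndep_and_iSup_eq_top 𝒰).1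
    (Decomposition.isInternal 𝒰)
  refine (isInternal_submodule_iff_iSupIndep_and_iSup_eq_top _).2 ⟨?_, ?_⟩
  · exact h.1.comp (add_right_injective n)
  · rw [eq_top_iff, ← h.2]
    refine iSup_le fun p => ?_
    have := le_iSup (shift 𝒰 n) (p - n)
    simpa [shift] using this

instance shift.decomposition {k U : Type*} [Field k] [AddCommGroup U] [Module k U]
    (𝒰 : ℤ → Submodule k U) [Decomposition 𝒰] (n : ℤ) : Decomposition (shift 𝒰 n) :=
  (shift_isInternal 𝒰 n).chooseDecomposition

/-- A linear map is homogeneous of degree `d`. -/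
def IsHomog {k A B : Type*} [Field k] [AddCommGroup A] [Module k A] [AddCommGroup B] [Module k B]
    (𝒜 : ℤ → Submodule k A) (ℬ : ℤ → Submodule k B) (d : ℤ) (f : A →ₗ[k] B) : Prop :=
  ∀ p, ∀ a ∈ 𝒜 p, f a ∈ ℬ (p + d)

/-- Graded commutativity: `a b = (-1)^{|a||b|} b a` for homogeneous `a`, `b`. -/
class GrComm {k A : Type*} [Field k] [Ring A] [Algebra k A] (𝒜 : ℤ → Submodule k A) : Prop where
  comm : ∀ p q a b, a ∈ 𝒜 p → b ∈ 𝒜 q → a * b = ((-1 : k) ^ (p * q)) • (b * a)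

/-- The grading involution `a ↦ (-1)^{|a|} a`. -/
def parity {k A : Type*} [Field k] [AddCommGroup A] [Module k A] (𝒜 : ℤ → Submodule k A)
    [Decomposition 𝒜] : A →ₗ[k] A :=
  DirectSum.toModule k ℤ A (fun p => ((-1 : k) ^ p) • (𝒜 p).subtype) ∘ₗ
    (decomposeLinearEquiv 𝒜).toLinearMap

theorem parity_of_mem {k A : Type*} [Field k] [AddCommGroup A] [Module k A]
    (𝒜 : ℤ → Submodule k A) [Decomposition 𝒜] {p : ℤ} {a : A} (ha : a ∈ 𝒜 p) :
    parity 𝒜 a = ((-1 : k) ^ p) • a := by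
  rw [parity, LinearMap.comp_apply, LinearEquiv.coe_coe, decomposeLinearEquiv_apply,
    decompose_of_mem 𝒜 ha, ← DirectSum.lof_eq_of k, DirectSum.toModule_lof]
  rfl

/-! ### The free graded commutative algebra -/

section GSym

variable {k U : Type*} [Field k] [AddCommGroup U] [Module k U] (𝒰 : ℤ → Submodule k U)

/-- The relation `x y = (-1)^{|x||y|} y x` for homogeneous `x, y ∈ U` in the tensor algebra. -/
inductive SymRel : TensorAlgebra k U → TensorAlgebra k U → Prop
  | swap {p q : ℤ} {x y : U} (hx : x ∈ 𝒰 p) (hy : y ∈ 𝒰 q) :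
      SymRel (TensorAlgebra.ι k x * TensorAlgebra.ι k y)
        (((-1 : k) ^ (p * q)) • (TensorAlgebra.ι k y * TensorAlgebra.ι k x))

/-- The free graded commutative algebra `S(U)` on the graded vector space `U`. -/
def GSym : Type _ := RingQuot (SymRel 𝒰)

namespace GSym

instance : Ring (GSym 𝒰) := inferInstanceAs (Ring (RingQuot (SymRel 𝒰)))
instance : Algebra k (GSym 𝒰) := inferInstanceAs (Algebra k (RingQuot (SymRel 𝒰)))

/-- The inclusion `U = S¹(U) → S(U)`. -/
def ι : U →ₗ[k] GSym 𝒰 :=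
  (RingQuot.mkAlgHom k (SymRel 𝒰)).toLinearMap ∘ₗ TensorAlgebra.ι k

theorem ι_comm {p q : ℤ} {x y : U} (hx : x ∈ 𝒰 p) (hy : y ∈ 𝒰 q) :
    ι 𝒰 x * ι 𝒰 y = ((-1 : k) ^ (p * q)) • (ι 𝒰 y * ι 𝒰 x) := by
  have := RingQuot.mkAlgHom_rel k (SymRel.swap (𝒰 := 𝒰) hx hy)
  rw [map_mul, map_smul, map_mul] at this
  exact this

/-- The universal property of `S(U)`. -/
def lift {A : Type*} [Semiring A] [Algebra k A] (f : U →ₗ[k] A)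
    (hf : ∀ p q x y, x ∈ 𝒰 p → y ∈ 𝒰 q → f x * f y = ((-1 : k) ^ (p * q)) • (f y * f x)) :
    GSym 𝒰 →ₐ[k] A :=
  RingQuot.liftAlgHom k ⟨TensorAlgebra.lift k f, by
    rintro _ _ ⟨hx, hy⟩
    rw [map_mul, map_smul, map_mul]
    simpa using hf _ _ _ _ hx hy⟩

variable {𝒰} in
@[simp] theorem lift_ι {A : Type*} [Semiring A] [Algebra k A] (f : U →ₗ[k] A)
    (hf : ∀ p q x y, x ∈ 𝒰 p → y ∈ 𝒰 q → f x * f y = ((-1 : k) ^ (p * q)) • (f y * f x))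
    (x : U) : lift 𝒰 f hf (ι 𝒰 x) = f x := by
  have := RingQuot.liftAlgHom_mkAlgHom_apply (S := k) (TensorAlgebra.lift k f) (s := SymRel 𝒰)
    (by
      rintro _ _ ⟨hx, hy⟩
      rw [map_mul, map_smul, map_mul]
      simpa using hf _ _ _ _ hx hy) (TensorAlgebra.ι k x)
  rw [TensorAlgebra.lift_ι_apply] at this
  exact this

variable {𝒰} in
theorem hom_ext {A : Type*} [Semiring A] [Algebra k A] {f g : GSym 𝒰 →ₐ[k] A}
    (h : ∀ x, f (ι 𝒰 x) = g (ι 𝒰 x)) : f = g := by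
  refine RingQuot.ringQuot_ext' k f g (TensorAlgebra.hom_ext ?_)
  ext x
  exact h x

/-- The part `S(U)_p` of total degree `p`: the span of the products `x₁ ⋯ x_m` of homogeneous
elements of `U` with `|x₁| + ⋯ + |x_m| = p`. -/
def grading (p : ℤ) : Submodule k (GSym 𝒰) :=
  Submodule.span k {a | ∃ l : List (ℤ × U), (∀ t ∈ l, t.2 ∈ 𝒰 t.1) ∧ (l.map Prod.fst).sum = p ∧
    a = (l.map fun t => ι 𝒰 t.2).prod}

theorem ι_mem_grading {p : ℤ} {x : U} (hx : x ∈ 𝒰 p) : ι 𝒰 x ∈ grading 𝒰 p :=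
  Submodule.subset_span ⟨[(p, x)], by simpa using hx, by simp, by simp⟩

instance : SetLike.GradedMonoid (grading 𝒰) where
  one_mem := Submodule.subset_span ⟨[], by simp, by simp, by simp⟩
  mul_mem p q a b ha hb := by
    have := Submodule.mul_mem_mul ha hb
    rw [grading, grading, Submodule.span_mul_span] at this
    refine Submodule.span_mono ?_ this
    rintro _ ⟨_, ⟨l, hl, rfl, rfl⟩, _, ⟨m, hm, rfl, rfl⟩, rfl⟩
    refine ⟨l ++ m, ?_, by simp, by simp⟩
    intro t ht
    rcases List.mem_append.1 ht with h | h
    exacts [hl t h, hm t h]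

/-- `ι` as a map into the direct sum of the homogeneous parts. -/
def ιGr [Decomposition 𝒰] : U →ₗ[k] ⨁ p, grading 𝒰 p :=
  DirectSum.toModule k ℤ _ (fun p => DirectSum.lof k ℤ (fun p => grading 𝒰 p) p ∘ₗ
    ((ι 𝒰) ∘ₗ (𝒰 p).subtype).codRestrict (grading 𝒰 p) (fun x => ι_mem_grading 𝒰 x.2)) ∘ₗ
    (decomposeLinearEquiv 𝒰).toLinearMap

theorem ιGr_of_mem [Decomposition 𝒰] {p : ℤ} {x : U} (hx : x ∈ 𝒰 p) :
    ιGr 𝒰 x = DirectSum.of (fun p => grading 𝒰 p) p ⟨ι 𝒰 x, ι_mem_grading 𝒰 hx⟩ := by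
  simp only [ιGr, LinearMap.comp_apply, LinearEquiv.coe_coe, decomposeLinearEquiv_apply,
    decompose_of_mem 𝒰 hx]
  rw [← DirectSum.lof_eq_of k, DirectSum.toModule_lof, ← DirectSum.lof_eq_of k]
  rfl

theorem ιGr_comm [Decomposition 𝒰] (p q : ℤ) (x y : U) (hx : x ∈ 𝒰 p) (hy : y ∈ 𝒰 q) :
    ιGr 𝒰 x * ιGr 𝒰 y = ((-1 : k) ^ (p * q)) • (ιGr 𝒰 y * ιGr 𝒰 x) := by
  rw [ιGr_of_mem 𝒰 hx, ιGr_of_mem 𝒰 hy, DirectSum.of_mul_of, DirectSum.of_mul_of, ← DirectSum.lof_eq_of k,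
    ← DirectSum.lof_eq_of k, ← map_smul]
  refine DirectSum.of_eq_of_gradedMonoid_eq (Sigma.subtype_ext (add_comm p q) ?_)
  exact ι_comm 𝒰 hx hy

/-- The decomposition of `S(U)` into homogeneous parts. -/
def decomposeHom [Decomposition 𝒰] : GSym 𝒰 →ₐ[k] ⨁ p, grading 𝒰 p :=
  lift 𝒰 (ιGr 𝒰) (ιGr_comm 𝒰)

theorem decomposeHom_ι [Decomposition 𝒰] (x : U) : decomposeHom 𝒰 (ι 𝒰 x) = ιGr 𝒰 x :=
  lift_ι (ιGr 𝒰) (ιGr_comm 𝒰) x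

instance [Decomposition 𝒰] : GradedAlgebra (grading 𝒰) :=
  GradedAlgebra.ofAlgHom (grading 𝒰) (decomposeHom 𝒰)
    (by
      refine hom_ext fun x => ?_
      simp only [AlgHom.comp_apply, decomposeHom_ι, AlgHom.id_apply]
      induction x using Decomposition.inductionOn 𝒰 with
      | zero => simp
      | homogeneous m => rw [ιGr_of_mem 𝒰 m.2]; simp
      | add m m' h h' => rw [map_add, map_add, h, h', map_add])
    (by
      rintro p ⟨a, ha⟩
      have key : ∀ l : List (ℤ × U), (∀ t ∈ l, t.2 ∈ 𝒰 t.1) →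
          ∀ h : (l.map fun t => ι 𝒰 t.2).prod ∈ grading 𝒰 (l.map Prod.fst).sum,
          decomposeHom 𝒰 (l.map fun t => ι 𝒰 t.2).prod =
            DirectSum.of (fun p => grading 𝒰 p) (l.map Prod.fst).sum ⟨_, h⟩ := by
        intro l
        induction l with
        | nil => intro _ h; simp only [List.map_nil, List.prod_nil, map_one]; rfl
        | cons t l ih =>
          intro hl h
          have hl' : ∀ t ∈ l, t.2 ∈ 𝒰 t.1 := fun s hs => hl s (by simp [hs])
          have hm : (l.map fun t => ι 𝒰 t.2).prod ∈ grading 𝒰 (l.map Prod.fst).sum :=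
            Submodule.subset_span ⟨l, hl', rfl, rfl⟩
          simp only [List.map_cons, List.prod_cons, map_mul, decomposeHom_ι]
          rw [ih hl' hm, ιGr_of_mem 𝒰 (hl t (by simp)), DirectSum.of_mul_of]
          exact DirectSum.of_eq_of_gradedMonoid_eq (Sigma.subtype_ext rfl rfl)
      dsimp only
      induction ha using Submodule.span_induction with
      | mem a h =>
        obtain ⟨l, hl, rfl, rfl⟩ := h
        exact key l hl _
      | zero => rw [map_zero]; exact (map_zero (DirectSum.of (fun p => grading 𝒰 p) p)).symm
      | add a b ha hb iha ihb => rw [map_add, iha, ihb, ← map_add]; rfl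
      | smul c a ha iha => 
        rw [map_smul, iha, ← DirectSum.lof_eq_of k, ← map_smul]; rfl)

/-- The weight homomorphism `S(U) → S(U)[t]`, `x ↦ x t` for `x ∈ U`. -/
def weightHom : GSym 𝒰 →ₐ[k] Polynomial (GSym 𝒰) :=
  lift 𝒰 (((Polynomial.monomial 1).restrictScalars k : GSym 𝒰 →ₗ[k] Polynomial (GSym 𝒰)) ∘ₗ ι 𝒰) (by
    intro p q x y hx hy
    simp only [LinearMap.comp_apply, LinearMap.restrictScalars_apply,
      Polynomial.monomial_mul_monomial]
    rw [ι_comm 𝒰 hx hy, Polynomial.smul_monomial])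

theorem weightHom_prod (l : List U) : weightHom 𝒰 (l.map (ι 𝒰)).prod =
    Polynomial.monomial l.length (l.map (ι 𝒰)).prod := by
  induction l with
  | nil => simp [Polynomial.monomial_zero_left]
  | cons x l ih =>
    rw [List.map_cons, List.prod_cons, map_mul, ih, weightHom, lift_ι]
    simp [Polynomial.monomial_mul_monomial, add_comm]

/-- The symmetric power `Sⁿ(U) ⊆ S(U)`. -/
def symPow (n : ℕ) : Submodule k (GSym 𝒰) := LinearMap.range (ι 𝒰) ^ n

/-- The projection of `S(U)` onto `Sⁿ(U)`. -/
def proj (n : ℕ) : GSym 𝒰 →ₗ[k] GSym 𝒰 :=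
  ((Polynomial.lcoeff (GSym 𝒰) n).restrictScalars k : Polynomial (GSym 𝒰) →ₗ[k] GSym 𝒰) ∘ₗ (weightHom 𝒰).toLinearMap

/-- The linear map on `S(U) = ⨁ Sⁿ(U)` which is `f n` on `Sⁿ(U)`. -/
def weightwise {M : Type*} [AddCommGroup M] [Module k M] (f : ℕ → GSym 𝒰 →ₗ[k] M) :
    GSym 𝒰 →ₗ[k] M :=
  Polynomial.lsum f ∘ₗ (weightHom 𝒰).toLinearMap

theorem weightwise_prod {M : Type*} [AddCommGroup M] [Module k M] (f : ℕ → GSym 𝒰 →ₗ[k] M)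
    (l : List U) : weightwise 𝒰 f (l.map (ι 𝒰)).prod = f l.length (l.map (ι 𝒰)).prod := by
  simp only [weightwise, LinearMap.comp_apply, AlgHom.toLinearMap_apply, weightHom_prod]
  simp [Polynomial.lsum]

/-- The counit `ε : S(U) → k`, `ε(1) = 1`, `ε(U) = 0`. -/
def counit : GSym 𝒰 →ₐ[k] k := lift 𝒰 0 (by simp)

/-- The projection `S(U) → S¹(U) = U`. -/
def toCogen : GSym 𝒰 →ₗ[k] U :=
  letI : Module kᵐᵒᵖ U := Module.compHom _ ((RingHom.id k).fromOpposite mul_comm)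
  haveI : IsCentralScalar k U := ⟨fun _ _ => rfl⟩
  TrivSqZeroExt.sndHom k U ∘ₗ (lift 𝒰 (TrivSqZeroExt.inrHom k U)
    (by simp [TrivSqZeroExt.inr_mul_inr])).toLinearMap

@[simp] theorem toCogen_ι (x : U) : toCogen 𝒰 (ι 𝒰 x) = x := by simp [toCogen]

/-- The identity of `U` as an isomorphism between two gradings that differ by an even translation
induces an isomorphism of free graded commutative algebras: even translations do not affect the
Koszul signs. -/
def regrade (𝒰' : ℤ → Submodule k U) (c : ℤ) (h : ∀ p, 𝒰 p ≤ 𝒰' (p + 2 * c)) :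
    GSym 𝒰 →ₐ[k] GSym 𝒰' :=
  lift 𝒰 (ι 𝒰') (by
    intro p q x y hx hy
    rw [ι_comm 𝒰' (h p hx) (h q hy)]
    congr 1
    have : (p + 2 * c) * (q + 2 * c) = p * q + 2 * (p * c + q * c + 2 * c * c) := by ring
    rw [this, zpow_add₀ (by simp), zpow_mul (-1 : k) 2]
    simp)

instance [Decomposition 𝒰] : GrComm (grading 𝒰) where
  comm p q a b ha hb := by
    have h1 : ∀ (t : ℤ × U) (l : List (ℤ × U)), t.2 ∈ 𝒰 t.1 → (∀ t ∈ l, t.2 ∈ 𝒰 t.1) →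
        ι 𝒰 t.2 * (l.map fun t => ι 𝒰 t.2).prod = ((-1 : k) ^ (t.1 * (l.map Prod.fst).sum)) •
          ((l.map fun t => ι 𝒰 t.2).prod * ι 𝒰 t.2) := by
      intro t l ht
      induction l with
      | nil => simp
      | cons s l ih =>
        intro hl
        simp only [List.map_cons, List.prod_cons, List.sum_cons]
        rw [← mul_assoc, ι_comm 𝒰 ht (hl s (by simp)), smul_mul_assoc, mul_assoc,
          ih (fun s hs => hl s (by simp [hs])), mul_smul_comm, smul_smul, ← zpow_add₀ (by simp), mul_add,
          mul_assoc]
    have h2 : ∀ (l m : List (ℤ × U)), (∀ t ∈ l, t.2 ∈ 𝒰 t.1) → (∀ t ∈ m, t.2 ∈ 𝒰 t.1) →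
        (l.map fun t => ι 𝒰 t.2).prod * (m.map fun t => ι 𝒰 t.2).prod =
        ((-1 : k) ^ ((l.map Prod.fst).sum * (m.map Prod.fst).sum)) •
          ((m.map fun t => ι 𝒰 t.2).prod * (l.map fun t => ι 𝒰 t.2).prod) := by
      intro l m
      induction l with
      | nil => simp
      | cons s l ih =>
        intro hl hm
        simp only [List.map_cons, List.prod_cons, List.sum_cons]
        rw [mul_assoc, ih (fun s hs => hl s (by simp [hs])) hm, mul_smul_comm, ← mul_assoc,
          h1 s m (hl s (by simp)) hm, smul_mul_assoc, smul_smul, ← zpow_add₀ (by simp), add_mul, mul_assoc,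
          add_comm]
    induction ha, hb using Submodule.span_induction₂ with
    | mem_mem a b ha hb =>
      obtain ⟨l, hl, rfl, rfl⟩ := ha
      obtain ⟨m, hm, rfl, rfl⟩ := hb
      exact h2 l m hl hm
    | zero_left | zero_right => simp
    | add_left _ _ _ _ _ _ h h' => rw [add_mul, h, h', mul_add, smul_add]
    | add_right _ _ _ _ _ _ h h' => rw [mul_add, h, h', add_mul, smul_add]
    | smul_left r _ _ _ _ h => rw [smul_mul_assoc, h, mul_smul_comm, smul_comm]
    | smul_right r _ _ _ _ h => rw [mul_smul_comm, h, smul_mul_assoc, smul_comm]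

end GSym

end GSym
/-! ### The coalgebra structure of `S(U)` -/

theorem unit_smul_eq {k M : Type*} [Field k] [AddCommGroup M] [Module k M] (n : ℤ) (x : M) :
    ((-1 : ℤˣ) ^ n) • x = ((-1 : k) ^ n) • x := by
  rcases Int.even_or_odd n with h | h <;> simp [h.neg_one_zpow]

namespace GSym

section Homog

variable {k U : Type*} [Field k] [AddCommGroup U] [Module k U] (𝒰 : ℤ → Submodule k U)
  {B : Type*} [Ring B] [Algebra k B] (ℬ : ℤ → Submodule k B)

theorem unit_isHomog [SetLike.GradedMonoid ℬ] :
    IsHomog (grading 𝒰) ℬ 0 (Algebra.linearMap k B ∘ₗ (counit 𝒰).toLinearMap) := by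
  intro p a ha
  induction ha using Submodule.span_induction with
  | mem a h =>
    obtain ⟨l, hl, rfl, rfl⟩ := h
    cases l with
    | nil => simpa using (SetLike.GradedOne.one_mem : (1 : B) ∈ ℬ 0)
    | cons t l => simp [counit]
  | zero => simp
  | add a b _ _ h h' => rw [map_add]; exact add_mem h h'
  | smul c a _ h => rw [map_smul]; exact Submodule.smul_mem _ _ h

theorem weightwise_isHomog {f : ℕ → GSym 𝒰 →ₗ[k] B} (d : ℤ)
    (hf : ∀ n, IsHomog (grading 𝒰) ℬ d (f n)) : IsHomog (grading 𝒰) ℬ d (weightwise 𝒰 f) := by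
  intro p a ha
  induction ha using Submodule.span_induction with
  | mem a h =>
    obtain ⟨l, hl, rfl, rfl⟩ := h
    have := weightwise_prod 𝒰 f (l.map Prod.snd)
    simp only [List.map_map, List.length_map] at this
    exact this ▸ hf _ _ _ (Submodule.subset_span ⟨l, hl, rfl, rfl⟩)
  | zero => simp
  | add a b _ _ h h' => rw [map_add]; exact add_mem h h'
  | smul c a _ h => rw [map_smul]; exact Submodule.smul_mem _ _ h

end Homog

section Comul

variable {k U : Type*} [Field k] [AddCommGroup U] [Module k U] (𝒰 : ℤ → Submodule k U)
  [Decomposition 𝒰]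

open GradedTensorProduct in
theorem tmul_mul_tmul {q p : ℤ} {a b c d : GSym 𝒰} (hb : b ∈ grading 𝒰 q)
    (hc : c ∈ grading 𝒰 p) :
    (a ᵍ⊗ₜ[k] b * c ᵍ⊗ₜ[k] d : grading 𝒰 ᵍ⊗[k] grading 𝒰) =
      ((-1 : k) ^ (q * p)) • ((a * c) ᵍ⊗ₜ[k] (b * d)) := by
  rw [← unit_smul_eq]
  exact tmul_coe_mul_coe_tmul (grading 𝒰) (grading 𝒰) a ⟨b, hb⟩ ⟨c, hc⟩ d

/-- The linear map `x ↦ x ⊗ 1 + 1 ⊗ x` on `U`. -/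
def comulGen : U →ₗ[k] grading 𝒰 ᵍ⊗[k] grading 𝒰 :=
  (GradedTensorProduct.of k (grading 𝒰) (grading 𝒰)).toLinearMap ∘ₗ
    ((TensorProduct.mk k (GSym 𝒰) (GSym 𝒰)).flip 1 +
      TensorProduct.mk k (GSym 𝒰) (GSym 𝒰) 1) ∘ₗ ι 𝒰

open GradedTensorProduct in
theorem comulGen_apply (x : U) : comulGen 𝒰 x = (ι 𝒰 x) ᵍ⊗ₜ[k] 1 + 1 ᵍ⊗ₜ[k] (ι 𝒰 x) := rfl

open GradedTensorProduct in
theorem comulGen_comm (p q : ℤ) (x y : U) (hx : x ∈ 𝒰 p) (hy : y ∈ 𝒰 q) :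
    comulGen 𝒰 x * comulGen 𝒰 y = ((-1 : k) ^ (p * q)) • (comulGen 𝒰 y * comulGen 𝒰 x) := by
  have hx' := ι_mem_grading 𝒰 hx
  have hy' := ι_mem_grading 𝒰 hy
  have h1 : (1 : GSym 𝒰) ∈ grading 𝒰 0 := SetLike.GradedOne.one_mem
  have hs : ((-1 : k) ^ (p * q)) * ((-1 : k) ^ (p * q)) = 1 := by
    rw [← mul_zpow]; simp
  simp only [comulGen_apply, mul_add, add_mul, tmul_mul_tmul 𝒰 h1 hx', tmul_mul_tmul 𝒰 h1 hy',
    tmul_mul_tmul 𝒰 h1 h1, tmul_mul_tmul 𝒰 hx' h1, tmul_mul_tmul 𝒰 hy' h1,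
    tmul_mul_tmul 𝒰 hx' hy', tmul_mul_tmul 𝒰 hy' hx', mul_zero, zero_mul, zpow_zero, one_smul,
    mul_one, one_mul, smul_add, smul_smul, mul_comm q p, hs]
  have e1 : ∀ (c : k) (a b : GSym 𝒰), ((c • a) ᵍ⊗ₜ[k] b : grading 𝒰 ᵍ⊗[k] grading 𝒰) =
      c • (a ᵍ⊗ₜ[k] b) := fun c a b => rfl
  have e2 : ∀ (c : k) (a b : GSym 𝒰), (a ᵍ⊗ₜ[k] (c • b) : grading 𝒰 ᵍ⊗[k] grading 𝒰) =
      c • (a ᵍ⊗ₜ[k] b) := fun c a b => TensorProduct.tmul_smul c a b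
  rw [ι_comm 𝒰 hx hy, e1, e2]
  abel

/-- The comultiplication as an algebra homomorphism to the graded tensor product (whose product is
`(a ⊗ b)(c ⊗ d) = (-1)^{|b||c|} ac ⊗ bd`), determined by `δ(x) = x ⊗ 1 + 1 ⊗ x` for `x ∈ U`. -/
def comulHom : GSym 𝒰 →ₐ[k] grading 𝒰 ᵍ⊗[k] grading 𝒰 :=
  lift 𝒰 (comulGen 𝒰) (comulGen_comm 𝒰)

/-- The shuffle comultiplication `δ : S(U) → S(U) ⊗ S(U)`,
`δ(x₁ ⋯ x_m) = ∑ₙ ∑_{σ ∈ Sh(n,m-n)} ± x_{σ(1)} ⋯ x_{σ(n)} ⊗ x_{σ(n+1)} ⋯ x_{σ(m)}`. -/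
def comul : GSym 𝒰 →ₗ[k] GSym 𝒰 ⊗[k] GSym 𝒰 :=
  (GradedTensorProduct.of k (grading 𝒰) (grading 𝒰)).symm.toLinearMap ∘ₗ
    (comulHom 𝒰).toLinearMap

/-- The convolution `f * g = μ ∘ (f ⊗ g) ∘ δ` of linear maps `f, g : S(U) → B` to an algebra:
`(f * g)(x₁ ⋯ x_m) = ∑ₙ ∑_{σ ∈ Sh(n,m-n)} ± f(x_{σ(1)} ⋯ x_{σ(n)}) g(x_{σ(n+1)} ⋯ x_{σ(m)})`.
It is only used with `g` of degree zero, when no further Koszul sign arises. -/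
def conv {B : Type*} [Ring B] [Algebra k B] (f g : GSym 𝒰 →ₗ[k] B) : GSym 𝒰 →ₗ[k] B :=
  LinearMap.mul' k B ∘ₗ TensorProduct.map f g ∘ₗ comul 𝒰

/-- The convolution powers, starting from the unit `S(U) → k → B`. -/
def convPow {B : Type*} [Ring B] [Algebra k B] (f : GSym 𝒰 →ₗ[k] B) : ℕ → GSym 𝒰 →ₗ[k] B
  | 0 => Algebra.linearMap k B ∘ₗ (counit 𝒰).toLinearMap
  | n + 1 => conv 𝒰 f (convPow f n)

/-- The exponential of `φ : S(U) → B` of degree zero with `φ(1) = 0`: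
`exp(φ)(x₁ ⋯ x_m) = ∑_{k=1}^m 1/k! ∑_{i₁+⋯+i_k=m} 1/(i₁!⋯i_k!) ∑_{σ ∈ S_m}
  ± φ(x_{σ(1)} ⋯ x_{σ(i₁)}) ⋯ φ(x_{σ(m-i_k+1)} ⋯ x_{σ(m)})` and `exp(φ)(1) = 1`.
The sum over all permutations divided by `i₁!⋯i_k!` is the sum over shuffles, so that the inner
sums make up the `k`-fold convolution power of `φ`. -/
def convExp {B : Type*} [Ring B] [Algebra k B] (φ : GSym 𝒰 →ₗ[k] B) : GSym 𝒰 →ₗ[k] B :=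
  weightwise 𝒰 fun m => ∑ j ∈ Finset.range (m + 1), ((j.factorial : k)⁻¹) • convPow 𝒰 φ j

/-- The logarithm of `Φ : S(U) → B` of degree zero with `Φ(1) = 1`:
`log(Φ)(x₁ ⋯ x_m) = ∑_{k=1}^m (-1)^{k-1}/k ∑_{i₁+⋯+i_k=m} 1/(i₁!⋯i_k!) ∑_{σ ∈ S_m}
  ± Φ(x_{σ(1)} ⋯ x_{σ(i₁)}) ⋯ Φ(x_{σ(m-i_k+1)} ⋯ x_{σ(m)})`, where all `i_j ≥ 1` (so that only
`Φ - ε` enters), and `log(Φ)(1) = 0`. -/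
def convLog {B : Type*} [Ring B] [Algebra k B] (Φ : GSym 𝒰 →ₗ[k] B) : GSym 𝒰 →ₗ[k] B :=
  weightwise 𝒰 fun m => ∑ j ∈ Finset.Icc 1 m,
    ((-1 : k) ^ (j - 1) / (j : k)) •
      convPow 𝒰 (Φ - Algebra.linearMap k B ∘ₗ (counit 𝒰).toLinearMap) j

/-! The constructions preserve the degree. -/

/-- The degree `p` part of `S(U) ⊗ S(U)`. -/
def tensorGrading (p : ℤ) : Submodule k (grading 𝒰 ᵍ⊗[k] grading 𝒰) :=
  Submodule.span k {t | ∃ i j a b, a ∈ grading 𝒰 i ∧ b ∈ grading 𝒰 j ∧ i + j = p ∧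
    t = GradedTensorProduct.tmul k a b}

theorem comulHom_mem {p : ℤ} {a : GSym 𝒰} (ha : a ∈ grading 𝒰 p) :
    comulHom 𝒰 a ∈ tensorGrading 𝒰 p := by
  have h1 : (1 : GSym 𝒰) ∈ grading 𝒰 0 := SetLike.GradedOne.one_mem
  have hmul : ∀ p q s t, s ∈ tensorGrading 𝒰 p → t ∈ tensorGrading 𝒰 q →
      s * t ∈ tensorGrading 𝒰 (p + q) := by
    intro p q s t hs ht
    induction hs, ht using Submodule.span_induction₂ with
    | mem_mem s t hs ht =>
      obtain ⟨i, j, a, b, ha, hb, rfl, rfl⟩ := hs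
      obtain ⟨i', j', a', b', ha', hb', rfl, rfl⟩ := ht
      rw [tmul_mul_tmul 𝒰 hb ha']
      refine Submodule.smul_mem _ _ (Submodule.subset_span ⟨i + i', j + j', _, _,
        SetLike.GradedMul.mul_mem ha ha', SetLike.GradedMul.mul_mem hb hb', by ring, rfl⟩)
    | zero_left => simp
    | zero_right => simp
    | add_left _ _ _ _ _ _ h h' => rw [add_mul]; exact add_mem h h'
    | add_right _ _ _ _ _ _ h h' => rw [mul_add]; exact add_mem h h'
    | smul_left r _ _ _ _ h =>
      rw [GradedTensorProduct.mul_def, LinearMap.map_smul₂]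
      exact Submodule.smul_mem _ _ h
    | smul_right r _ _ _ _ h =>
      rw [GradedTensorProduct.mul_def, map_smul]
      exact Submodule.smul_mem _ _ h
  induction ha using Submodule.span_induction with
  | mem a h =>
    obtain ⟨l, hl, rfl, rfl⟩ := h
    induction l with
    | nil =>
      simp only [List.map_nil, List.prod_nil, map_one, List.sum_nil]
      exact Submodule.subset_span ⟨0, 0, 1, 1, h1, h1, by simp, rfl⟩
    | cons t l ih =>
      simp only [List.map_cons, List.prod_cons, List.sum_cons, map_mul]
      refine hmul _ _ _ _ ?_ (ih fun s hs => hl s (by simp [hs]))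
      rw [comulHom, lift_ι, comulGen_apply]
      have ht := ι_mem_grading 𝒰 (hl t (by simp))
      exact add_mem (Submodule.subset_span ⟨_, 0, _, 1, ht, h1, by simp, rfl⟩)
        (Submodule.subset_span ⟨0, _, 1, _, h1, ht, by simp, rfl⟩)
  | zero => simp
  | add a b _ _ h h' => rw [map_add]; exact add_mem h h'
  | smul c a _ h => rw [map_smul]; exact Submodule.smul_mem _ _ h

variable {B : Type*} [Ring B] [Algebra k B] (ℬ : ℤ → Submodule k B)

theorem conv_isHomog [SetLike.GradedMonoid ℬ] {f g : GSym 𝒰 →ₗ[k] B}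
    (hf : IsHomog (grading 𝒰) ℬ 0 f) (hg : IsHomog (grading 𝒰) ℬ 0 g) :
    IsHomog (grading 𝒰) ℬ 0 (conv 𝒰 f g) := by
  intro p a ha
  have key : ∀ t ∈ tensorGrading 𝒰 p, LinearMap.mul' k B (TensorProduct.map f g
      ((GradedTensorProduct.of k (grading 𝒰) (grading 𝒰)).symm t)) ∈ ℬ (p + 0) := by
    intro t ht
    induction ht using Submodule.span_induction with
    | mem t h =>
      obtain ⟨i, j, c, d, hc, hd, rfl, rfl⟩ := h
      have := SetLike.GradedMul.mul_mem (hf i c hc) (hg j d hd)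
      simpa using this
    | zero => simp
    | add a b _ _ h h' => rw [map_add, map_add, map_add]; exact add_mem h h'
    | smul c a _ h => rw [map_smul, map_smul, map_smul]; exact Submodule.smul_mem _ _ h
  exact key _ (comulHom_mem 𝒰 ha)

theorem convPow_isHomog [SetLike.GradedMonoid ℬ] {f : GSym 𝒰 →ₗ[k] B}
    (hf : IsHomog (grading 𝒰) ℬ 0 f) (n : ℕ) : IsHomog (grading 𝒰) ℬ 0 (convPow 𝒰 f n) := by
  induction n with
  | zero => exact unit_isHomog 𝒰 ℬ
  | succ n ih => exact conv_isHomog 𝒰 ℬ hf ih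

theorem convExp_isHomog [SetLike.GradedMonoid ℬ] {f : GSym 𝒰 →ₗ[k] B}
    (hf : IsHomog (grading 𝒰) ℬ 0 f) : IsHomog (grading 𝒰) ℬ 0 (convExp 𝒰 f) := by
  refine weightwise_isHomog 𝒰 ℬ 0 fun m p a ha => ?_
  rw [LinearMap.sum_apply]
  exact Submodule.sum_mem _ fun j _ => Submodule.smul_mem _ _ (convPow_isHomog 𝒰 ℬ hf j p a ha)

end Comul

end GSym

/-! ### `L∞`-algebras and their morphisms -/

section LInf

variable {k G H : Type*} [Field k] [AddCommGroup G] [Module k G] [AddCommGroup H] [Module k H]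

open GSym

/-- A coderivation of degree one of the coalgebra `S(U)`: `δ D = (D ⊗ 1 + 1 ⊗ D) δ`, where
`(1 ⊗ D)(a ⊗ b) = (-1)^{|a|} a ⊗ D(b)` by the Koszul rule. -/
structure IsCoderivation (𝒰 : ℤ → Submodule k G) [Decomposition 𝒰]
    (D : GSym 𝒰 →ₗ[k] GSym 𝒰) : Prop where
  homog : IsHomog (grading 𝒰) (grading 𝒰) 1 D
  coder : ∀ a, comul 𝒰 (D a) = TensorProduct.map D LinearMap.id (comul 𝒰 a) +
    TensorProduct.map (parity (grading 𝒰)) D (comul 𝒰 a)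

/-- An `L∞`-algebra structure on the graded vector space `𝔤`: a codifferential on `S(𝔤[1])`, that
is, a coderivation `D` of degree one with `D² = 0` and `D(1) = 0`. -/
structure IsLInf (𝒢 : ℤ → Submodule k G) [Decomposition 𝒢]
    (D : GSym (shift 𝒢 1) →ₗ[k] GSym (shift 𝒢 1)) : Prop extends
    IsCoderivation (shift 𝒢 1) D where
  sq : ∀ a, D (D a) = 0
  one : D 1 = 0

/-- An `L∞`-morphism `(𝔤, D) → (𝔥, D')`: a morphism of graded (counital) coalgebras
`F : S(𝔤[1]) → S(𝔥[1])` that commutes with the codifferentials and maps `1` to `1`. -/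
structure IsLInfMorphism {𝒢 : ℤ → Submodule k G} {ℋ : ℤ → Submodule k H} [Decomposition 𝒢]
    [Decomposition ℋ] (D : GSym (shift 𝒢 1) →ₗ[k] GSym (shift 𝒢 1))
    (D' : GSym (shift ℋ 1) →ₗ[k] GSym (shift ℋ 1))
    (F : GSym (shift 𝒢 1) →ₗ[k] GSym (shift ℋ 1)) : Prop where
  homog : IsHomog (grading (shift 𝒢 1)) (grading (shift ℋ 1)) 0 F
  comul : ∀ a, comul (shift ℋ 1) (F a) = TensorProduct.map F F (comul (shift 𝒢 1) a)
  counit : ∀ a, counit (shift ℋ 1) (F a) = counit (shift 𝒢 1) a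
  one : F 1 = 1
  comm : ∀ a, F (D a) = D' (F a)

end LInf
/-! ### Formal power series in `ħ`, `|ħ| = 2` -/

section HSeries

variable {k V W : Type*} [Field k] [Ring V] [Algebra k V] [Ring W] [Algebra k W]

/-- The power series `∑ vₙ ħⁿ` of degree `p`: those with `|vₙ| = p - 2n` for all `n`. -/
def hHomog (𝒱 : ℤ → Submodule k V) (p : ℤ) : Submodule k (PowerSeries V) where
  carrier := {v | ∀ n : ℕ, PowerSeries.coeff n v ∈ 𝒱 (p - 2 * n)}
  zero_mem' n := by simp
  add_mem' ha hb n := by rw [map_add]; exact add_mem (ha n) (hb n)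
  smul_mem' c v hv n := Submodule.smul_mem _ c (hv n)

theorem hHomog_mul (𝒱 : ℤ → Submodule k V) [SetLike.GradedMonoid 𝒱] {p q : ℤ}
    {v w : PowerSeries V} (hv : v ∈ hHomog 𝒱 p) (hw : w ∈ hHomog 𝒱 q) :
    v * w ∈ hHomog 𝒱 (p + q) := by
  intro n
  rw [PowerSeries.coeff_mul]
  refine Submodule.sum_mem _ fun ij hij => ?_
  have := SetLike.GradedMul.mul_mem (hv ij.1) (hw ij.2)
  rw [Finset.HasAntidiagonal.mem_antidiagonal] at hij
  have e : p - 2 * (ij.1 : ℤ) + (q - 2 * (ij.2 : ℤ)) = p + q - 2 * (n : ℤ) := by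
    rw [← hij]; push_cast; ring
  rwa [e] at this

theorem hHomog_one (𝒱 : ℤ → Submodule k V) [SetLike.GradedMonoid 𝒱] :
    (1 : PowerSeries V) ∈ hHomog 𝒱 0 := by
  intro n
  rw [PowerSeries.coeff_one]
  split_ifs with h
  · subst h; simpa using (SetLike.GradedOne.one_mem : (1 : V) ∈ 𝒱 0)
  · exact zero_mem _

/-- The graded algebra `V[[ħ]]` of power series in a variable `ħ` of degree `2` (in the graded
sense): `V[[ħ]] = ⨁ₚ V[[ħ]]^p` with `V[[ħ]]^p = ∏ₙ V^{p-2n} ħⁿ`. -/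
def HSeries (𝒱 : ℤ → Submodule k V) [SetLike.GradedMonoid 𝒱] : Subalgebra k (PowerSeries V) where
  carrier := (⨆ p, hHomog 𝒱 p : Submodule k (PowerSeries V))
  add_mem' ha hb := add_mem ha hb
  mul_mem' {a b} ha hb := by
    have h : (⨆ p, hHomog 𝒱 p) * (⨆ p, hHomog 𝒱 p) ≤ ⨆ p, hHomog 𝒱 p := by
      simp only [Submodule.iSup_mul, Submodule.mul_iSup]
      exact iSup_le fun p => iSup_le fun q =>
        (Submodule.mul_le.2 fun v hv w hw => hHomog_mul 𝒱 hv hw).trans (le_iSup (hHomog 𝒱) (q + p))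
    exact h (Submodule.mul_mem_mul ha hb)
  algebraMap_mem' c := by
    rw [Algebra.algebraMap_eq_smul_one]
    exact Submodule.smul_mem _ c (le_iSup (hHomog 𝒱) 0 (hHomog_one 𝒱))

theorem hHomog_le (𝒱 : ℤ → Submodule k V) [SetLike.GradedMonoid 𝒱] {p : ℤ} {v : PowerSeries V}
    (hv : v ∈ hHomog 𝒱 p) : v ∈ HSeries 𝒱 := le_iSup (hHomog 𝒱) p hv

/-- The degree `p` part `V[[ħ]]^p`. -/
def hGrading (𝒱 : ℤ → Submodule k V) [SetLike.GradedMonoid 𝒱] (p : ℤ) :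
    Submodule k (HSeries 𝒱) := (hHomog 𝒱 p).comap (HSeries 𝒱).val.toLinearMap

theorem mem_hGrading (𝒱 : ℤ → Submodule k V) [SetLike.GradedMonoid 𝒱] {p : ℤ} {v : HSeries 𝒱} :
    v ∈ hGrading 𝒱 p ↔ (v : PowerSeries V) ∈ hHomog 𝒱 p := Iff.rfl

instance (𝒱 : ℤ → Submodule k V) [SetLike.GradedMonoid 𝒱] :
    SetLike.GradedMonoid (hGrading 𝒱) where
  one_mem := hHomog_one 𝒱
  mul_mem _ _ _ _ ha hb := hHomog_mul 𝒱 ha hb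

/-- The coefficient of `ħⁿ`. -/
def hcoeff (𝒱 : ℤ → Submodule k V) [SetLike.GradedMonoid 𝒱] (n : ℕ) : HSeries 𝒱 →ₗ[k] V :=
  ((PowerSeries.coeff n).restrictScalars k : PowerSeries V →ₗ[k] V) ∘ₗ
    (HSeries 𝒱).val.toLinearMap

theorem HSeries_induction (𝒱 : ℤ → Submodule k V) [SetLike.GradedMonoid 𝒱]
    {C : HSeries 𝒱 → Prop} (h0 : ∀ p, ∀ v ∈ hGrading 𝒱 p, C v)
    (h1 : ∀ v w, C v → C w → C (v + w)) (v : HSeries 𝒱) : C v := by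
  have : ∀ w (hw : w ∈ (⨆ p, hHomog 𝒱 p : Submodule k (PowerSeries V))), C ⟨w, hw⟩ := by
    intro w hw
    induction hw using Submodule.iSup_induction' with
    | mem p x hx => exact h0 p ⟨x, hHomog_le 𝒱 hx⟩ hx
    | zero => exact h0 0 0 (zero_mem _)
    | add x y hx hy h h' => exact h1 ⟨x, hx⟩ ⟨y, hy⟩ h h'
  exact this v.1 v.2

theorem hGrading_isInternal (𝒱 : ℤ → Submodule k V) [GradedAlgebra 𝒱] :
    IsInternal (hGrading 𝒱) := by
  constructor
  · intro d d' hd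
    have key : ∀ (d : ⨁ p, hGrading 𝒱 p) (n : ℕ) (p : ℤ),
        (decompose 𝒱 (hcoeff 𝒱 n (DirectSum.coeAddMonoidHom (hGrading 𝒱) d)) (p - 2 * n) : V) =
          hcoeff 𝒱 n (d p) := by
      intro d n p
      induction d using DirectSum.induction_on with
      | zero => simp
      | of q x =>
        rw [DirectSum.coeAddMonoidHom_of]
        have hx : hcoeff 𝒱 n x ∈ 𝒱 (q - 2 * n) := x.2 n
        by_cases h : q = p
        · subst h
          rw [decompose_of_mem_same 𝒱 hx, DirectSum.of_eq_same]
        · rw [decompose_of_mem_ne 𝒱 hx (by omega), DirectSum.of_eq_of_ne _ _ _ (Ne.symm h)]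
          simp
      | add a b ha hb => simp [decompose_add, DirectSum.add_apply, ha, hb]
    refine DFinsupp.ext fun p => Subtype.ext (Subtype.ext (PowerSeries.ext fun n => ?_))
    have h := key d n p
    rw [hd, key d' n p] at h
    exact h.symm
  · intro v
    induction v using HSeries_induction with
    | h0 p v hv => exact ⟨DirectSum.of (fun p => hGrading 𝒱 p) p ⟨v, hv⟩, by simp⟩
    | h1 v w hv hw =>
      obtain ⟨a, rfl⟩ := hv
      obtain ⟨b, rfl⟩ := hw
      exact ⟨a + b, map_add _ _ _⟩

instance (𝒱 : ℤ → Submodule k V) [GradedAlgebra 𝒱] : GradedAlgebra (hGrading 𝒱) where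
  toDecomposition := (hGrading_isInternal 𝒱).chooseDecomposition

instance (𝒱 : ℤ → Submodule k V) [SetLike.GradedMonoid 𝒱] [GrComm 𝒱] : GrComm (hGrading 𝒱) where
  comm p q a b ha hb := by
    refine Subtype.ext (PowerSeries.ext fun n => ?_)
    have e : ∀ (c : k) (v : PowerSeries V), PowerSeries.coeff n (c • v) = c • PowerSeries.coeff n v :=
      fun c v => rfl
    have e' : ((((-1 : k) ^ (p * q)) • (b * a) : HSeries 𝒱) : PowerSeries V) =
      ((-1 : k) ^ (p * q)) • ((b : PowerSeries V) * a) := rfl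
    rw [e', e, PowerSeries.coeff_mul, Finset.smul_sum, MulMemClass.coe_mul, PowerSeries.coeff_mul,
      ← Finset.sum_equiv (Equiv.prodComm ℕ ℕ) (s := Finset.HasAntidiagonal.antidiagonal n)]
    · intro ij; simp [add_comm]
    · intro ij _
      have h := GrComm.comm (k := k) _ _ _ _ (ha ij.2) (hb ij.1)
      have : (p - 2 * (ij.2 : ℤ)) * (q - 2 * (ij.1 : ℤ)) =
        p * q + 2 * (-(p * ij.1) - q * ij.2 + 2 * ij.1 * ij.2) := by ring
      rw [this, zpow_add₀ (by simp), zpow_mul (-1 : k) 2] at h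
      simpa using h.symm

/-- The inclusion `v ↦ v ħⁿ` of `V` into `V[[ħ]]`. -/
def hmonomial (𝒱 : ℤ → Submodule k V) [GradedAlgebra 𝒱] (n : ℕ) : V →ₗ[k] HSeries 𝒱 :=
  LinearMap.codRestrict (Subalgebra.toSubmodule (HSeries 𝒱))
    ((PowerSeries.monomial n).restrictScalars k : V →ₗ[k] PowerSeries V) (by
    intro v
    induction v using Decomposition.inductionOn 𝒱 with
    | zero => rw [map_zero]; exact zero_mem _
    | @homogeneous p m =>
      refine hHomog_le 𝒱 (p := p + 2 * n) fun j => ?_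
      rw [LinearMap.restrictScalars_apply, PowerSeries.coeff_monomial]
      split_ifs with h
      · subst h; simp
      · exact zero_mem _
    | add a b ha hb => rw [map_add]; exact add_mem ha hb)

/-- The linear map `∑ vₙ ħⁿ ↦ ∑ v_{n+m} ħⁿ` on power series. -/
def divAux (k V : Type*) [Field k] [Ring V] [Algebra k V] (m : ℕ) :
    PowerSeries V →ₗ[k] PowerSeries V where
  toFun v := PowerSeries.mk fun n => PowerSeries.coeff (n + m) v
  map_add' v w := by ext n; simp
  map_smul' c v := by
    ext n
    have e : ∀ (c : k) (j : ℕ) (v : PowerSeries V),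
      PowerSeries.coeff j (c • v) = c • PowerSeries.coeff j v := fun c j v => rfl
    simp only [RingHom.id_apply, e, PowerSeries.coeff_mk]

/-- Division by `ħᵐ` on `V[[ħ]]`: `∑ vₙ ħⁿ ↦ ∑ v_{n+m} ħⁿ`. -/
def hdiv (𝒱 : ℤ → Submodule k V) [SetLike.GradedMonoid 𝒱] (m : ℕ) : HSeries 𝒱 →ₗ[k] HSeries 𝒱 :=
  LinearMap.restrict (p := Subalgebra.toSubmodule (HSeries 𝒱))
    (q := Subalgebra.toSubmodule (HSeries 𝒱)) (divAux k V m) (by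
    intro v hv
    refine HSeries_induction 𝒱 (C := fun v => divAux k V m v ∈ HSeries 𝒱) ?_ ?_ ⟨v, hv⟩
    · intro p v hv
      refine hHomog_le 𝒱 (p := p - 2 * m) fun n => ?_
      have := hv (n + m)
      rw [Nat.cast_add] at this
      simp only [divAux, LinearMap.coe_mk, AddHom.coe_mk, PowerSeries.coeff_mk]
      have e : p - 2 * (m : ℤ) - 2 * (n : ℤ) = p - 2 * ((n : ℤ) + m) := by ring
      rw [e]
      exact this
    · intro v w hv hw
      have := add_mem hv hw
      rwa [← map_add] at this)

/-- The continuous `k[[ħ]]`-linear extension of `f : V → W[[ħ]]`: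
`∑ vⱼ ħʲ ↦ ∑ f(vⱼ) ħʲ`. -/
def hextend {𝒲 : ℤ → Submodule k W} [SetLike.GradedMonoid 𝒲] (f : V →ₗ[k] HSeries 𝒲) :
    PowerSeries V →ₗ[k] PowerSeries W where
  toFun v := PowerSeries.mk fun m => ∑ ij ∈ Finset.HasAntidiagonal.antidiagonal m,
    hcoeff 𝒲 ij.1 (f (PowerSeries.coeff ij.2 v))
  map_add' v w := by ext m; simp [Finset.sum_add_distrib]
  map_smul' c v := by
    ext m
    have e : ∀ (c : k) (j : ℕ) (v : PowerSeries V),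
      PowerSeries.coeff j (c • v) = c • PowerSeries.coeff j v := fun c j v => rfl
    have e' : ∀ (c : k) (j : ℕ) (v : PowerSeries W),
      PowerSeries.coeff j (c • v) = c • PowerSeries.coeff j v := fun c j v => rfl
    simp only [RingHom.id_apply, e, e', map_smul, PowerSeries.coeff_mk, Finset.smul_sum]

theorem hextend_mem {𝒱 : ℤ → Submodule k V} {𝒲 : ℤ → Submodule k W}
    [SetLike.GradedMonoid 𝒲] {f : V →ₗ[k] HSeries 𝒲} {d : ℤ}
    (hf : IsHomog 𝒱 (hGrading 𝒲) d f) {p : ℤ} {v : PowerSeries V} (hv : v ∈ hHomog 𝒱 p) :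
    hextend f v ∈ hHomog 𝒲 (p + d) := by
  intro m
  simp only [hextend, LinearMap.coe_mk, AddHom.coe_mk, PowerSeries.coeff_mk]
  refine Submodule.sum_mem _ fun ij hij => ?_
  rw [Finset.HasAntidiagonal.mem_antidiagonal] at hij
  have := hf _ _ (hv ij.2) ij.1
  have e : p - 2 * (ij.2 : ℤ) + d - 2 * (ij.1 : ℤ) = p + d - 2 * (m : ℤ) := by
    rw [← hij]; push_cast; ring
  rwa [e] at this

/-- The extension of a homogeneous map `f : V → W[[ħ]]` as a map `V[[ħ]] → W[[ħ]]`. -/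
def hext {𝒱 : ℤ → Submodule k V} {𝒲 : ℤ → Submodule k W} [SetLike.GradedMonoid 𝒱]
    [SetLike.GradedMonoid 𝒲] {f : V →ₗ[k] HSeries 𝒲} {d : ℤ}
    (hf : IsHomog 𝒱 (hGrading 𝒲) d f) : HSeries 𝒱 →ₗ[k] HSeries 𝒲 :=
  LinearMap.restrict (p := Subalgebra.toSubmodule (HSeries 𝒱))
    (q := Subalgebra.toSubmodule (HSeries 𝒲)) (hextend f) (by
    intro v hv
    refine HSeries_induction 𝒱 (C := fun v => hextend f v ∈ HSeries 𝒲) ?_ ?_ ⟨v, hv⟩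
    · intro p v hv
      exact hHomog_le 𝒲 (hextend_mem hf hv)
    · intro v w hv hw
      have := add_mem hv hw
      rwa [← map_add] at this)

end HSeries

/-! ### Differential operators and higher derived brackets -/

section Brackets

variable {k A : Type*} [Field k] [Ring A] [Algebra k A] (𝒜 : ℤ → Submodule k A)
  [Decomposition 𝒜]

/-- The graded commutator `[T, L_a] = T L_a - (-1)^{|T||a|} L_a T` with the left multiplication by
`a`, as a bilinear function of `a` and of the linear operator `T`. The elements `(a ± τ a)/2` are
the even and the odd part of `a`, where `τ` is the grading involution, and `τ T τ = (-1)^{|T|} T`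
for homogeneous `T`; see `commL_apply_of_homog`. -/
def commL : A →ₗ[k] Module.End k (Module.End k A) :=
  LinearMap.mk₂ k (fun a T => T * LinearMap.mulLeft k a -
      (2 : k)⁻¹ • (LinearMap.mulLeft k (a + parity 𝒜 a) * T +
        LinearMap.mulLeft k (a - parity 𝒜 a) * (parity 𝒜 * T * parity 𝒜)))
    (by intro a b T; ext x; simp only [map_add, LinearMap.sub_apply, LinearMap.add_apply,
          LinearMap.smul_apply, Module.End.mul_apply, LinearMap.mulLeft_apply, add_mul, sub_mul]
        module)
    (by intro c a T; ext x; simp only [map_smul, LinearMap.sub_apply, LinearMap.add_apply,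
          LinearMap.smul_apply, Module.End.mul_apply, LinearMap.mulLeft_apply, add_mul, sub_mul,
          smul_mul_assoc]
        module)
    (by intro a T T'; ext x; simp only [map_add, LinearMap.sub_apply, LinearMap.add_apply,
          LinearMap.smul_apply, Module.End.mul_apply, LinearMap.mulLeft_apply, mul_add]
        module)
    (by intro c a T; ext x; simp only [map_smul, LinearMap.sub_apply, LinearMap.add_apply,
          LinearMap.smul_apply, Module.End.mul_apply, LinearMap.mulLeft_apply, mul_smul_comm]
        module)

theorem commL_apply (a : A) (T : Module.End k A) (x : A) : commL 𝒜 a T x = T (a * x) -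
    (2 : k)⁻¹ • ((a + parity 𝒜 a) * T x +
      (a - parity 𝒜 a) * parity 𝒜 (T (parity 𝒜 x))) := rfl

/-- For `T` homogeneous of degree `d` and `a` homogeneous of degree `q`, `commL` is the graded
commutator `[T, L_a] = T L_a - (-1)^{dq} L_a T`. -/
theorem commL_apply_of_homog [CharZero k] {T : Module.End k A} {d q : ℤ} (hT : IsHomog 𝒜 𝒜 d T)
    {a : A} (ha : a ∈ 𝒜 q) (x : A) :
    commL 𝒜 a T x = T (a * x) - ((-1 : k) ^ (d * q)) • (a * T x) := by
  have hpar : parity 𝒜 (T (parity 𝒜 x)) = ((-1 : k) ^ d) • T x := by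
    induction x using Decomposition.inductionOn 𝒜 with
    | zero => simp
    | @homogeneous p m =>
      rw [parity_of_mem 𝒜 m.2, map_smul, map_smul, parity_of_mem 𝒜 (hT p m m.2), smul_smul,
        ← zpow_add₀ (by simp)]
      congr 1
      rw [← add_assoc, ← two_mul, zpow_add₀ (by simp), zpow_mul]
      simp
    | add x y hx hy => simp only [map_add, hx, hy, smul_add]
  rw [commL_apply, hpar, parity_of_mem 𝒜 ha]
  have h2 : (2 : k) ≠ 0 := two_ne_zero
  rcases Int.even_or_odd q with h | h
  · rw [h.neg_one_zpow, (h.mul_left d).neg_one_zpow]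
    simp only [one_smul, sub_self, zero_mul, add_zero, ← two_smul k a, smul_mul_assoc, smul_smul,
      inv_mul_cancel₀ h2]
  · rw [h.neg_one_zpow, mul_comm d q, zpow_mul, h.neg_one_zpow, neg_one_smul, add_neg_cancel,
      zero_mul, zero_add, sub_neg_eq_add, ← two_smul k a, smul_mul_assoc, smul_smul,
      inv_mul_cancel₀ h2, one_smul, mul_smul_comm]

theorem parity_parity (a : A) : parity 𝒜 (parity 𝒜 a) = a := by
  induction a using Decomposition.inductionOn 𝒜 with
  | zero => simp
  | add x y hx hy => rw [map_add, map_add, hx, hy]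
  | @homogeneous p m =>
    rw [parity_of_mem 𝒜 m.2, map_smul, parity_of_mem 𝒜 m.2, smul_smul, ← mul_zpow]
    simp

/-- The iterated commutator `[[…[T, L_{a₁}], …], L_{aₙ}]`. -/
def iterComm (T : Module.End k A) (l : List A) : Module.End k A :=
  l.foldl (fun S a => commL 𝒜 a S) T

/-- Differential operators of order `≤ n` on a graded commutative algebra. -/
def IsDiffOp (n : ℕ) (T : A →ₗ[k] A) : Prop :=
  ∀ l : List A, l.length = n + 1 → iterComm 𝒜 T l = 0

end Brackets

section HigherBrackets

variable {k A : Type*} [Field k] [CharZero k] [Ring A] [Algebra k A] (𝒜 : ℤ → Submodule k A)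
  [GradedAlgebra 𝒜]

theorem parity_mul (a b : A) : parity 𝒜 (a * b) = parity 𝒜 a * parity 𝒜 b := by
  induction a using Decomposition.inductionOn 𝒜 with
  | zero => simp
  | add x y hx hy => rw [add_mul, map_add, hx, hy, map_add, add_mul]
  | @homogeneous p m =>
    induction b using Decomposition.inductionOn 𝒜 with
    | zero => simp
    | add x y hx hy => rw [mul_add, map_add, hx, hy, map_add, mul_add]
    | @homogeneous q n =>
      rw [parity_of_mem 𝒜 m.2, parity_of_mem 𝒜 n.2,
        parity_of_mem 𝒜 (SetLike.GradedMul.mul_mem m.2 n.2), zpow_add₀ (by simp),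
        smul_mul_smul_comm]

theorem commL_even {q : ℤ} {a : A} (ha : a ∈ 𝒜 q) (hq : Even q) (T : Module.End k A) (x : A) :
    commL 𝒜 a T x = T (a * x) - a * T x := by
  have h2 : (2 : k) ≠ 0 := two_ne_zero
  rw [commL_apply, parity_of_mem 𝒜 ha, hq.neg_one_zpow, one_smul, sub_self, zero_mul, add_zero,
    ← two_smul k a, smul_mul_assoc, smul_smul, inv_mul_cancel₀ h2, one_smul]

theorem commL_odd {q : ℤ} {a : A} (ha : a ∈ 𝒜 q) (hq : Odd q) (T : Module.End k A) (x : A) :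
    commL 𝒜 a T x = T (a * x) - a * parity 𝒜 (T (parity 𝒜 x)) := by
  have h2 : (2 : k) ≠ 0 := two_ne_zero
  rw [commL_apply, parity_of_mem 𝒜 ha, hq.neg_one_zpow, neg_one_smul, add_neg_cancel,
      zero_mul, zero_add, sub_neg_eq_add, ← two_smul k a, smul_mul_assoc, smul_smul,
      inv_mul_cancel₀ h2, one_smul]

/-- The operators `T ↦ [T, L_a]` and `T ↦ [T, L_b]` commute up to the Koszul sign. -/
theorem commL_comm [GrComm 𝒜] {p q : ℤ} {a b : A} (ha : a ∈ 𝒜 p) (hb : b ∈ 𝒜 q)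
    (T : Module.End k A) :
    commL 𝒜 b (commL 𝒜 a T) = ((-1 : k) ^ (p * q)) • commL 𝒜 a (commL 𝒜 b T) := by
  have hab := GrComm.comm p q a b ha hb
  ext x
  rw [LinearMap.smul_apply]
  have hpa := parity_of_mem 𝒜 ha
  have hpb := parity_of_mem 𝒜 hb
  rcases Int.even_or_odd p with hp | hp <;> rcases Int.even_or_odd q with hq | hq
  · rw [(hp.mul_right q).neg_one_zpow] at hab ⊢
    rw [one_smul] at hab ⊢
    simp only [commL_even 𝒜 ha hp, commL_even 𝒜 hb hq, mul_sub, ← mul_assoc, hab]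
    abel
  · rw [(hp.mul_right q).neg_one_zpow] at hab ⊢
    rw [hp.neg_one_zpow, one_smul] at hpa
    rw [hq.neg_one_zpow, neg_one_smul] at hpb
    rw [one_smul] at hab ⊢
    simp only [commL_even 𝒜 ha hp, commL_odd 𝒜 hb hq, mul_sub, ← mul_assoc, hab, map_sub,
      parity_mul, hpa]
    abel
  · rw [(hq.mul_left p).neg_one_zpow] at hab ⊢
    rw [hp.neg_one_zpow, neg_one_smul] at hpa
    rw [hq.neg_one_zpow, one_smul] at hpb
    rw [one_smul] at hab ⊢
    simp only [commL_even 𝒜 hb hq, commL_odd 𝒜 ha hp, mul_sub, ← mul_assoc, hab, map_sub,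
      parity_mul, hpb]
    abel
  · rw [(hp.mul hq).neg_one_zpow] at hab ⊢
    rw [hp.neg_one_zpow, neg_one_smul] at hpa
    rw [hq.neg_one_zpow, neg_one_smul] at hpb
    rw [neg_one_smul] at hab ⊢
    simp only [commL_odd 𝒜 ha hp, commL_odd 𝒜 hb hq, mul_sub, ← mul_assoc, hab, map_sub,
      parity_mul, hpa, hpb, parity_parity, neg_mul, mul_neg, map_neg]
    abel

/-- The homomorphism from `S(A)` that sends `a₁ ⋯ aₙ` to the operator
`T ↦ [[…[T, L_{a₁}], …], L_{aₙ}]` on `End A`. -/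
def iterCommHom [GrComm 𝒜] : GSym 𝒜 →ₐ[k] (Module.End k (Module.End k A))ᵐᵒᵖ :=
  GSym.lift 𝒜 ((MulOpposite.opLinearEquiv k).toLinearMap ∘ₗ commL 𝒜) (by
    intro p q a b ha hb
    apply MulOpposite.unop_injective
    refine LinearMap.ext fun T => ?_
    exact commL_comm 𝒜 ha hb T)

/-- The higher derived brackets of an operator `T` on `A`, as a linear map `S(A) → A`:
`a₁ ⋯ aₙ ↦ [[…[T, L_{a₁}], …], L_{aₙ}] 1`; see `higherBracket_prod`. -/
def higherBracket [GrComm 𝒜] (T : Module.End k A) : GSym 𝒜 →ₗ[k] A :=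
  LinearMap.applyₗ (1 : A) ∘ₗ LinearMap.applyₗ T ∘ₗ
    (MulOpposite.opLinearEquiv k).symm.toLinearMap ∘ₗ (iterCommHom 𝒜).toLinearMap

theorem higherBracket_prod [GrComm 𝒜] (T : Module.End k A) (l : List A) :
    higherBracket 𝒜 T (l.map (GSym.ι 𝒜)).prod = iterComm 𝒜 T l 1 := by
  have : ∀ l : List A, MulOpposite.unop (iterCommHom 𝒜 (l.map (GSym.ι 𝒜)).prod) T =
      iterComm 𝒜 T l := by
    intro l
    induction l generalizing T with
    | nil => simp [iterComm]
    | cons a l ih =>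
      rw [List.map_cons, List.prod_cons, map_mul, MulOpposite.unop_mul, Module.End.mul_apply, ih,
        iterCommHom, GSym.lift_ι]
      rfl
  exact congrArg (fun S : Module.End k A => S 1) (this l)

end HigherBrackets

/-! ### `BV∞`-algebras and their morphisms -/

section BV

variable {k V W U : Type*} [Field k] [Ring V] [Algebra k V] [Ring W] [Algebra k W]
  [AddCommGroup U] [Module k U]

/-- A `BV∞`-structure on the graded commutative algebra `V`: a linear map `Δ : V → V[[ħ]]` of
degree one, `Δ = ħ⁻¹ ∑_{n ≥ 1} ħⁿ Δₙ`, such that `Δₙ` is a differential operator of order `≤ n`,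
`Δ² = 0` and `Δ(1) = 0`. -/
structure IsBVInf (𝒱 : ℤ → Submodule k V) [GradedAlgebra 𝒱] (Δ : V →ₗ[k] HSeries 𝒱) : Prop where
  homog : IsHomog 𝒱 (hGrading 𝒱) 1 Δ
  order : ∀ n : ℕ, 1 ≤ n → IsDiffOp 𝒱 n (hcoeff 𝒱 (n - 1) ∘ₗ Δ)
  sq : ∀ v, hextend Δ (Δ v : PowerSeries V) = 0
  one : Δ 1 = 0

/-- A `BV∞`-morphism `φ` from a `BV∞`-algebra `(S(U), Δ)`, free as a graded commutative algebra, to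
a `BV∞`-algebra `(V, Δ')`: a linear map `φ : S(U) → V[[ħ]]` of degree zero with `φ(1) = 0`,
`exp(φ) Δ = Δ' exp(φ)`, and `φ = ħ⁻¹ ∑_{n ≥ 1} ħⁿ φₙ` where `φₙ` vanishes on `S^{>n}(U)`. -/
structure IsBVMorphism {𝒰 : ℤ → Submodule k U} [Decomposition 𝒰] {𝒱 : ℤ → Submodule k V}
    [GradedAlgebra 𝒱] (Δ : GSym 𝒰 →ₗ[k] HSeries (GSym.grading 𝒰)) (Δ' : V →ₗ[k] HSeries 𝒱)
    (φ : GSym 𝒰 →ₗ[k] HSeries 𝒱) : Prop where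
  homog : IsHomog (GSym.grading 𝒰) (hGrading 𝒱) 0 φ
  one : φ 1 = 0
  comm : ∀ x, hextend (GSym.convExp 𝒰 φ) (Δ x : PowerSeries (GSym 𝒰)) =
    hextend Δ' (GSym.convExp 𝒰 φ x : PowerSeries V)
  order : ∀ n m : ℕ, 1 ≤ n → n < m → ∀ x ∈ GSym.symPow 𝒰 m, hcoeff 𝒱 (n - 1) (φ x) = 0

/-- The extension `V[[ħ]] → W[[ħ]]` of `exp(ψ)`, for `ψ` of degree zero. -/
def expExt {𝒰 : ℤ → Submodule k U} [Decomposition 𝒰] {𝒱 : ℤ → Submodule k V}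
    [GradedAlgebra 𝒱] {ψ : GSym 𝒰 →ₗ[k] HSeries 𝒱}
    (hψ : IsHomog (GSym.grading 𝒰) (hGrading 𝒱) 0 ψ) :
    HSeries (GSym.grading 𝒰) →ₗ[k] HSeries 𝒱 :=
  hext (GSym.convExp_isHomog 𝒰 (hGrading 𝒱) hψ)

/-- The composition `ψ ⋄ φ = log(exp(ψ) ∘ exp(φ))`. -/
def diamond {U' : Type*} [AddCommGroup U'] [Module k U'] {𝒰 : ℤ → Submodule k U} [Decomposition 𝒰]
    {𝒰' : ℤ → Submodule k U'} [Decomposition 𝒰'] {𝒱 : ℤ → Submodule k V} [GradedAlgebra 𝒱]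
    {ψ : GSym 𝒰' →ₗ[k] HSeries 𝒱} (hψ : IsHomog (GSym.grading 𝒰') (hGrading 𝒱) 0 ψ)
    (φ : GSym 𝒰 →ₗ[k] HSeries (GSym.grading 𝒰')) : GSym 𝒰 →ₗ[k] HSeries 𝒱 :=
  GSym.convLog 𝒰 (expExt hψ ∘ₗ GSym.convExp 𝒰 φ)

end BV

/-! ### The two constructions -/

section Functors

open GSym

variable {k G H U V : Type*} [Field k] [AddCommGroup G] [Module k G] [AddCommGroup H] [Module k H]
  [AddCommGroup U] [Module k U] [Ring V] [Algebra k V]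

/-- The identification `S(𝔤[1]) → S(𝔤[-1])` by double suspension. -/
def susp (𝒢 : ℤ → Submodule k G) : GSym (shift 𝒢 1) →ₐ[k] GSym (shift 𝒢 (-1)) :=
  regrade (shift 𝒢 1) (shift 𝒢 (-1)) 1 (fun p => le_of_eq (congrArg 𝒢 (by ring)))

/-- The inverse identification `S(𝔤[-1]) → S(𝔤[1])`. -/
def desusp (𝒢 : ℤ → Submodule k G) : GSym (shift 𝒢 (-1)) →ₐ[k] GSym (shift 𝒢 1) :=
  regrade (shift 𝒢 (-1)) (shift 𝒢 1) (-1) (fun p => le_of_eq (congrArg 𝒢 (by ring)))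

/-- The operator `Dₙ` on `S(𝔤[-1])`,
`Dₙ(x₁ ⋯ x_m) = ∑_{σ ∈ Sh(n,m-n)} ± lₙ(x_{σ(1)}, …, x_{σ(n)}) x_{σ(n+1)} ⋯ x_{σ(m)}`, where `lₙ` is
the restriction to `Sⁿ` of the projection of `D` to the cogenerators. -/
def coderComponent (𝒢 : ℤ → Submodule k G) [Decomposition 𝒢]
    (D : GSym (shift 𝒢 1) →ₗ[k] GSym (shift 𝒢 1)) (n : ℕ) :
    GSym (shift 𝒢 (-1)) →ₗ[k] GSym (shift 𝒢 (-1)) :=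
  conv (shift 𝒢 (-1)) (ι (shift 𝒢 (-1)) ∘ₗ toCogen (shift 𝒢 1) ∘ₗ D ∘ₗ (desusp 𝒢).toLinearMap ∘ₗ
    proj (shift 𝒢 (-1)) n) LinearMap.id

/-- The `BV∞`-operator `Δ = ħ⁻¹ ∑_{n ≥ 1} ħⁿ Dₙ` on `S(𝔤[-1])` of an `L∞`-algebra `(𝔤, D)`. Note that
`Dₙ` vanishes on `S^m` for `n > m`. -/
def bvOfLInf (𝒢 : ℤ → Submodule k G) [Decomposition 𝒢]
    (D : GSym (shift 𝒢 1) →ₗ[k] GSym (shift 𝒢 1)) :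
    GSym (shift 𝒢 (-1)) →ₗ[k] HSeries (grading (shift 𝒢 (-1))) :=
  weightwise (shift 𝒢 (-1)) fun m => ∑ n ∈ Finset.Icc 1 m,
    hmonomial (grading (shift 𝒢 (-1))) (n - 1) ∘ₗ coderComponent 𝒢 D n

/-- The `BV∞`-morphism `φ_ħ = ħ⁻¹ ∑_{n ≥ 1} ħⁿ φₙ : S(𝔤[-1]) → S(𝔥[-1])[[ħ]]` of an `L∞`-morphism
`F : 𝔤 → 𝔥`, where `φₙ` is the projection of `F` to the cogenerators on `Sⁿ` and zero on the other
symmetric powers. -/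
def bvOfLInfMorphism {𝒢 : ℤ → Submodule k G} [Decomposition 𝒢] {ℋ : ℤ → Submodule k H}
    [Decomposition ℋ] (F : GSym (shift 𝒢 1) →ₗ[k] GSym (shift ℋ 1)) :
    GSym (shift 𝒢 (-1)) →ₗ[k] HSeries (grading (shift ℋ (-1))) :=
  weightwise (shift 𝒢 (-1)) fun n => hmonomial (grading (shift ℋ (-1))) (n - 1) ∘ₗ
    ι (shift ℋ (-1)) ∘ₗ toCogen (shift ℋ 1) ∘ₗ F ∘ₗ (desusp 𝒢).toLinearMap

variable {𝒱 : ℤ → Submodule k V} [GradedAlgebra 𝒱]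

/-- The graded vector space `V[[ħ]][1]`. -/
abbrev hShift (𝒱 : ℤ → Submodule k V) [GradedAlgebra 𝒱] : ℤ → Submodule k (HSeries 𝒱) :=
  shift (hGrading 𝒱) 1

/-- The identification of `S(V[[ħ]][2])` with `S(V[[ħ]])`. -/
def hRegrade (𝒱 : ℤ → Submodule k V) [GradedAlgebra 𝒱] :
    GSym (shift (hShift 𝒱) 1) →ₐ[k] GSym (hGrading 𝒱) :=
  regrade (shift (hShift 𝒱) 1) (hGrading 𝒱) 1
    (fun p => le_of_eq (congrArg (hGrading 𝒱) (by ring)))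

section Derived

variable [CharZero k] [GrComm 𝒱]

/-- The brackets `l^ħₙ(a₁, …, aₙ) = [[…[Δ, L_{a₁}], …], L_{aₙ}] 1` on `V[[ħ]]`, as a linear map on
`S(V[[ħ]][2])`. -/
def hBracket {Δ : V →ₗ[k] HSeries 𝒱} (hΔ : IsBVInf 𝒱 Δ) :
    GSym (shift (hShift 𝒱) 1) →ₗ[k] HSeries 𝒱 :=
  higherBracket (hGrading 𝒱) (hext hΔ.homog) ∘ₗ (hRegrade 𝒱).toLinearMap

/-- The modified brackets `Lₙ = ħ^{1-n} l^ħₙ`, as a linear map on `S(V[[ħ]][2])`. -/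
def modifiedBracket {Δ : V →ₗ[k] HSeries 𝒱} (hΔ : IsBVInf 𝒱 Δ) :
    GSym (shift (hShift 𝒱) 1) →ₗ[k] HSeries 𝒱 :=
  weightwise (shift (hShift 𝒱) 1) fun n => hdiv 𝒱 (n - 1) ∘ₗ hBracket hΔ

/-- The `L∞`-structure on `V[[ħ]][1]` given by the modified brackets `Lₙ`: the coderivation
`D(a₁ ⋯ a_m) = ∑ₙ ∑_{σ ∈ Sh(n,m-n)} ± Lₙ(a_{σ(1)}, …, a_{σ(n)}) a_{σ(n+1)} ⋯ a_{σ(m)}`. -/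
def derivedLInf {Δ : V →ₗ[k] HSeries 𝒱} (hΔ : IsBVInf 𝒱 Δ) :
    GSym (shift (hShift 𝒱) 1) →ₗ[k] GSym (shift (hShift 𝒱) 1) :=
  conv (shift (hShift 𝒱) 1) (ι (shift (hShift 𝒱) 1) ∘ₗ modifiedBracket hΔ) LinearMap.id

end Derived

/-- The conversion formula `φ|_{S^m} = ħ^{m-1} f|_{S^m}`, `m ≥ 1`, between a map `φ : S(𝔤[-1]) → V[[ħ]]`
and the projection `f` of a map `F : S(𝔤[1]) → S(V[[ħ]][2])` to the cogenerators. -/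
def Corresponds (𝒢 : ℤ → Submodule k G) (φ : GSym (shift 𝒢 (-1)) →ₗ[k] HSeries 𝒱)
    (F : GSym (shift 𝒢 1) →ₗ[k] GSym (shift (hShift 𝒱) 1)) : Prop :=
  ∀ m : ℕ, 1 ≤ m → ∀ x ∈ symPow (shift 𝒢 1) m, (φ (susp 𝒢 x) : PowerSeries V) =
    (PowerSeries.X : PowerSeries V) ^ (m - 1) *
      ((toCogen (shift (hShift 𝒱) 1) (F x) : HSeries 𝒱) : PowerSeries V)

/-- The components `f|_{S^m} = ħ^{1-m} φ|_{S^m}`, for `φ : S(𝔤[-1]) → V[[ħ]]`. -/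
def adjComponents (𝒢 : ℤ → Submodule k G) (φ : GSym (shift 𝒢 (-1)) →ₗ[k] HSeries 𝒱) :
    GSym (shift 𝒢 1) →ₗ[k] HSeries 𝒱 :=
  weightwise (shift 𝒢 1) fun m => hdiv 𝒱 (m - 1) ∘ₗ φ ∘ₗ (susp 𝒢).toLinearMap

/-- The coalgebra morphism `F : S(𝔤[1]) → S(V[[ħ]][2])` with components `f|_{S^m} = ħ^{1-m} φ|_{S^m}`:
`F(x₁ ⋯ x_m) = ∑ⱼ 1/j! ∑_{i₁+⋯+i_j=m} ∑_{σ ∈ Sh(i₁,…,i_j)} ± f(x_{σ(1)} ⋯ x_{σ(i₁)}) ⋯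
f(x_{σ(m-i_j+1)} ⋯ x_{σ(m)})`. -/
def adj (𝒢 : ℤ → Submodule k G) [Decomposition 𝒢] (φ : GSym (shift 𝒢 (-1)) →ₗ[k] HSeries 𝒱) :
    GSym (shift 𝒢 1) →ₗ[k] GSym (shift (hShift 𝒱) 1) :=
  convExp (shift 𝒢 1) (ι (shift (hShift 𝒱) 1) ∘ₗ adjComponents 𝒢 φ)

/-- The multiplication `S(V[[ħ]]) → V[[ħ]]`, where `V[[ħ]]` is written as `𝔤[-1]`, `𝔤 = V[[ħ]][1]`. -/
def hMultiplication (𝒱 : ℤ → Submodule k V) [GradedAlgebra 𝒱] [GrComm 𝒱] :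
    GSym (shift (hShift 𝒱) (-1)) →ₐ[k] HSeries 𝒱 :=
  (lift (hGrading 𝒱) LinearMap.id (GrComm.comm (𝒜 := hGrading 𝒱))).comp
    (regrade (shift (hShift 𝒱) (-1)) (hGrading 𝒱) 0
      (fun p => le_of_eq (congrArg (hGrading 𝒱) (by ring))))

variable {𝒰 : ℤ → Submodule k U} [Decomposition 𝒰]

/-- The composition `ψ ⋄ p₁ : S(S(U)[[ħ]]) → V[[ħ]]` of `ψ : S(U) → V[[ħ]]` with the `BV∞`-morphism `p₁`
(the projection to the linear component), whose exponential is the multiplication map: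
`ψ ⋄ p₁ = log(exp(ψ) ∘ multiplication)`, extended from `S(U)` to `S(U)[[ħ]]` by continuity and
`ħ`-linearity in each argument. -/
def diamondCounit {ψ : GSym 𝒰 →ₗ[k] HSeries 𝒱} (hψ : IsHomog (grading 𝒰) (hGrading 𝒱) 0 ψ) :
    GSym (shift (hShift (grading 𝒰)) (-1)) →ₗ[k] HSeries 𝒱 :=
  convLog (shift (hShift (grading 𝒰)) (-1))
    (expExt hψ ∘ₗ (hMultiplication (grading 𝒰)).toLinearMap)

/-- The `L∞`-morphism `S(U)[[ħ]][1] → V[[ħ]][1]` induced by a `BV∞`-morphism `ψ : S(U) → V`: the one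
that corresponds to the `BV∞`-morphism `ψ ⋄ p₁`. -/
def inducedLInfMorphism {ψ : GSym 𝒰 →ₗ[k] HSeries 𝒱}
    (hψ : IsHomog (grading 𝒰) (hGrading 𝒱) 0 ψ) :
    GSym (shift (hShift (grading 𝒰)) 1) →ₗ[k] GSym (shift (hShift 𝒱) 1) :=
  adj (hShift (grading 𝒰)) (diamondCounit hψ)

end Functors

end HBV

end

open HBV

/-!
The comultiplication of `S(U)` makes the linear maps `S(U) → B` to a graded commutative algebra an
algebra under convolution, in which `exp` and `log` are the usual power series; they are mutually
inverse by the chain rule for coderivations (`ser_coder`), applied to the multiplications by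
elements of `U`. A coalgebra morphism is the exponential, and a coderivation the extension, of its
projection to the cogenerators (`eq_convExp_of_isCoalgHom`, `isCoalgHom_convExp`,
`eq_conv_of_isCoder`, `isCoder_conv_id`).

The powers of `ħ` are absorbed by working with Laurent series. For `f : S(𝔤[-1]) → V[[ħ]]` let
`θ(f)` be the map `S(𝔤[1]) → V((ħ))` equal to `ħ^{-m} f` on `Sᵐ`. As `θ` is compatible with
convolution, `θ(exp φ) = exp(θ φ)`, and the relation `φ = ħ^{m-1} f` on `Sᵐ` becomes
`θ(exp φ) = μ_ħ F`, where `F = exp(f)` is the coalgebra morphism with the components `f` and `μ_ħ` is the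
algebra homomorphism `a₁ ⋯ a_m ↦ ħ^{-m} a₁ ⋯ a_m` on `S(V[[ħ]][2])` (`theta_convExp_eq_muh_adj`,
`hasOrder_and_adj_eq`). Two identities then turn one structure into the other:
* `θ` carries `Δ_𝔤` to `D`, because the component `D_n` lowers the length of words by `n - 1` and
  comes with the factor `ħ^{n-1}` (`theta_bvOfLInf`);
* `μ_ħ` carries the codifferential `D_V` given by the modified brackets to `Δ`. This is Koszul's
  expression of `Δ(a₁ ⋯ a_m)` through the higher brackets of `Δ` (`comp_mulHom`, `lext_muh`).

Thus `exp(φ) Δ_𝔤 = Δ exp(φ)` means `μ_ħ F D = μ_ħ D_V F`. Although `μ_ħ` is not injective, this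
implies `F D = D_V F`: both sides are of the form `e * F` with `e` valued in the cogenerators, `F`
can be cancelled, and `μ_ħ` is injective on the cogenerators (`eq_zero_of_conv_muh`). The same
argument gives `D_V² = 0`, and the naturality statements follow from
`θ(exp(ψ ⋄ φ)) = exp(ψ) θ(exp φ)`. The square of `Δ_𝔤` vanishes since that of `D` does, and `D_n` has order `≤ n` because its
commutator with the multiplication by a generator is the extension of a map with one argument fewer
(`conv_id_mem_diffOp`).

The brackets `l^ħ_n` are divisible by `ħ^{n-1}` because each commutator lowers the orders of the
coefficients of `Δ` by one, so that after `n` steps those of `ħ^i` with `i < n - 1` are zero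
(`HasSymbol`). That `κ = ψ ⋄ p₁` is divisible by `ħ^{r-1}` on `Sʳ` is clear from the order of `ψ`
for products of elements of `U`; the general case is reduced to it by the formula for `κ(ab ⋅ w)`
(`diamondCounit_mulι_mul`, `hasOrder_diamondCounit`).
-/

noncomputable section

set_option linter.unusedSectionVars false

namespace HBV

/-! ### Koszul signs and words -/

section Koszul

variable {k A : Type*} [Field k] [AddCommGroup A] [Module k A] (𝒜 : ℤ → Submodule k A)
  [Decomposition 𝒜]

/-- The sign operator `a ↦ (-1)^{d|a|} a`. -/
def koszul (d : ℤ) : A →ₗ[k] A := if Even d then LinearMap.id else parity 𝒜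

theorem koszul_of_mem (d : ℤ) {p : ℤ} {a : A} (ha : a ∈ 𝒜 p) :
    koszul 𝒜 d a = ((-1 : k) ^ (d * p)) • a := by
  unfold koszul
  split_ifs with h
  · rw [(h.mul_right p).neg_one_zpow, one_smul, LinearMap.id_apply]
  · rw [parity_of_mem 𝒜 ha, zpow_mul, (Int.not_even_iff_odd.1 h).neg_one_zpow]

theorem koszul_zero : koszul 𝒜 0 = LinearMap.id := by simp [koszul]

theorem koszul_one : koszul 𝒜 1 = parity 𝒜 := by simp [koszul]

theorem linearMap_ext_homog {M : Type*} [AddCommGroup M] [Module k M] {f g : A →ₗ[k] M}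
    (h : ∀ p, ∀ a ∈ 𝒜 p, f a = g a) : f = g := by
  ext a
  induction a using Decomposition.inductionOn 𝒜 with
  | zero => simp
  | add x y hx hy => rw [map_add, map_add, hx, hy]
  | @homogeneous p m => exact h p m m.2

theorem koszul_comp_koszul (d e : ℤ) : koszul 𝒜 d ∘ₗ koszul 𝒜 e = koszul 𝒜 (d + e) := by
  refine linearMap_ext_homog 𝒜 fun p a ha => ?_
  rw [LinearMap.comp_apply, koszul_of_mem 𝒜 e ha, map_smul, koszul_of_mem 𝒜 d ha,
    koszul_of_mem 𝒜 _ ha, smul_smul, ← zpow_add₀ (by simp)]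
  congr 2; ring

theorem neg_one_zpow_mul_self (n : ℤ) : ((-1 : k) ^ n) * ((-1 : k) ^ n) = 1 := by
  rw [← mul_zpow]; simp

end Koszul

namespace GSym

section Words

variable {k U : Type*} [Field k] [AddCommGroup U] [Module k U] (𝒰 : ℤ → Submodule k U)

/-- Left multiplication by the generator `x`. -/
def mulι (x : U) : GSym 𝒰 →ₗ[k] GSym 𝒰 := LinearMap.mulLeft k (ι 𝒰 x)

@[simp] theorem mulι_apply (x : U) (a : GSym 𝒰) : mulι 𝒰 x a = ι 𝒰 x * a := rfl

/-- The product `x₁ ⋯ x_m` of a word whose letters carry their degrees. -/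
def wprod (l : List (ℤ × U)) : GSym 𝒰 := (l.map fun t => ι 𝒰 t.2).prod

@[simp] theorem wprod_nil : wprod 𝒰 [] = 1 := rfl

theorem wprod_cons (t : ℤ × U) (l : List (ℤ × U)) :
    wprod 𝒰 (t :: l) = ι 𝒰 t.2 * wprod 𝒰 l := rfl

theorem wprod_append (l l' : List (ℤ × U)) :
    wprod 𝒰 (l ++ l') = wprod 𝒰 l * wprod 𝒰 l' := by simp [wprod]

/-- The letters of the word are homogeneous, of the degrees they carry. -/
def IsWord (l : List (ℤ × U)) : Prop := ∀ t ∈ l, t.2 ∈ 𝒰 t.1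

theorem isWord_nil : IsWord 𝒰 [] := by simp [IsWord]

variable {𝒰} in
theorem isWord_cons {t : ℤ × U} {l : List (ℤ × U)} :
    IsWord 𝒰 (t :: l) ↔ t.2 ∈ 𝒰 t.1 ∧ IsWord 𝒰 l := by simp [IsWord]

variable {𝒰} in
theorem isWord_append {l l' : List (ℤ × U)} :
    IsWord 𝒰 (l ++ l') ↔ IsWord 𝒰 l ∧ IsWord 𝒰 l' := by
  simp only [IsWord, List.mem_append]
  exact ⟨fun h => ⟨fun t ht => h t (Or.inl ht), fun t ht => h t (Or.inr ht)⟩,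
    fun h t ht => ht.elim (h.1 t) (h.2 t)⟩

theorem wprod_mem {l : List (ℤ × U)} (hl : IsWord 𝒰 l) :
    wprod 𝒰 l ∈ grading 𝒰 (l.map Prod.fst).sum :=
  Submodule.subset_span ⟨l, hl, rfl, rfl⟩

theorem weightwise_wprod {M : Type*} [AddCommGroup M] [Module k M] (f : ℕ → GSym 𝒰 →ₗ[k] M)
    (l : List (ℤ × U)) : weightwise 𝒰 f (wprod 𝒰 l) = f l.length (wprod 𝒰 l) := by
  have := weightwise_prod 𝒰 f (l.map Prod.snd)
  simp only [List.map_map, List.length_map] at this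
  exact this

theorem proj_wprod (n : ℕ) (l : List (ℤ × U)) :
    proj 𝒰 n (wprod 𝒰 l) = if l.length = n then wprod 𝒰 l else 0 := by
  have := weightHom_prod 𝒰 (l.map Prod.snd)
  simp only [List.map_map, List.length_map] at this
  change Polynomial.coeff (weightHom 𝒰 (wprod 𝒰 l)) n = _
  erw [this]
  rw [Polynomial.coeff_monomial]
  rfl

theorem isHomog_of_words {M : Type*} [AddCommGroup M] [Module k M] (ℳ : ℤ → Submodule k M)
    {d : ℤ} {f : GSym 𝒰 →ₗ[k] M}
    (h : ∀ l, IsWord 𝒰 l → f (wprod 𝒰 l) ∈ ℳ ((l.map Prod.fst).sum + d)) :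
    IsHomog (grading 𝒰) ℳ d f := by
  intro p a ha
  induction ha using Submodule.span_induction with
  | mem a h' =>
    obtain ⟨l, hl, rfl, rfl⟩ := h'
    exact h l hl
  | zero => simp
  | add a b _ _ h h' => rw [map_add]; exact add_mem h h'
  | smul c a _ h => rw [map_smul]; exact Submodule.smul_mem _ _ h

variable {𝒰} in
theorem _root_.HBV.IsHomog.word {M : Type*} [AddCommGroup M] [Module k M]
    {ℳ : ℤ → Submodule k M} {d : ℤ} {f : GSym 𝒰 →ₗ[k] M} (h : IsHomog (grading 𝒰) ℳ d f)
    {l : List (ℤ × U)} (hl : IsWord 𝒰 l) :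
    f (wprod 𝒰 l) ∈ ℳ ((l.map Prod.fst).sum + d) := h _ _ (wprod_mem 𝒰 hl)

variable [Decomposition 𝒰]

theorem ext_words {M : Type*} [AddCommGroup M] [Module k M] {f g : GSym 𝒰 →ₗ[k] M}
    (h : ∀ l, IsWord 𝒰 l → f (wprod 𝒰 l) = g (wprod 𝒰 l)) : f = g := by
  refine linearMap_ext_homog (grading 𝒰) fun p a ha => ?_
  induction ha using Submodule.span_induction with
  | mem a h' =>
    obtain ⟨l, hl, rfl, rfl⟩ := h'
    exact h l hl
  | zero => simp
  | add a b _ _ h h' => rw [map_add, map_add, h, h']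
  | smul c a _ h => rw [map_smul, map_smul, h]

/-- `Sᵐ(U)` is spanned by the words of length `m`. -/
theorem symPow_le_span (m : ℕ) : symPow 𝒰 m ≤
    Submodule.span k {a | ∃ l, IsWord 𝒰 l ∧ l.length = m ∧ a = wprod 𝒰 l} := by
  induction m with
  | zero =>
    rw [symPow, pow_zero, Submodule.one_eq_span]
    exact Submodule.span_mono (by rintro _ rfl; exact ⟨[], isWord_nil 𝒰, rfl, rfl⟩)
  | succ m ih =>
    rw [symPow, pow_succ']
    refine Submodule.mul_le.2 ?_
    rintro _ ⟨x, rfl⟩ b hb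
    have hb' := ih hb
    clear hb
    induction hb' using Submodule.span_induction with
    | mem b h' =>
      obtain ⟨l, hl, rfl, rfl⟩ := h'
      induction x using Decomposition.inductionOn 𝒰 with
      | zero => simp
      | add x y hx hy => rw [map_add, add_mul]; exact add_mem hx hy
      | @homogeneous p x =>
        exact Submodule.subset_span ⟨(p, (x : U)) :: l, isWord_cons.2 ⟨x.2, hl⟩, rfl, rfl⟩
    | zero => simp
    | add a b _ _ h h' => rw [mul_add]; exact add_mem h h'
    | smul c a _ h => rw [mul_smul_comm]; exact Submodule.smul_mem _ _ h

theorem symPow_ext {M : Type*} [AddCommGroup M] [Module k M] {f g : GSym 𝒰 →ₗ[k] M} {m : ℕ}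
    (h : ∀ l, IsWord 𝒰 l → l.length = m → f (wprod 𝒰 l) = g (wprod 𝒰 l)) {x : GSym 𝒰}
    (hx : x ∈ symPow 𝒰 m) : f x = g x := by
  have hx' := symPow_le_span 𝒰 m hx
  clear hx
  induction hx' using Submodule.span_induction with
  | mem a h' =>
    obtain ⟨l, hl, hm, rfl⟩ := h'
    exact h l hl hm
  | zero => simp
  | add a b _ _ h h' => rw [map_add, map_add, h, h']
  | smul c a _ h => rw [map_smul, map_smul, h]

theorem wprod_mem_symPow (l : List (ℤ × U)) : wprod 𝒰 l ∈ symPow 𝒰 l.length := by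
  induction l with
  | nil => exact Submodule.one_le.1 (by simp [symPow])
  | cons t l ih =>
    rw [List.length_cons, symPow, pow_succ', wprod_cons]
    exact Submodule.mul_mem_mul ⟨_, rfl⟩ ih

theorem koszul_mulι (d : ℤ) {p : ℤ} {x : U} (hx : x ∈ 𝒰 p) :
    koszul (grading 𝒰) d ∘ₗ mulι 𝒰 x =
      ((-1 : k) ^ (d * p)) • (mulι 𝒰 x ∘ₗ koszul (grading 𝒰) d) := by
  refine linearMap_ext_homog (grading 𝒰) fun q a ha => ?_
  simp only [LinearMap.comp_apply, LinearMap.smul_apply, mulι_apply]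
  rw [koszul_of_mem _ d (SetLike.GradedMul.mul_mem (ι_mem_grading 𝒰 hx) ha),
    koszul_of_mem _ d ha, mul_smul_comm, smul_smul, ← zpow_add₀ (by simp), mul_add]

theorem comp_koszul_mulι {M : Type*} [AddCommGroup M] [Module k M] (f : GSym 𝒰 →ₗ[k] M) (d : ℤ)
    {p : ℤ} {x : U} (hx : x ∈ 𝒰 p) : (f ∘ₗ koszul (grading 𝒰) d) ∘ₗ mulι 𝒰 x =
      ((-1 : k) ^ (d * p)) • ((f ∘ₗ mulι 𝒰 x) ∘ₗ koszul (grading 𝒰) d) := by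
  rw [LinearMap.comp_assoc, koszul_mulι 𝒰 d hx, LinearMap.comp_smul, LinearMap.comp_assoc]

theorem comp_koszul_koszul {M : Type*} [AddCommGroup M] [Module k M] (f : GSym 𝒰 →ₗ[k] M)
    (d e : ℤ) : (f ∘ₗ koszul (grading 𝒰) d) ∘ₗ koszul (grading 𝒰) e =
      f ∘ₗ koszul (grading 𝒰) (d + e) := by
  rw [LinearMap.comp_assoc, koszul_comp_koszul]

theorem mulι_mem {p q : ℤ} {x : U} (hx : x ∈ 𝒰 p) {a : GSym 𝒰} (ha : a ∈ grading 𝒰 q) :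
    ι 𝒰 x * a ∈ grading 𝒰 (p + q) := SetLike.GradedMul.mul_mem (ι_mem_grading 𝒰 hx) ha

theorem koszul_wprod (d : ℤ) {l : List (ℤ × U)} (hl : IsWord 𝒰 l) :
    koszul (grading 𝒰) d (wprod 𝒰 l) = ((-1 : k) ^ (d * (l.map Prod.fst).sum)) • wprod 𝒰 l :=
  koszul_of_mem _ d (wprod_mem 𝒰 hl)

theorem koszul_gsym_one (d : ℤ) : koszul (grading 𝒰) d 1 = 1 := by
  rw [koszul_of_mem _ d (SetLike.GradedOne.one_mem : (1 : GSym 𝒰) ∈ grading 𝒰 0)]; simp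

/-! ### The convolution algebra -/

/-- A coderivation of degree `d`: `δ T = (T ⊗ 1 + 1 ⊗ T) δ` with the Koszul sign in the second
summand. Besides the codifferentials, the left multiplications by elements of `U` are examples. -/
def IsCoder (d : ℤ) (T : GSym 𝒰 →ₗ[k] GSym 𝒰) : Prop :=
  ∀ a, comul 𝒰 (T a) = TensorProduct.map T LinearMap.id (comul 𝒰 a) +
    TensorProduct.map (koszul (grading 𝒰) d) T (comul 𝒰 a)

open GradedTensorProduct in
theorem isCoder_mulι {p : ℤ} {x : U} (hx : x ∈ 𝒰 p) : IsCoder 𝒰 p (mulι 𝒰 x) := by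
  intro a
  have h1 : (1 : GSym 𝒰) ∈ grading 𝒰 0 := SetLike.GradedOne.one_mem
  have key : ∀ t : GSym 𝒰 ⊗[k] GSym 𝒰,
      comulGen 𝒰 x * (GradedTensorProduct.of k (grading 𝒰) (grading 𝒰) t) =
        GradedTensorProduct.of k (grading 𝒰) (grading 𝒰)
          (TensorProduct.map (mulι 𝒰 x) LinearMap.id t +
            TensorProduct.map (koszul (grading 𝒰) p) (mulι 𝒰 x) t) := by
    intro t
    induction t using TensorProduct.induction_on with
    | zero => simp
    | add s t hs ht => rw [map_add, mul_add, hs, ht, ← map_add]; congr 1; simp only [map_add]; abel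
    | tmul c d =>
      induction c using Decomposition.inductionOn (grading 𝒰) with
      | zero => simp
      | add c c' hc hc' =>
        rw [add_tmul, map_add, mul_add, hc, hc', ← map_add]; congr 1; simp only [map_add]; abel
      | @homogeneous q c =>
        rw [comulGen_apply, add_mul, map_add]
        congr 1
        · exact (tmul_mul_tmul 𝒰 h1 c.2).trans (by simp)
        · refine (tmul_mul_tmul 𝒰 (ι_mem_grading 𝒰 hx) c.2).trans ?_
          rw [TensorProduct.map_tmul, koszul_of_mem _ p c.2, one_mul, ← TensorProduct.smul_tmul',
            map_smul]
          rfl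
  have := key (comul 𝒰 a)
  have h2 : comulGen 𝒰 x * (GradedTensorProduct.of k (grading 𝒰) (grading 𝒰) (comul 𝒰 a)) =
      GradedTensorProduct.of k (grading 𝒰) (grading 𝒰) (comul 𝒰 (mulι 𝒰 x a)) := by
    simp only [comul, LinearMap.comp_apply, LinearEquiv.coe_coe, LinearEquiv.apply_symm_apply,
      AlgHom.toLinearMap_apply, mulι_apply, map_mul]
    rw [comulHom, lift_ι]
  rw [h2] at this
  exact (GradedTensorProduct.of k (grading 𝒰) (grading 𝒰)).injective this

theorem comul_one : comul 𝒰 1 = 1 ⊗ₜ[k] 1 := by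
  simp only [comul, LinearMap.comp_apply, AlgHom.toLinearMap_apply, map_one]; rfl

variable {B : Type*} [Ring B] [Algebra k B]

theorem conv_comp_coder {d : ℤ} {T : GSym 𝒰 →ₗ[k] GSym 𝒰} (hT : IsCoder 𝒰 d T)
    (f g : GSym 𝒰 →ₗ[k] B) :
    conv 𝒰 f g ∘ₗ T = conv 𝒰 (f ∘ₗ T) g + conv 𝒰 (f ∘ₗ koszul (grading 𝒰) d) (g ∘ₗ T) := by
  have h : comul 𝒰 ∘ₗ T = (TensorProduct.map T LinearMap.id +
      TensorProduct.map (koszul (grading 𝒰) d) T) ∘ₗ comul 𝒰 := LinearMap.ext hT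
  simp only [conv]
  rw [LinearMap.comp_assoc, LinearMap.comp_assoc, h, LinearMap.add_comp, LinearMap.comp_add,
    LinearMap.comp_add, TensorProduct.map_comp f, ← LinearMap.comp_id g, TensorProduct.map_comp f,
    LinearMap.comp_id]
  rfl

theorem conv_mulι {p : ℤ} {x : U} (hx : x ∈ 𝒰 p) (f g : GSym 𝒰 →ₗ[k] B) :
    conv 𝒰 f g ∘ₗ mulι 𝒰 x = conv 𝒰 (f ∘ₗ mulι 𝒰 x) g +
      conv 𝒰 (f ∘ₗ koszul (grading 𝒰) p) (g ∘ₗ mulι 𝒰 x) :=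
  conv_comp_coder 𝒰 (isCoder_mulι 𝒰 hx) f g

@[simp] theorem conv_one (f g : GSym 𝒰 →ₗ[k] B) : conv 𝒰 f g 1 = f 1 * g 1 := by
  simp [conv, comul_one]

theorem conv_cons {t : ℤ × U} (ht : t.2 ∈ 𝒰 t.1) (l : List (ℤ × U)) (f g : GSym 𝒰 →ₗ[k] B) :
    conv 𝒰 f g (wprod 𝒰 (t :: l)) = conv 𝒰 (f ∘ₗ mulι 𝒰 t.2) g (wprod 𝒰 l) +
      conv 𝒰 (f ∘ₗ koszul (grading 𝒰) t.1) (g ∘ₗ mulι 𝒰 t.2) (wprod 𝒰 l) :=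
  LinearMap.congr_fun (conv_mulι 𝒰 ht f g) (wprod 𝒰 l)

/-- The convolution as a bilinear map. -/
def convB (B : Type*) [Ring B] [Algebra k B] :
    (GSym 𝒰 →ₗ[k] B) →ₗ[k] (GSym 𝒰 →ₗ[k] B) →ₗ[k] (GSym 𝒰 →ₗ[k] B) :=
  LinearMap.mk₂ k (conv 𝒰)
    (fun f f' g => by simp only [conv, TensorProduct.map_add_left, LinearMap.add_comp,
      LinearMap.comp_add])
    (fun c f g => by simp only [conv, TensorProduct.map_smul_left, LinearMap.smul_comp,
      LinearMap.comp_smul])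
    (fun f g g' => by simp only [conv, TensorProduct.map_add_right, LinearMap.add_comp,
      LinearMap.comp_add])
    (fun c f g => by simp only [conv, TensorProduct.map_smul_right, LinearMap.smul_comp,
      LinearMap.comp_smul])

theorem convB_apply (f g : GSym 𝒰 →ₗ[k] B) : convB 𝒰 B f g = conv 𝒰 f g := rfl

theorem conv_add_left (f f' g : GSym 𝒰 →ₗ[k] B) :
    conv 𝒰 (f + f') g = conv 𝒰 f g + conv 𝒰 f' g := (convB 𝒰 B).map_add₂ f f' g

theorem conv_add_right (f g g' : GSym 𝒰 →ₗ[k] B) :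
    conv 𝒰 f (g + g') = conv 𝒰 f g + conv 𝒰 f g' := (convB 𝒰 B f).map_add g g'

theorem conv_sub_left (f f' g : GSym 𝒰 →ₗ[k] B) :
    conv 𝒰 (f - f') g = conv 𝒰 f g - conv 𝒰 f' g := (convB 𝒰 B).map_sub₂ f f' g

theorem conv_smul_left (c : k) (f g : GSym 𝒰 →ₗ[k] B) :
    conv 𝒰 (c • f) g = c • conv 𝒰 f g := (convB 𝒰 B).map_smul₂ c f g

theorem conv_smul_right (c : k) (f g : GSym 𝒰 →ₗ[k] B) :
    conv 𝒰 f (c • g) = c • conv 𝒰 f g := (convB 𝒰 B f).map_smul c g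

theorem conv_zero_left (g : GSym 𝒰 →ₗ[k] B) : conv 𝒰 0 g = 0 := (convB 𝒰 B).map_zero₂ g

theorem conv_zero_right (f : GSym 𝒰 →ₗ[k] B) : conv 𝒰 f 0 = 0 := (convB 𝒰 B f).map_zero

theorem conv_sum_left {ι' : Type*} (s : Finset ι') (f : ι' → GSym 𝒰 →ₗ[k] B)
    (g : GSym 𝒰 →ₗ[k] B) : conv 𝒰 (∑ i ∈ s, f i) g = ∑ i ∈ s, conv 𝒰 (f i) g :=
  (convB 𝒰 B).map_sum₂ s f g

theorem conv_sum_right {ι' : Type*} (s : Finset ι') (f : GSym 𝒰 →ₗ[k] B)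
    (g : ι' → GSym 𝒰 →ₗ[k] B) : conv 𝒰 f (∑ i ∈ s, g i) = ∑ i ∈ s, conv 𝒰 f (g i) :=
  map_sum (convB 𝒰 B f) g s

/-- Membership of a convolution product in a subspace can be tested on the splittings of a word
into two complementary subwords. -/
theorem conv_wprod_mem (M : Submodule k B) (f g : GSym 𝒰 →ₗ[k] B) {l : List (ℤ × U)}
    (hl : IsWord 𝒰 l)
    (h : ∀ l₁ l₂ : List (ℤ × U), (l₁ ++ l₂).Perm l → f (wprod 𝒰 l₁) * g (wprod 𝒰 l₂) ∈ M) :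
    conv 𝒰 f g (wprod 𝒰 l) ∈ M := by
  induction l generalizing f g with
  | nil => simpa using h [] [] (List.Perm.refl _)
  | cons t l ih =>
    have ht := isWord_cons.1 hl
    rw [conv_cons 𝒰 ht.1]
    refine add_mem (ih _ _ ht.2 fun l₁ l₂ hp => ?_) (ih _ _ ht.2 fun l₁ l₂ hp => ?_)
    · exact h (t :: l₁) l₂ (hp.cons t)
    · have hw : IsWord 𝒰 l₁ := fun s hs => ht.2 s (hp.subset (List.mem_append_left _ hs))
      rw [LinearMap.comp_apply, koszul_wprod 𝒰 _ hw, map_smul, smul_mul_assoc]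
      exact Submodule.smul_mem _ _ (h l₁ (t :: l₂) (List.perm_middle.trans (hp.cons t)))

theorem conv_eq_zero_of_words (f g : GSym 𝒰 →ₗ[k] B) {l : List (ℤ × U)} (hl : IsWord 𝒰 l)
    (h : ∀ l₁ l₂ : List (ℤ × U), (l₁ ++ l₂).Perm l → f (wprod 𝒰 l₁) * g (wprod 𝒰 l₂) = 0) :
    conv 𝒰 f g (wprod 𝒰 l) = 0 :=
  (Submodule.mem_bot k).1 (conv_wprod_mem 𝒰 ⊥ f g hl fun l₁ l₂ hp =>
    (Submodule.mem_bot k).2 (h l₁ l₂ hp))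

theorem conv_congr_right {f g g' : GSym 𝒰 →ₗ[k] B} {l : List (ℤ × U)} (hl : IsWord 𝒰 l)
    (h : ∀ l', IsWord 𝒰 l' → l'.length ≤ l.length → g (wprod 𝒰 l') = g' (wprod 𝒰 l')) :
    conv 𝒰 f g (wprod 𝒰 l) = conv 𝒰 f g' (wprod 𝒰 l) := by
  have := conv_eq_zero_of_words 𝒰 f (g - g') hl fun l₁ l₂ hp => by
    rw [LinearMap.sub_apply, h l₂ (fun s hs => hl s (hp.subset (List.mem_append_right _ hs)))
      (by have := hp.length_eq; simp at this; omega), sub_self, mul_zero]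
  rw [← convB_apply, map_sub, LinearMap.sub_apply, sub_eq_zero] at this
  exact this

theorem conv_congr_left {f f' g : GSym 𝒰 →ₗ[k] B} {l : List (ℤ × U)} (hl : IsWord 𝒰 l)
    (h : ∀ l', IsWord 𝒰 l' → l'.length ≤ l.length → f (wprod 𝒰 l') = f' (wprod 𝒰 l')) :
    conv 𝒰 f g (wprod 𝒰 l) = conv 𝒰 f' g (wprod 𝒰 l) := by
  have := conv_eq_zero_of_words 𝒰 (f - f') g hl fun l₁ l₂ hp => by
    rw [LinearMap.sub_apply, h l₁ (fun s hs => hl s (hp.subset (List.mem_append_left _ hs)))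
      (by have := hp.length_eq; simp at this; omega), sub_self, zero_mul]
  rw [conv_sub_left, LinearMap.sub_apply, sub_eq_zero] at this
  exact this

theorem conv_koszul (d : ℤ) (f g : GSym 𝒰 →ₗ[k] B) :
    conv 𝒰 f g ∘ₗ koszul (grading 𝒰) d =
      conv 𝒰 (f ∘ₗ koszul (grading 𝒰) d) (g ∘ₗ koszul (grading 𝒰) d) := by
  refine ext_words 𝒰 fun l hl => ?_
  induction l generalizing f g with
  | nil => simp [koszul_gsym_one]
  | cons t l ih =>
    have ht := isWord_cons.1 hl
    have e : (f ∘ₗ koszul (grading 𝒰) d) ∘ₗ koszul (grading 𝒰) t.1 =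
        (f ∘ₗ koszul (grading 𝒰) t.1) ∘ₗ koszul (grading 𝒰) d := by
      rw [comp_koszul_koszul, comp_koszul_koszul, add_comm]
    rw [conv_cons 𝒰 ht.1 l (f ∘ₗ koszul _ d), e, comp_koszul_mulι 𝒰 f d ht.1,
      comp_koszul_mulι 𝒰 g d ht.1, conv_smul_left, conv_smul_right, LinearMap.smul_apply,
      LinearMap.smul_apply, ← ih _ _ ht.2, ← ih _ _ ht.2, LinearMap.comp_apply,
      koszul_wprod 𝒰 d hl, map_smul, conv_cons 𝒰 ht.1, LinearMap.comp_apply,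
      LinearMap.comp_apply, koszul_wprod 𝒰 d ht.2, map_smul, map_smul, smul_add, smul_smul,
      smul_smul, List.map_cons, List.sum_cons, mul_add, ← zpow_add₀ (by simp)]

theorem conv_assoc (f g h : GSym 𝒰 →ₗ[k] B) :
    conv 𝒰 (conv 𝒰 f g) h = conv 𝒰 f (conv 𝒰 g h) := by
  refine ext_words 𝒰 fun l hl => ?_
  induction l generalizing f g h with
  | nil => simp [mul_assoc]
  | cons t l ih =>
    have ht := isWord_cons.1 hl
    rw [conv_cons 𝒰 ht.1, conv_cons 𝒰 ht.1, conv_mulι 𝒰 ht.1, conv_mulι 𝒰 ht.1, conv_koszul,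
      conv_add_left, conv_add_right, LinearMap.add_apply, LinearMap.add_apply, ih _ _ _ ht.2,
      ih _ _ _ ht.2, ih _ _ _ ht.2, add_assoc]

/-- The unit `S(U) → k → B` of the convolution algebra. -/
def convUnit (B : Type*) [Ring B] [Algebra k B] : GSym 𝒰 →ₗ[k] B :=
  Algebra.linearMap k B ∘ₗ (counit 𝒰).toLinearMap

theorem convPow_zero (f : GSym 𝒰 →ₗ[k] B) : convPow 𝒰 f 0 = convUnit 𝒰 B := rfl

theorem convPow_succ (f : GSym 𝒰 →ₗ[k] B) (n : ℕ) :
    convPow 𝒰 f (n + 1) = conv 𝒰 f (convPow 𝒰 f n) := rfl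

@[simp] theorem convUnit_one : convUnit 𝒰 B 1 = 1 := by simp [convUnit]

@[simp] theorem convUnit_mul (x : U) (a : GSym 𝒰) : convUnit 𝒰 B (ι 𝒰 x * a) = 0 := by
  simp [convUnit, counit]

theorem convUnit_mulι (x : U) : convUnit 𝒰 B ∘ₗ mulι 𝒰 x = 0 := by
  ext a; simp

theorem convUnit_koszul (d : ℤ) : convUnit 𝒰 B ∘ₗ koszul (grading 𝒰) d = convUnit 𝒰 B := by
  refine ext_words 𝒰 fun l hl => ?_
  cases l with
  | nil => simp [koszul_gsym_one]
  | cons t l => rw [LinearMap.comp_apply, koszul_wprod 𝒰 d hl, map_smul, wprod_cons]; simp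

theorem convUnit_conv (f : GSym 𝒰 →ₗ[k] B) : conv 𝒰 (convUnit 𝒰 B) f = f := by
  refine ext_words 𝒰 fun l hl => ?_
  induction l generalizing f with
  | nil => simp
  | cons t l ih =>
    have ht := isWord_cons.1 hl
    rw [conv_cons 𝒰 ht.1, convUnit_mulι, conv_zero_left, convUnit_koszul, ih _ ht.2]
    simp [wprod_cons]

theorem conv_convUnit (f : GSym 𝒰 →ₗ[k] B) : conv 𝒰 f (convUnit 𝒰 B) = f := by
  refine ext_words 𝒰 fun l hl => ?_
  induction l generalizing f with
  | nil => simp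
  | cons t l ih =>
    have ht := isWord_cons.1 hl
    rw [conv_cons 𝒰 ht.1, convUnit_mulι, conv_zero_right, ih _ ht.2]
    simp [wprod_cons]

/-- Graded commutativity of the convolution of maps of degrees `e` and `d` whose values commute in
the graded sense. -/
theorem conv_comm {f g : GSym 𝒰 →ₗ[k] B} {e d : ℤ}
    (h : ∀ p q a b, a ∈ grading 𝒰 p → b ∈ grading 𝒰 q →
      f a * g b = ((-1 : k) ^ ((p + e) * (q + d))) • (g b * f a)) :
    conv 𝒰 (f ∘ₗ koszul (grading 𝒰) d) g =
      ((-1 : k) ^ (e * d)) • conv 𝒰 (g ∘ₗ koszul (grading 𝒰) e) f := by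
  refine ext_words 𝒰 fun l hl => ?_
  induction l generalizing f g e d with
  | nil =>
    have h1 : (1 : GSym 𝒰) ∈ grading 𝒰 0 := SetLike.GradedOne.one_mem
    simpa [koszul_gsym_one] using h 0 0 1 1 h1 h1
  | cons t l ih =>
    have ht := isWord_cons.1 hl
    have h1 := ih (f := f ∘ₗ mulι 𝒰 t.2) (g := g) (e := e + t.1) (d := d) (by
      intro p q a b ha hb
      have := h _ q _ b (mulι_mem 𝒰 ht.1 ha) hb
      rw [LinearMap.comp_apply, mulι_apply, this]
      congr 2; ring) ht.2
    have h2 := ih (f := f) (g := g ∘ₗ mulι 𝒰 t.2) (e := e) (d := d + t.1) (by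
      intro p q a b ha hb
      have := h p _ a _ ha (mulι_mem 𝒰 ht.1 hb)
      rw [LinearMap.comp_apply, mulι_apply, this]
      congr 2; ring) ht.2
    have s1 : ((-1 : k) ^ (d * t.1)) * (-1) ^ ((e + t.1) * d) = (-1) ^ (e * d) := by
      rw [add_mul, zpow_add₀ (by simp), mul_comm t.1 d, mul_comm ((-1 : k) ^ (e * d)),
        ← mul_assoc, neg_one_zpow_mul_self, one_mul]
    have s2 : ((-1 : k) ^ (e * d)) * (-1) ^ (e * t.1) = (-1) ^ (e * (d + t.1)) := by
      rw [mul_add, zpow_add₀ (by simp)]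
    rw [conv_cons 𝒰 ht.1, LinearMap.smul_apply, conv_cons 𝒰 ht.1, comp_koszul_mulι 𝒰 f d ht.1,
      comp_koszul_mulι 𝒰 g e ht.1, comp_koszul_koszul, comp_koszul_koszul, conv_smul_left,
      conv_smul_left, LinearMap.smul_apply, LinearMap.smul_apply, h1, h2, LinearMap.smul_apply,
      LinearMap.smul_apply, smul_smul, s1, smul_add, smul_smul, s2, add_comm]

end Words

end GSym

/-! ### Homogeneous maps -/

section Homog

variable {k A B C : Type*} [Field k] [AddCommGroup A] [Module k A] [AddCommGroup B] [Module k B]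
  [AddCommGroup C] [Module k C] {𝒜 : ℤ → Submodule k A} {ℬ : ℤ → Submodule k B}
  {𝒞 : ℤ → Submodule k C}

theorem IsHomog.comp {d e : ℤ} {g : B →ₗ[k] C} {f : A →ₗ[k] B} (hg : IsHomog ℬ 𝒞 e g)
    (hf : IsHomog 𝒜 ℬ d f) : IsHomog 𝒜 𝒞 (d + e) (g ∘ₗ f) := by
  intro p a ha
  rw [← add_assoc]
  exact hg _ _ (hf p a ha)

theorem IsHomog.sub {d : ℤ} {f g : A →ₗ[k] B} (hf : IsHomog 𝒜 ℬ d f) (hg : IsHomog 𝒜 ℬ d g) :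
    IsHomog 𝒜 ℬ d (f - g) := fun p a ha => sub_mem (hf p a ha) (hg p a ha)

theorem isHomog_id : IsHomog 𝒜 𝒜 0 (LinearMap.id : A →ₗ[k] A) := fun _ _ ha => by
  simpa using ha

theorem IsHomog.of_eq {d e : ℤ} {f : A →ₗ[k] B} (hf : IsHomog 𝒜 ℬ d f) (h : d = e) :
    IsHomog 𝒜 ℬ e f := h ▸ hf

end Homog

/-! ### Power series in the convolution algebra -/

namespace GSym

section Series

variable {k U : Type*} [Field k] [AddCommGroup U] [Module k U] (𝒰 : ℤ → Submodule k U)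
  [Decomposition 𝒰] {B : Type*} [Ring B] [Algebra k B] (ℬ : ℤ → Submodule k B)

theorem word_induction {C : GSym 𝒰 → Prop} (word : ∀ l, IsWord 𝒰 l → C (wprod 𝒰 l))
    (zero : C 0) (add : ∀ a b, C a → C b → C (a + b)) (smul : ∀ (c : k) a, C a → C (c • a))
    (a : GSym 𝒰) : C a := by
  induction a using Decomposition.inductionOn (grading 𝒰) with
  | zero => exact zero
  | add x y hx hy => exact add _ _ hx hy
  | @homogeneous p m =>
    obtain ⟨a, ha⟩ := m
    induction ha using Submodule.span_induction with
    | mem a h' =>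
      obtain ⟨l, hl, rfl, rfl⟩ := h'
      exact word l hl
    | zero => exact zero
    | add a b _ _ h h' => exact add _ _ h h'
    | smul c a _ h => exact smul _ _ h

theorem conv_isHomog_add [SetLike.GradedMonoid ℬ] {f g : GSym 𝒰 →ₗ[k] B} {d e : ℤ}
    (hf : IsHomog (grading 𝒰) ℬ d f) (hg : IsHomog (grading 𝒰) ℬ e g) :
    IsHomog (grading 𝒰) ℬ (d + e) (conv 𝒰 f g) := by
  refine isHomog_of_words 𝒰 ℬ fun l hl => conv_wprod_mem 𝒰 _ f g hl fun l₁ l₂ hp => ?_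
  have hw : IsWord 𝒰 (l₁ ++ l₂) := fun t ht => hl t (hp.subset ht)
  have := SetLike.GradedMul.mul_mem (hf.word (isWord_append.1 hw).1)
    (hg.word (isWord_append.1 hw).2)
  have hs := (hp.map Prod.fst).sum_eq
  rw [List.map_append, List.sum_append] at hs
  rw [← hs]
  convert this using 2
  ring

theorem convPow_wprod_eq_zero {f : GSym 𝒰 →ₗ[k] B} (hf : f 1 = 0) {n : ℕ} {l : List (ℤ × U)}
    (hl : IsWord 𝒰 l) (hn : l.length < n) : convPow 𝒰 f n (wprod 𝒰 l) = 0 := by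
  induction n generalizing l with
  | zero => omega
  | succ n ih =>
    rw [convPow_succ]
    refine conv_eq_zero_of_words 𝒰 _ _ hl fun l₁ l₂ hp => ?_
    have hw : IsWord 𝒰 (l₁ ++ l₂) := fun t ht => hl t (hp.subset ht)
    cases l₁ with
    | nil => rw [wprod_nil, hf, zero_mul]
    | cons t l₁ =>
      have := hp.length_eq
      simp only [List.cons_append, List.length_cons, List.length_append] at this
      rw [ih (isWord_append.1 hw).2 (by omega), mul_zero]

/-- The series `∑ cⱼ f^{*j}` in the convolution algebra, for `f(1) = 0`: on words of length `m` the
terms with `j > m` vanish. -/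
def ser (c : ℕ → k) (f : GSym 𝒰 →ₗ[k] B) : GSym 𝒰 →ₗ[k] B :=
  weightwise 𝒰 fun m => ∑ j ∈ Finset.range (m + 1), c j • convPow 𝒰 f j

theorem ser_wprod (c : ℕ → k) {f : GSym 𝒰 →ₗ[k] B} (hf : f 1 = 0) {l : List (ℤ × U)}
    (hl : IsWord 𝒰 l) {N : ℕ} (hN : l.length < N) :
    ser 𝒰 c f (wprod 𝒰 l) = (∑ j ∈ Finset.range N, c j • convPow 𝒰 f j) (wprod 𝒰 l) := by
  rw [ser, weightwise_wprod, LinearMap.sum_apply, LinearMap.sum_apply]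
  refine Finset.sum_subset (Finset.range_mono hN) fun j _ hj => ?_
  rw [LinearMap.smul_apply, convPow_wprod_eq_zero 𝒰 hf hl (by simpa using hj), smul_zero]

theorem ser_apply (c : ℕ → k) {f : GSym 𝒰 →ₗ[k] B} (hf : f 1 = 0) (a : GSym 𝒰) :
    ∃ N₀, ∀ N ≥ N₀, ser 𝒰 c f a = (∑ j ∈ Finset.range N, c j • convPow 𝒰 f j) a := by
  induction a using word_induction with
  | word l hl => exact ⟨l.length + 1, fun N hN => ser_wprod 𝒰 c hf hl hN⟩
  | zero => exact ⟨0, fun N _ => by rw [map_zero, map_zero]⟩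
  | add a b ha hb =>
    obtain ⟨N, hN⟩ := ha
    obtain ⟨M, hM⟩ := hb
    exact ⟨max N M, fun n hn => by
      rw [map_add, map_add, hN n (le_of_max_le_left hn), hM n (le_of_max_le_right hn)]⟩
  | smul c a ha =>
    obtain ⟨N, hN⟩ := ha
    exact ⟨N, fun n hn => by rw [map_smul, map_smul, hN n hn]⟩

theorem ser_one (c : ℕ → k) (f : GSym 𝒰 →ₗ[k] B) : ser 𝒰 c f 1 = c 0 • 1 := by
  have := weightwise_wprod 𝒰 (fun m => ∑ j ∈ Finset.range (m + 1), c j • convPow 𝒰 f j) []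
  rw [wprod_nil] at this
  rw [ser, this]
  simp [convPow_zero]

theorem ser_isHomog [SetLike.GradedMonoid ℬ] (c : ℕ → k) {f : GSym 𝒰 →ₗ[k] B}
    (hf : IsHomog (grading 𝒰) ℬ 0 f) : IsHomog (grading 𝒰) ℬ 0 (ser 𝒰 c f) := by
  refine weightwise_isHomog 𝒰 ℬ 0 fun m p a ha => ?_
  rw [LinearMap.sum_apply]
  exact Submodule.sum_mem _ fun j _ => Submodule.smul_mem _ _ (convPow_isHomog 𝒰 ℬ hf j p a ha)

theorem convUnit_coder {d : ℤ} {T : GSym 𝒰 →ₗ[k] GSym 𝒰} (hT : IsCoder 𝒰 d T) :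
    convUnit 𝒰 B ∘ₗ T = 0 := by
  have := conv_comp_coder 𝒰 hT (convUnit 𝒰 B) (convUnit 𝒰 B)
  rw [convUnit_koszul, convUnit_conv, convUnit_conv, conv_convUnit] at this
  exact left_eq_add.1 this

theorem conv_comm_of_isHomog [GrComm ℬ] {f g : GSym 𝒰 →ₗ[k] B} {d : ℤ}
    (hf : IsHomog (grading 𝒰) ℬ 0 f) (hg : IsHomog (grading 𝒰) ℬ d g) :
    conv 𝒰 (f ∘ₗ koszul (grading 𝒰) d) g = conv 𝒰 g f := by
  have := conv_comm 𝒰 (f := f) (g := g) (e := 0) (d := d) fun p q a b ha hb =>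
    GrComm.comm _ _ _ _ (hf p a ha) (hg q b hb)
  rw [this, koszul_zero]
  simp

variable [SetLike.GradedMonoid ℬ] [GrComm ℬ]

/-- The Leibniz rule: by commutativity, the `n + 1` factors of `f^{*(n+1)}` contribute equal terms.
-/
theorem convPow_coder {f : GSym 𝒰 →ₗ[k] B} (hf : IsHomog (grading 𝒰) ℬ 0 f) {d : ℤ}
    {T : GSym 𝒰 →ₗ[k] GSym 𝒰} (hT : IsCoder 𝒰 d T)
    (hfT : IsHomog (grading 𝒰) ℬ d (f ∘ₗ T)) (n : ℕ) :
    convPow 𝒰 f (n + 1) ∘ₗ T = ((n : k) + 1) • conv 𝒰 (f ∘ₗ T) (convPow 𝒰 f n) := by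
  induction n with
  | zero => simp [convPow_succ, convPow_zero, conv_convUnit]
  | succ n ih =>
    rw [convPow_succ, conv_comp_coder 𝒰 hT, ih, conv_smul_right, ← conv_assoc,
      conv_comm_of_isHomog 𝒰 ℬ hf hfT, conv_assoc, ← convPow_succ]
    push_cast
    module

/-- The chain rule for the composition of a series with a coderivation. -/
theorem ser_coder (c : ℕ → k) {f : GSym 𝒰 →ₗ[k] B} (hf : IsHomog (grading 𝒰) ℬ 0 f)
    (hf1 : f 1 = 0) {d : ℤ} {T : GSym 𝒰 →ₗ[k] GSym 𝒰} (hT : IsCoder 𝒰 d T)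
    (hfT : IsHomog (grading 𝒰) ℬ d (f ∘ₗ T)) :
    ser 𝒰 c f ∘ₗ T = conv 𝒰 (f ∘ₗ T) (ser 𝒰 (fun j => ((j : k) + 1) * c (j + 1)) f) := by
  refine ext_words 𝒰 fun l hl => ?_
  obtain ⟨N₀, hN₀⟩ := ser_apply 𝒰 c hf1 (T (wprod 𝒰 l))
  have hN := hN₀ (max N₀ (l.length + 1) + 1) (by omega)
  have hlN : l.length < max N₀ (l.length + 1) := by omega
  generalize max N₀ (l.length + 1) = N at hN hlN
  rw [LinearMap.comp_apply, hN, conv_congr_right 𝒰 hl fun l' hl' hle =>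
    ser_wprod 𝒰 _ hf1 hl' (lt_of_le_of_lt hle hlN), conv_sum_right, Finset.sum_range_succ',
    LinearMap.add_apply, LinearMap.smul_apply, convPow_zero,
    ← LinearMap.comp_apply (convUnit 𝒰 B) T, convUnit_coder 𝒰 hT,
    LinearMap.zero_apply, smul_zero, add_zero, LinearMap.sum_apply, LinearMap.sum_apply]
  refine Finset.sum_congr rfl fun j _ => ?_
  have := LinearMap.congr_fun (convPow_coder 𝒰 ℬ hf hT hfT j) (wprod 𝒰 l)
  rw [LinearMap.comp_apply] at this
  rw [LinearMap.smul_apply, this, conv_smul_right, LinearMap.smul_apply, LinearMap.smul_apply,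
    smul_smul, mul_comm]

theorem isHomog_comp_mulι {f : GSym 𝒰 →ₗ[k] B} {e : ℤ} (hf : IsHomog (grading 𝒰) ℬ e f) {p : ℤ}
    {x : U} (hx : x ∈ 𝒰 p) : IsHomog (grading 𝒰) ℬ (p + e) (f ∘ₗ mulι 𝒰 x) := by
  intro q a ha
  have := hf _ _ (mulι_mem 𝒰 hx ha)
  rwa [add_comm p q, add_assoc] at this

/-- A map `E` with `E(x a) = (g_x * E)(a)` for all `x ∈ U` is determined by `E(1)`. -/
theorem eq_of_mulι {E E' : GSym 𝒰 →ₗ[k] B} (h1 : E 1 = E' 1) (g : U → GSym 𝒰 →ₗ[k] B)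
    (hE : ∀ p, ∀ x ∈ 𝒰 p, E ∘ₗ mulι 𝒰 x = conv 𝒰 (g x) E)
    (hE' : ∀ p, ∀ x ∈ 𝒰 p, E' ∘ₗ mulι 𝒰 x = conv 𝒰 (g x) E') : E = E' := by
  have : ∀ n : ℕ, ∀ l, IsWord 𝒰 l → l.length ≤ n → E (wprod 𝒰 l) = E' (wprod 𝒰 l) := by
    intro n
    induction n with
    | zero =>
      intro l _ h
      rw [List.length_eq_zero_iff.1 (Nat.le_zero.1 h), wprod_nil, h1]
    | succ n ih =>
      intro l hl h
      cases l with
      | nil => exact ih [] hl (by simp)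
      | cons t l =>
        have ht := isWord_cons.1 hl
        have e := LinearMap.congr_fun (hE _ _ ht.1) (wprod 𝒰 l)
        have e' := LinearMap.congr_fun (hE' _ _ ht.1) (wprod 𝒰 l)
        rw [List.length_cons] at h
        rw [conv_congr_right 𝒰 ht.2 fun l' hl' hle => ih l' hl' (by omega), ← e'] at e
        exact e
  exact ext_words 𝒰 fun l hl => this _ l hl le_rfl

/-- The inverse `∑ (-1)ʲ (Φ - ε)^{*j}` of `Φ` in the convolution algebra, for `Φ(1) = 1`. -/
def convInv (Φ : GSym 𝒰 →ₗ[k] B) : GSym 𝒰 →ₗ[k] B :=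
  ser 𝒰 (fun j => (-1) ^ j) (Φ - convUnit 𝒰 B)

theorem sub_convUnit_one {Φ : GSym 𝒰 →ₗ[k] B} (hΦ : Φ 1 = 1) : (Φ - convUnit 𝒰 B) 1 = 0 := by
  simp [hΦ]

theorem conv_convInv {Φ : GSym 𝒰 →ₗ[k] B} (hΦ : Φ 1 = 1) :
    conv 𝒰 Φ (convInv 𝒰 Φ) = convUnit 𝒰 B := by
  have hf := sub_convUnit_one 𝒰 hΦ
  have hs : Φ = convUnit 𝒰 B + (Φ - convUnit 𝒰 B) := by abel
  suffices conv 𝒰 (convUnit 𝒰 B + (Φ - convUnit 𝒰 B)) (convInv 𝒰 Φ) = convUnit 𝒰 B by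
    rwa [← hs] at this
  rw [convInv, conv_add_left, convUnit_conv]
  refine ext_words 𝒰 fun l hl => ?_
  rw [LinearMap.add_apply, ser_wprod 𝒰 _ hf hl (Nat.lt_succ_of_lt (Nat.lt_succ_self _)),
    conv_congr_right 𝒰 hl fun l' hl' hle => ser_wprod 𝒰 _ hf hl' (Nat.lt_succ_of_le hle),
    conv_sum_right, Finset.sum_range_succ', LinearMap.add_apply]
  have e : ∀ j, ((-1 : k) ^ (j + 1)) • convPow 𝒰 (Φ - convUnit 𝒰 B) (j + 1) =
      -(((-1 : k) ^ j) • convPow 𝒰 (Φ - convUnit 𝒰 B) (j + 1)) := fun j => by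
    rw [pow_succ]; module
  simp only [conv_smul_right, ← convPow_succ, e, Finset.sum_neg_distrib, LinearMap.neg_apply,
    convPow_zero, pow_zero, one_smul]
  abel

theorem convPow_succ' (f : GSym 𝒰 →ₗ[k] B) (n : ℕ) :
    convPow 𝒰 f (n + 1) = conv 𝒰 (convPow 𝒰 f n) f := by
  induction n with
  | zero => rw [convPow_succ, convPow_zero, conv_convUnit, convUnit_conv]
  | succ n ih => rw [convPow_succ, ih, ← conv_assoc, ← convPow_succ, ih]

theorem convInv_conv {Φ : GSym 𝒰 →ₗ[k] B} (hΦ : Φ 1 = 1) :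
    conv 𝒰 (convInv 𝒰 Φ) Φ = convUnit 𝒰 B := by
  have hf := sub_convUnit_one 𝒰 hΦ
  have hs : Φ = convUnit 𝒰 B + (Φ - convUnit 𝒰 B) := by abel
  suffices conv 𝒰 (convInv 𝒰 Φ) (convUnit 𝒰 B + (Φ - convUnit 𝒰 B)) = convUnit 𝒰 B by
    rwa [← hs] at this
  rw [convInv, conv_add_right, conv_convUnit]
  refine ext_words 𝒰 fun l hl => ?_
  rw [LinearMap.add_apply, ser_wprod 𝒰 _ hf hl (Nat.lt_succ_of_lt (Nat.lt_succ_self _)),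
    conv_congr_left 𝒰 hl fun l' hl' hle => ser_wprod 𝒰 _ hf hl' (Nat.lt_succ_of_le hle),
    conv_sum_left, Finset.sum_range_succ', LinearMap.add_apply]
  have e : ∀ j, ((-1 : k) ^ (j + 1)) • convPow 𝒰 (Φ - convUnit 𝒰 B) (j + 1) =
      -(((-1 : k) ^ j) • convPow 𝒰 (Φ - convUnit 𝒰 B) (j + 1)) := fun j => by
    rw [pow_succ]; module
  simp only [conv_smul_left, ← convPow_succ', e, Finset.sum_neg_distrib, LinearMap.neg_apply,
    convPow_zero, pow_zero, one_smul]
  abel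

/-- A map `Φ` with `Φ(1) = 1` is invertible for the convolution. -/
theorem conv_right_cancel {Φ : GSym 𝒰 →ₗ[k] B} (hΦ : Φ 1 = 1) {g g' : GSym 𝒰 →ₗ[k] B}
    (h : conv 𝒰 g Φ = conv 𝒰 g' Φ) : g = g' := by
  have := congrArg (fun e => conv 𝒰 e (convInv 𝒰 Φ)) h
  simpa only [conv_assoc, conv_convInv 𝒰 hΦ, conv_convUnit] using this

/-! ### Exponential and logarithm -/

theorem convExp_eq_ser (f : GSym 𝒰 →ₗ[k] B) :
    convExp 𝒰 f = ser 𝒰 (fun j => ((j.factorial : k))⁻¹) f := rfl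

theorem convLog_eq_ser (Φ : GSym 𝒰 →ₗ[k] B) :
    convLog 𝒰 Φ = ser 𝒰 (fun j => (-1) ^ (j - 1) / (j : k)) (Φ - convUnit 𝒰 B) := by
  rw [convLog, ser]
  congr 1
  funext m
  rw [Finset.sum_range_succ']
  simp only [Nat.cast_zero, div_zero, zero_smul, add_zero]
  rw [Finset.range_eq_Ico, Finset.sum_Ico_add' (fun j : ℕ => ((-1 : k) ^ (j - 1) / (j : k)) •
    convPow 𝒰 (Φ - convUnit 𝒰 B) j) 0 m 1]
  rfl

theorem convExp_one (f : GSym 𝒰 →ₗ[k] B) : convExp 𝒰 f 1 = 1 := by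
  rw [convExp_eq_ser, ser_one]; simp

theorem convLog_one (f : GSym 𝒰 →ₗ[k] B) : convLog 𝒰 f 1 = 0 := by
  rw [convLog_eq_ser, ser_one]; simp

theorem isHomog_sub_convUnit {Φ : GSym 𝒰 →ₗ[k] B} (hΦ : IsHomog (grading 𝒰) ℬ 0 Φ) :
    IsHomog (grading 𝒰) ℬ 0 (Φ - convUnit 𝒰 B) := hΦ.sub (unit_isHomog 𝒰 ℬ)

theorem convLog_isHomog {Φ : GSym 𝒰 →ₗ[k] B} (hΦ : IsHomog (grading 𝒰) ℬ 0 Φ) :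
    IsHomog (grading 𝒰) ℬ 0 (convLog 𝒰 Φ) := by
  rw [convLog_eq_ser]
  exact ser_isHomog 𝒰 ℬ _ (isHomog_sub_convUnit 𝒰 ℬ hΦ)

variable [CharZero k]

/-- The chain rule for the exponential. -/
theorem convExp_coder {f : GSym 𝒰 →ₗ[k] B} (hf : IsHomog (grading 𝒰) ℬ 0 f)
    (hf1 : f 1 = 0) {d : ℤ} {T : GSym 𝒰 →ₗ[k] GSym 𝒰} (hT : IsCoder 𝒰 d T)
    (hfT : IsHomog (grading 𝒰) ℬ d (f ∘ₗ T)) :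
    convExp 𝒰 f ∘ₗ T = conv 𝒰 (f ∘ₗ T) (convExp 𝒰 f) := by
  rw [convExp_eq_ser, ser_coder 𝒰 ℬ _ hf hf1 hT hfT]
  congr 2
  funext j
  have h : (j : k) + 1 ≠ 0 := by exact_mod_cast Nat.succ_ne_zero j
  rw [Nat.factorial_succ]
  push_cast
  rw [mul_inv, mul_inv_cancel_left₀ h]

/-- Left multiplication by `x ∈ U` is a coderivation, so the chain rule expresses `exp(f)` on words
of length `m + 1` through its values on words of length `≤ m`. -/
theorem convExp_mulι {f : GSym 𝒰 →ₗ[k] B} (hf : IsHomog (grading 𝒰) ℬ 0 f)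
    (hf1 : f 1 = 0) {p : ℤ} {x : U} (hx : x ∈ 𝒰 p) :
    convExp 𝒰 f ∘ₗ mulι 𝒰 x = conv 𝒰 (f ∘ₗ mulι 𝒰 x) (convExp 𝒰 f) :=
  convExp_coder 𝒰 ℬ hf hf1 (isCoder_mulι 𝒰 hx)
    ((isHomog_comp_mulι 𝒰 ℬ hf hx).of_eq (add_zero p))

/-- The logarithmic derivative: `log(Φ)(x ·) = Φ(x ·) * Φ⁻¹`. -/
theorem convLog_mulι {Φ : GSym 𝒰 →ₗ[k] B} (hΦ : IsHomog (grading 𝒰) ℬ 0 Φ)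
    (hΦ1 : Φ 1 = 1) {p : ℤ} {x : U} (hx : x ∈ 𝒰 p) :
    convLog 𝒰 Φ ∘ₗ mulι 𝒰 x = conv 𝒰 (Φ ∘ₗ mulι 𝒰 x) (convInv 𝒰 Φ) := by
  have hf := isHomog_sub_convUnit 𝒰 ℬ hΦ
  rw [convLog_eq_ser, ser_coder 𝒰 ℬ _ hf (sub_convUnit_one 𝒰 hΦ1) (isCoder_mulι 𝒰 hx)
    ((isHomog_comp_mulι 𝒰 ℬ hf hx).of_eq (add_zero p)), LinearMap.sub_comp, convUnit_mulι,
    sub_zero, convInv]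
  congr 2
  funext j
  have h : (j : k) + 1 ≠ 0 := by exact_mod_cast Nat.succ_ne_zero j
  rw [Nat.add_sub_cancel, Nat.cast_add_one, mul_div_cancel₀ _ h]

theorem convExp_convLog {Φ : GSym 𝒰 →ₗ[k] B} (hΦ : IsHomog (grading 𝒰) ℬ 0 Φ)
    (hΦ1 : Φ 1 = 1) : convExp 𝒰 (convLog 𝒰 Φ) = Φ := by
  refine eq_of_mulι 𝒰 (by rw [convExp_one, hΦ1]) (fun x => convLog 𝒰 Φ ∘ₗ mulι 𝒰 x)
    (fun p x hx => convExp_mulι 𝒰 ℬ (convLog_isHomog 𝒰 ℬ hΦ) (convLog_one 𝒰 Φ) hx)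
    (fun p x hx => ?_)
  rw [convLog_mulι 𝒰 ℬ hΦ hΦ1 hx, conv_assoc, convInv_conv 𝒰 hΦ1, conv_convUnit]

theorem eq_of_mulι_eq {f g : GSym 𝒰 →ₗ[k] B} (h1 : f 1 = g 1)
    (h : ∀ p, ∀ x ∈ 𝒰 p, f ∘ₗ mulι 𝒰 x = g ∘ₗ mulι 𝒰 x) : f = g := by
  refine ext_words 𝒰 fun l hl => ?_
  cases l with
  | nil => exact h1
  | cons t l => exact LinearMap.congr_fun (h _ _ (isWord_cons.1 hl).1) (wprod 𝒰 l)

theorem convLog_convExp {f : GSym 𝒰 →ₗ[k] B} (hf : IsHomog (grading 𝒰) ℬ 0 f)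
    (hf1 : f 1 = 0) : convLog 𝒰 (convExp 𝒰 f) = f := by
  refine eq_of_mulι_eq 𝒰 (by rw [convLog_one, hf1]) fun p x hx => ?_
  rw [convLog_mulι 𝒰 ℬ (convExp_isHomog 𝒰 ℬ hf) (convExp_one 𝒰 f) hx,
    convExp_mulι 𝒰 ℬ hf hf1 hx, conv_assoc, conv_convInv 𝒰 (convExp_one 𝒰 f), conv_convUnit]

theorem convExp_injective {f g : GSym 𝒰 →ₗ[k] B} (hf : IsHomog (grading 𝒰) ℬ 0 f)
    (hf1 : f 1 = 0) (hg : IsHomog (grading 𝒰) ℬ 0 g) (hg1 : g 1 = 0)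
    (h : convExp 𝒰 f = convExp 𝒰 g) : f = g := by
  rw [← convLog_convExp 𝒰 ℬ hf hf1, h, convLog_convExp 𝒰 ℬ hg hg1]

end Series

section AlgHom

variable {k U U' : Type*} [Field k] [AddCommGroup U] [Module k U] [AddCommGroup U'] [Module k U']
  (𝒰 : ℤ → Submodule k U) [Decomposition 𝒰] (𝒰' : ℤ → Submodule k U') [Decomposition 𝒰']
  {B B' : Type*} [Ring B] [Algebra k B] [Ring B'] [Algebra k B']

/-! ### Functoriality of the convolution algebra -/

theorem algHom_conv (α : B →ₐ[k] B') (f g : GSym 𝒰 →ₗ[k] B) :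
    α.toLinearMap ∘ₗ conv 𝒰 f g = conv 𝒰 (α.toLinearMap ∘ₗ f) (α.toLinearMap ∘ₗ g) := by
  have h : α.toLinearMap ∘ₗ LinearMap.mul' k B =
      LinearMap.mul' k B' ∘ₗ TensorProduct.map α.toLinearMap α.toLinearMap := by
    ext a b; simp
  rw [conv, ← LinearMap.comp_assoc, h, conv, TensorProduct.map_comp]
  rfl

theorem algHom_convUnit (α : B →ₐ[k] B') :
    α.toLinearMap ∘ₗ convUnit 𝒰 B = convUnit 𝒰 B' := by
  ext a; simp [convUnit]

theorem algHom_convPow (α : B →ₐ[k] B') (f : GSym 𝒰 →ₗ[k] B) (n : ℕ) :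
    α.toLinearMap ∘ₗ convPow 𝒰 f n = convPow 𝒰 (α.toLinearMap ∘ₗ f) n := by
  induction n with
  | zero => exact algHom_convUnit 𝒰 α
  | succ n ih => rw [convPow_succ, algHom_conv, ih, convPow_succ]

theorem algHom_ser (α : B →ₐ[k] B') (c : ℕ → k) (f : GSym 𝒰 →ₗ[k] B) :
    α.toLinearMap ∘ₗ ser 𝒰 c f = ser 𝒰 c (α.toLinearMap ∘ₗ f) := by
  refine ext_words 𝒰 fun l hl => ?_
  simp only [ser, LinearMap.comp_apply, weightwise_wprod, LinearMap.sum_apply,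
    LinearMap.smul_apply, map_sum, map_smul, ← algHom_convPow]

theorem algHom_convExp (α : B →ₐ[k] B') (f : GSym 𝒰 →ₗ[k] B) :
    α.toLinearMap ∘ₗ convExp 𝒰 f = convExp 𝒰 (α.toLinearMap ∘ₗ f) := algHom_ser 𝒰 α _ f

theorem mulLeft_conv (b : B) (f g : GSym 𝒰 →ₗ[k] B) :
    conv 𝒰 (LinearMap.mulLeft k b ∘ₗ f) g = LinearMap.mulLeft k b ∘ₗ conv 𝒰 f g := by
  have h : LinearMap.mulLeft k b ∘ₗ LinearMap.mul' k B =
      LinearMap.mul' k B ∘ₗ TensorProduct.map (LinearMap.mulLeft k b) LinearMap.id := by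
    ext x y; simp [mul_assoc]
  rw [conv, conv, ← LinearMap.comp_assoc _ _ (LinearMap.mulLeft k b), h,
    ← LinearMap.id_comp g, TensorProduct.map_comp, LinearMap.id_comp]
  rfl

theorem conv_mulLeft {b : B} (hb : ∀ x, b * x = x * b) (f g : GSym 𝒰 →ₗ[k] B) :
    conv 𝒰 f (LinearMap.mulLeft k b ∘ₗ g) = LinearMap.mulLeft k b ∘ₗ conv 𝒰 f g := by
  have h : LinearMap.mulLeft k b ∘ₗ LinearMap.mul' k B =
      LinearMap.mul' k B ∘ₗ TensorProduct.map LinearMap.id (LinearMap.mulLeft k b) := by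
    ext x y; simp [← mul_assoc, hb x]
  rw [conv, conv, ← LinearMap.comp_assoc _ _ (LinearMap.mulLeft k b), h,
    ← LinearMap.id_comp f, TensorProduct.map_comp, LinearMap.id_comp]
  rfl

/-- A morphism of graded counital coalgebras, of degree zero, that preserves `1`. -/
structure IsCoalgHom (F : GSym 𝒰 →ₗ[k] GSym 𝒰') : Prop where
  comul : ∀ a, comul 𝒰' (F a) = TensorProduct.map F F (comul 𝒰 a)
  counit : ∀ a, counit 𝒰' (F a) = counit 𝒰 a
  one : F 1 = 1

variable {𝒰 𝒰'} {F : GSym 𝒰 →ₗ[k] GSym 𝒰'}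

theorem conv_comp_coalgHom (hF : IsCoalgHom 𝒰 𝒰' F) (f g : GSym 𝒰' →ₗ[k] B) :
    conv 𝒰' f g ∘ₗ F = conv 𝒰 (f ∘ₗ F) (g ∘ₗ F) := by
  have h : comul 𝒰' ∘ₗ F = TensorProduct.map F F ∘ₗ comul 𝒰 := LinearMap.ext hF.comul
  rw [conv, LinearMap.comp_assoc, LinearMap.comp_assoc, h, conv, TensorProduct.map_comp]
  rfl

theorem convUnit_comp_coalgHom (hF : IsCoalgHom 𝒰 𝒰' F) :
    convUnit 𝒰' B ∘ₗ F = convUnit 𝒰 B := by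
  ext a; simp [convUnit, hF.counit]

theorem convPow_comp_coalgHom (hF : IsCoalgHom 𝒰 𝒰' F) (f : GSym 𝒰' →ₗ[k] B) (n : ℕ) :
    convPow 𝒰' f n ∘ₗ F = convPow 𝒰 (f ∘ₗ F) n := by
  induction n with
  | zero => exact convUnit_comp_coalgHom hF
  | succ n ih => rw [convPow_succ, conv_comp_coalgHom hF, ih, convPow_succ]

theorem ser_comp_coalgHom (hF : IsCoalgHom 𝒰 𝒰' F) (c : ℕ → k) {f : GSym 𝒰' →ₗ[k] B}
    (hf : f 1 = 0) : ser 𝒰' c f ∘ₗ F = ser 𝒰 c (f ∘ₗ F) := by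
  refine LinearMap.ext fun a => ?_
  obtain ⟨N, hN⟩ := ser_apply 𝒰' c hf (F a)
  obtain ⟨M, hM⟩ := ser_apply 𝒰 c (f := f ∘ₗ F) (by simp [hF.one, hf]) a
  rw [LinearMap.comp_apply, hN _ (le_max_left N M), hM _ (le_max_right N M)]
  simp only [LinearMap.sum_apply, LinearMap.smul_apply, ← convPow_comp_coalgHom hF,
    LinearMap.comp_apply]

theorem convExp_comp_coalgHom (hF : IsCoalgHom 𝒰 𝒰' F) {f : GSym 𝒰' →ₗ[k] B}
    (hf : f 1 = 0) : convExp 𝒰' f ∘ₗ F = convExp 𝒰 (f ∘ₗ F) := ser_comp_coalgHom hF _ hf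

theorem convLog_comp_coalgHom (hF : IsCoalgHom 𝒰 𝒰' F) {Φ : GSym 𝒰' →ₗ[k] B}
    (hΦ : Φ 1 = 1) : convLog 𝒰' Φ ∘ₗ F = convLog 𝒰 (Φ ∘ₗ F) := by
  rw [convLog_eq_ser, ser_comp_coalgHom hF _ (sub_convUnit_one 𝒰' hΦ), convLog_eq_ser,
    LinearMap.sub_comp, convUnit_comp_coalgHom hF]

theorem IsCoalgHom.comp {U'' : Type*} [AddCommGroup U''] [Module k U'']
    {𝒰'' : ℤ → Submodule k U''} [Decomposition 𝒰''] {F' : GSym 𝒰' →ₗ[k] GSym 𝒰''}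
    (hF' : IsCoalgHom 𝒰' 𝒰'' F') (hF : IsCoalgHom 𝒰 𝒰' F) : IsCoalgHom 𝒰 𝒰'' (F' ∘ₗ F) where
  comul a := by
    rw [LinearMap.comp_apply, hF'.comul, hF.comul, TensorProduct.map_comp]; rfl
  counit a := by rw [LinearMap.comp_apply, hF'.counit, hF.counit]
  one := by rw [LinearMap.comp_apply, hF.one, hF'.one]

/-- An algebra homomorphism `S(U) → S(U')` that extends a linear map `h : U → U'` of even degree is
a morphism of coalgebras. -/
theorem isCoalgHom_of_algHom (F : GSym 𝒰 →ₐ[k] GSym 𝒰') (h : U →ₗ[k] U') (c : ℤ)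
    (hh : ∀ p, ∀ x ∈ 𝒰 p, h x ∈ 𝒰' (p + 2 * c)) (hF : ∀ x, F (ι 𝒰 x) = ι 𝒰' (h x)) :
    IsCoalgHom 𝒰 𝒰' F.toLinearMap := by
  have hw : ∀ l, IsWord 𝒰 l → F (wprod 𝒰 l) = wprod 𝒰' (l.map fun t => (t.1 + 2 * c, h t.2)) ∧
      IsWord 𝒰' (l.map fun t => (t.1 + 2 * c, h t.2)) ∧
      ∃ n : ℤ, ((l.map fun t => (t.1 + 2 * c, h t.2)).map Prod.fst).sum =
        (l.map Prod.fst).sum + 2 * n := by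
    intro l hl
    induction l with
    | nil => exact ⟨by simp, isWord_nil 𝒰', 0, by simp⟩
    | cons t l ih =>
      obtain ⟨ht, hl⟩ := isWord_cons.1 hl
      obtain ⟨h1, h2, n, h3⟩ := ih hl
      refine ⟨?_, ?_, n + c, ?_⟩
      · rw [wprod_cons, map_mul, hF, h1]; rfl
      · rw [List.map_cons]; exact isWord_cons.2 ⟨hh _ _ ht, h2⟩
      · rw [List.map_cons, List.map_cons, List.sum_cons, h3, List.map_cons, List.sum_cons]; ring
  have hmul : ∀ x, F.toLinearMap ∘ₗ mulι 𝒰 x = mulι 𝒰' (h x) ∘ₗ F.toLinearMap := by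
    intro x; ext a; simp [hF]
  have hk : ∀ p : ℤ, F.toLinearMap ∘ₗ koszul (grading 𝒰) p =
      koszul (grading 𝒰') (p + 2 * c) ∘ₗ F.toLinearMap := by
    intro p
    refine ext_words 𝒰 fun l hl => ?_
    obtain ⟨h1, h2, n, h3⟩ := hw l hl
    rw [LinearMap.comp_apply, koszul_wprod 𝒰 p hl, map_smul, LinearMap.comp_apply,
      AlgHom.toLinearMap_apply, h1, koszul_wprod 𝒰' _ h2, h3]
    congr 1
    have e : (p + 2 * c) * ((l.map Prod.fst).sum + 2 * n) = p * (l.map Prod.fst).sum +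
      2 * (p * n + c * (l.map Prod.fst).sum + 2 * c * n) := by ring
    rw [e, zpow_add₀ (by simp), zpow_mul (-1 : k) 2]
    simp
  refine ⟨?_, ?_, map_one F⟩
  · suffices comul 𝒰' ∘ₗ F.toLinearMap =
        TensorProduct.map F.toLinearMap F.toLinearMap ∘ₗ comul 𝒰 from LinearMap.congr_fun this
    refine ext_words 𝒰 fun l hl => ?_
    induction l with
    | nil => simp [comul_one]
    | cons t l ih =>
      obtain ⟨ht, hl⟩ := isWord_cons.1 hl
      have ih := ih hl
      have e1 := isCoder_mulι 𝒰' (hh _ _ ht) (F (wprod 𝒰 l))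
      have e2 := isCoder_mulι 𝒰 ht (wprod 𝒰 l)
      rw [LinearMap.comp_apply, AlgHom.toLinearMap_apply, LinearMap.comp_apply] at ih
      rw [ih] at e1
      rw [mulι_apply, ← hF, ← map_mul] at e1
      rw [mulι_apply] at e2
      rw [LinearMap.comp_apply, AlgHom.toLinearMap_apply, wprod_cons, e1, LinearMap.comp_apply, e2,
        map_add]
      have m : ∀ (p q : GSym 𝒰 →ₗ[k] GSym 𝒰) (p' q' : GSym 𝒰' →ₗ[k] GSym 𝒰'),
          F.toLinearMap ∘ₗ p = p' ∘ₗ F.toLinearMap → F.toLinearMap ∘ₗ q = q' ∘ₗ F.toLinearMap →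
          ∀ s, TensorProduct.map p' q' (TensorProduct.map F.toLinearMap F.toLinearMap s) =
            TensorProduct.map F.toLinearMap F.toLinearMap (TensorProduct.map p q s) := by
        intro p q p' q' h1 h2 s
        rw [← LinearMap.comp_apply, ← TensorProduct.map_comp, ← h1, ← h2, TensorProduct.map_comp]
        rfl
      rw [m _ _ _ _ (hmul t.2) (by rw [LinearMap.comp_id, LinearMap.id_comp]),
        m _ _ _ _ (hk t.1) (hmul t.2)]
  · suffices (counit 𝒰').comp F = counit 𝒰 from fun a => AlgHom.congr_fun this a
    refine hom_ext fun x => ?_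
    simp [hF, counit]

/-! ### Morphisms and coderivations with values in cogenerators -/

theorem toCogen_mul (x : U) (a : GSym 𝒰) : toCogen 𝒰 (ι 𝒰 x * a) = counit 𝒰 a • x := by
  let _ : Module kᵐᵒᵖ U := Module.compHom _ ((RingHom.id k).fromOpposite mul_comm)
  have _ : IsCentralScalar k U := ⟨fun _ _ => rfl⟩
  have hc : ∀ a, (lift 𝒰 (TrivSqZeroExt.inrHom k U)
      (by simp [TrivSqZeroExt.inr_mul_inr]) a).fst = counit 𝒰 a := by
    intro a
    suffices (TrivSqZeroExt.fstHom k k U).comp (lift 𝒰 (TrivSqZeroExt.inrHom k U)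
      (by simp [TrivSqZeroExt.inr_mul_inr])) = counit 𝒰 from AlgHom.congr_fun this a
    refine hom_ext fun x => ?_
    simp [counit]
  rw [← hc a]
  change (lift 𝒰 (TrivSqZeroExt.inrHom k U) _ (ι 𝒰 x * a)).snd = _
  rw [map_mul, lift_ι]
  simp

theorem toCogen_one : toCogen 𝒰 1 = 0 := by
  let _ : Module kᵐᵒᵖ U := Module.compHom _ ((RingHom.id k).fromOpposite mul_comm)
  have _ : IsCentralScalar k U := ⟨fun _ _ => rfl⟩
  change (lift 𝒰 (TrivSqZeroExt.inrHom k U) _ 1).snd = 0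
  rw [map_one, TrivSqZeroExt.snd_one]

theorem toCogen_mem {p : ℤ} {a : GSym 𝒰} (ha : a ∈ grading 𝒰 p) : toCogen 𝒰 a ∈ 𝒰 p := by
  have : IsHomog (grading 𝒰) 𝒰 0 (toCogen 𝒰) := by
    refine isHomog_of_words 𝒰 𝒰 fun l hl => ?_
    cases l with
    | nil => rw [wprod_nil, toCogen_one]; exact zero_mem _
    | cons t l =>
      obtain ⟨ht, hl⟩ := isWord_cons.1 hl
      rw [wprod_cons, toCogen_mul]
      cases l with
      | nil => simpa using ht
      | cons s l => simp [wprod_cons, counit]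
  simpa using this p a ha

theorem ι_toCogen_isHomog : IsHomog (grading 𝒰) (grading 𝒰) 0 (ι 𝒰 ∘ₗ toCogen 𝒰) :=
  fun p a ha => by simpa using ι_mem_grading 𝒰 (toCogen_mem ha)

theorem ι_toCogen_comp_isHomog {A : Type*} [AddCommGroup A] [Module k A] {𝒜 : ℤ → Submodule k A}
    {d : ℤ} {T : A →ₗ[k] GSym 𝒰} (hT : IsHomog 𝒜 (grading 𝒰) d T) :
    IsHomog 𝒜 (grading 𝒰) d (ι 𝒰 ∘ₗ toCogen 𝒰 ∘ₗ T) :=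
  fun p a ha => ι_mem_grading 𝒰 (toCogen_mem (hT p a ha))

variable [CharZero k]

variable (𝒰) in
/-- The identity of `S(U)` is the exponential of the projection to the cogenerators. -/
theorem convExp_toCogen : convExp 𝒰 (ι 𝒰 ∘ₗ toCogen 𝒰) = LinearMap.id := by
  refine eq_of_mulι 𝒰 (by rw [convExp_one]; rfl) (fun x => (ι 𝒰 ∘ₗ toCogen 𝒰) ∘ₗ mulι 𝒰 x)
    (fun p x hx => convExp_mulι 𝒰 (grading 𝒰) ι_toCogen_isHomog (by simp [toCogen_one]) hx)
    (fun p x hx => ?_)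
  have : (ι 𝒰 ∘ₗ toCogen 𝒰) ∘ₗ mulι 𝒰 x =
      LinearMap.mulLeft k (ι 𝒰 x) ∘ₗ convUnit 𝒰 (GSym 𝒰) := by
    ext a; simp [toCogen_mul, convUnit, Algebra.algebraMap_eq_smul_one]
  rw [this, mulLeft_conv, convUnit_conv]
  rfl

/-- A coalgebra morphism is the exponential of its projection to the cogenerators. -/
theorem eq_convExp_of_isCoalgHom (hF : IsCoalgHom 𝒰 𝒰' F) :
    F = convExp 𝒰 (ι 𝒰' ∘ₗ toCogen 𝒰' ∘ₗ F) := by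
  have h := convExp_comp_coalgHom hF (f := ι 𝒰' ∘ₗ toCogen 𝒰') (by simp [toCogen_one])
  rw [convExp_toCogen, LinearMap.id_comp] at h
  exact h

/-- A coderivation is recovered from its projection to the cogenerators. -/
theorem eq_conv_of_isCoder {d : ℤ} {D : GSym 𝒰 →ₗ[k] GSym 𝒰} (hD : IsCoder 𝒰 d D)
    (hd : IsHomog (grading 𝒰) (grading 𝒰) d D) :
    D = conv 𝒰 (ι 𝒰 ∘ₗ toCogen 𝒰 ∘ₗ D) LinearMap.id := by
  have h := convExp_coder 𝒰 (grading 𝒰) ι_toCogen_isHomog (by simp [toCogen_one]) hD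
    ((ι_toCogen_isHomog.comp hd).of_eq (add_zero d))
  rw [convExp_toCogen, LinearMap.id_comp] at h
  exact h

/-- For a coalgebra morphism `F` and a coderivation `D`, the map `F D` is of the form `e * F` with
`e` valued in the cogenerators. -/
theorem coalgHom_comp_coder (hF : IsCoalgHom 𝒰 𝒰' F)
    (hF0 : IsHomog (grading 𝒰) (grading 𝒰') 0 F) {d : ℤ} {D : GSym 𝒰 →ₗ[k] GSym 𝒰}
    (hD : IsCoder 𝒰 d D) (hd : IsHomog (grading 𝒰) (grading 𝒰) d D) :
    F ∘ₗ D = conv 𝒰 (ι 𝒰' ∘ₗ toCogen 𝒰' ∘ₗ F ∘ₗ D) F := by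
  have hp : IsHomog (grading 𝒰) (grading 𝒰') 0 (ι 𝒰' ∘ₗ toCogen 𝒰' ∘ₗ F) :=
    ι_toCogen_comp_isHomog hF0
  have h := convExp_coder 𝒰 (grading 𝒰') hp (by simp [toCogen_one, hF.one]) hD
    ((hp.comp hd).of_eq (add_zero d))
  rw [← eq_convExp_of_isCoalgHom hF] at h
  simpa only [LinearMap.comp_assoc] using h

variable (𝒰) in
/-- The inclusion of the left factor `a ↦ a ⊗ 1`. -/
def inl : GSym 𝒰 →ₐ[k] grading 𝒰 ᵍ⊗[k] grading 𝒰 := GradedTensorProduct.includeLeft _ _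

variable (𝒰) in
/-- The inclusion of the right factor `b ↦ 1 ⊗ b`. -/
def inr : GSym 𝒰 →ₐ[k] grading 𝒰 ᵍ⊗[k] grading 𝒰 := GradedTensorProduct.includeRight _ _

open GradedTensorProduct in
theorem inl_mul_inr (a b : GSym 𝒰) : inl 𝒰 a * inr 𝒰 b = (a ᵍ⊗ₜ[k] b) := by
  have h1 : (1 : GSym 𝒰) ∈ grading 𝒰 0 := SetLike.GradedOne.one_mem
  have := tmul_mul_tmul 𝒰 (a := a) (d := b) h1 h1
  rw [mul_zero, zpow_zero, one_smul, mul_one, one_mul] at this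
  exact this

open GradedTensorProduct in
theorem inl_comm_inr {p q : ℤ} {a b : GSym 𝒰} (ha : a ∈ grading 𝒰 p) (hb : b ∈ grading 𝒰 q) :
    inl 𝒰 a * inr 𝒰 b = ((-1 : k) ^ (p * q)) • (inr 𝒰 b * inl 𝒰 a) := by
  have h : inr 𝒰 b * inl 𝒰 a = ((-1 : k) ^ (q * p)) • (a ᵍ⊗ₜ[k] b) := by
    have := tmul_mul_tmul 𝒰 (a := 1) (d := 1) hb ha
    rw [mul_one, one_mul] at this
    exact this
  rw [h, inl_mul_inr, smul_smul, mul_comm q p, neg_one_zpow_mul_self, one_smul]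

theorem conv_inl_inr (f g : GSym 𝒰 →ₗ[k] GSym 𝒰') :
    conv 𝒰 ((inl 𝒰').toLinearMap ∘ₗ f) ((inr 𝒰').toLinearMap ∘ₗ g) =
      (GradedTensorProduct.of k (grading 𝒰') (grading 𝒰')).toLinearMap ∘ₗ
        TensorProduct.map f g ∘ₗ comul 𝒰 := by
  have h : LinearMap.mul' k _ ∘ₗ TensorProduct.map (inl 𝒰').toLinearMap (inr 𝒰').toLinearMap =
      (GradedTensorProduct.of k (grading 𝒰') (grading 𝒰')).toLinearMap := by
    ext a b
    exact inl_mul_inr a b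
  rw [conv, TensorProduct.map_comp, ← h]
  rfl

variable (𝒰) in
theorem comulHom_eq_conv : (comulHom 𝒰).toLinearMap =
    conv 𝒰 (inl 𝒰).toLinearMap (inr 𝒰).toLinearMap := by
  have := conv_inl_inr (𝒰 := 𝒰) (𝒰' := 𝒰) LinearMap.id LinearMap.id
  rw [LinearMap.comp_id, LinearMap.comp_id] at this
  rw [this, TensorProduct.map_id]
  rfl

theorem comulHom_comp_ι : (comulHom 𝒰).toLinearMap ∘ₗ ι 𝒰 =
    (inl 𝒰).toLinearMap ∘ₗ ι 𝒰 + (inr 𝒰).toLinearMap ∘ₗ ι 𝒰 := by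
  ext x
  simp only [LinearMap.comp_apply, AlgHom.toLinearMap_apply, comulHom, lift_ι]
  rfl

/-- The exponential of a map to the cogenerators is a morphism of coalgebras. -/
theorem isCoalgHom_convExp {f : GSym 𝒰 →ₗ[k] U'}
    (hf : IsHomog (grading 𝒰) (grading 𝒰') 0 (ι 𝒰' ∘ₗ f)) (hf1 : f 1 = 0) :
    IsCoalgHom 𝒰 𝒰' (convExp 𝒰 (ι 𝒰' ∘ₗ f)) := by
  have hι1 : (ι 𝒰' ∘ₗ f) 1 = 0 := by simp [hf1]
  have hodd := fun p x hx => convExp_mulι 𝒰 (grading 𝒰') (p := p) (x := x) hf hι1 hx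
  have hF0 := convExp_isHomog 𝒰 (grading 𝒰') hf
  have hF1 := convExp_one 𝒰 (ι 𝒰' ∘ₗ f)
  refine ⟨?_, ?_, hF1⟩
  · generalize convExp 𝒰 (ι 𝒰' ∘ₗ f) = F at *
    suffices (comulHom 𝒰').toLinearMap ∘ₗ F =
        conv 𝒰 ((inl 𝒰').toLinearMap ∘ₗ F) ((inr 𝒰').toLinearMap ∘ₗ F) by
      intro a
      rw [conv_inl_inr] at this
      exact (GradedTensorProduct.of k (grading 𝒰') (grading 𝒰')).injective
        (LinearMap.congr_fun this a)
    refine eq_of_mulι 𝒰 (by simp [hF1])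
      (fun x => (comulHom 𝒰').toLinearMap ∘ₗ (ι 𝒰' ∘ₗ f) ∘ₗ mulι 𝒰 x)
      (fun p x hx => ?_) (fun p x hx => ?_)
    · rw [LinearMap.comp_assoc, hodd p x hx, algHom_conv]
    · have hc := conv_comm 𝒰 (f := (inl 𝒰').toLinearMap ∘ₗ F)
        (g := (inr 𝒰').toLinearMap ∘ₗ (ι 𝒰' ∘ₗ f) ∘ₗ mulι 𝒰 x) (e := 0) (d := p)
        (fun q r a b ha hb => inl_comm_inr (hF0 q a ha) (by
          have := isHomog_comp_mulι 𝒰 (grading 𝒰') hf hx r b hb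
          rwa [add_zero] at this))
      rw [koszul_zero, LinearMap.comp_id, zero_mul, zpow_zero, one_smul] at hc
      rw [conv_mulι 𝒰 hx, LinearMap.comp_assoc (mulι 𝒰 x), LinearMap.comp_assoc (mulι 𝒰 x),
        hodd p x hx, algHom_conv, algHom_conv, ← conv_assoc 𝒰 (_ ∘ₗ koszul _ _), hc, conv_assoc,
        conv_assoc, ← conv_add_left]
      congr 1
      have := congrArg (fun T => T ∘ₗ f ∘ₗ mulι 𝒰 x) (comulHom_comp_ι (𝒰 := 𝒰'))
      simp only [LinearMap.add_comp, LinearMap.comp_assoc] at this ⊢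
      exact this.symm
  · have h := algHom_convExp 𝒰 (counit 𝒰') (ι 𝒰' ∘ₗ f)
    have h0 : (counit 𝒰').toLinearMap ∘ₗ (ι 𝒰' ∘ₗ f) = 0 := by ext a; simp [counit]
    have h1 : convExp 𝒰 (0 : GSym 𝒰 →ₗ[k] k) = (counit 𝒰).toLinearMap := by
      refine ext_words 𝒰 fun l hl => ?_
      rw [convExp_eq_ser, ser_wprod 𝒰 _ rfl hl (Nat.lt_succ_self _), Finset.sum_range_succ']
      simp [convPow_succ, conv_zero_left, convPow_zero, convUnit]
    rw [h0, h1] at h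
    exact LinearMap.congr_fun h

theorem toCogen_convExp {f : GSym 𝒰 →ₗ[k] U'}
    (hf : IsHomog (grading 𝒰) (grading 𝒰') 0 (ι 𝒰' ∘ₗ f)) (hf1 : f 1 = 0) :
    toCogen 𝒰' ∘ₗ convExp 𝒰 (ι 𝒰' ∘ₗ f) = f := by
  have hF := isCoalgHom_convExp hf hf1
  have h := eq_convExp_of_isCoalgHom hF
  have hF0 := convExp_isHomog 𝒰 (grading 𝒰') hf
  have h' := convExp_injective 𝒰 (grading 𝒰') hf (by simp [hf1])
    (ι_toCogen_comp_isHomog hF0) (by simp [hF.one, toCogen_one]) h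
  ext a
  have := congrArg (toCogen 𝒰') (LinearMap.congr_fun h' a)
  simpa using this.symm

/-- The extension `d * id` of a map `d` to the cogenerators is a coderivation. -/
theorem isCoder_conv_id {d : GSym 𝒰 →ₗ[k] U} {e : ℤ}
    (hd : IsHomog (grading 𝒰) (grading 𝒰) e (ι 𝒰 ∘ₗ d)) :
    IsCoder 𝒰 e (conv 𝒰 (ι 𝒰 ∘ₗ d) LinearMap.id) := by
  have hc := conv_comm 𝒰 (f := (inl 𝒰).toLinearMap) (g := (inr 𝒰).toLinearMap ∘ₗ ι 𝒰 ∘ₗ d)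
    (e := 0) (d := e)
    (fun q r a b ha hb => inl_comm_inr (by simpa using ha) (hd r b hb))
  rw [koszul_zero, LinearMap.comp_id, zero_mul, zpow_zero, one_smul] at hc
  have h1 := conv_inl_inr (𝒰 := 𝒰) (𝒰' := 𝒰) (conv 𝒰 (ι 𝒰 ∘ₗ d) LinearMap.id) LinearMap.id
  have h2 := conv_inl_inr (𝒰 := 𝒰) (𝒰' := 𝒰) (koszul (grading 𝒰) e)
    (conv 𝒰 (ι 𝒰 ∘ₗ d) LinearMap.id)
  have h3 : (comulHom 𝒰).toLinearMap ∘ₗ conv 𝒰 (ι 𝒰 ∘ₗ d) LinearMap.id =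
      conv 𝒰 ((inl 𝒰).toLinearMap ∘ₗ conv 𝒰 (ι 𝒰 ∘ₗ d) LinearMap.id)
          ((inr 𝒰).toLinearMap ∘ₗ LinearMap.id) +
        conv 𝒰 ((inl 𝒰).toLinearMap ∘ₗ koszul (grading 𝒰) e)
          ((inr 𝒰).toLinearMap ∘ₗ conv 𝒰 (ι 𝒰 ∘ₗ d) LinearMap.id) := by
    rw [algHom_conv, algHom_conv, algHom_conv, ← conv_assoc 𝒰 (_ ∘ₗ koszul _ _), hc, conv_assoc,
      conv_assoc, LinearMap.comp_id, LinearMap.comp_id, LinearMap.comp_id, ← comulHom_eq_conv,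
      ← conv_add_left, ← LinearMap.comp_assoc, comulHom_comp_ι, LinearMap.add_comp]
    rfl
  intro a
  rw [h1, h2] at h3
  exact (GradedTensorProduct.of k (grading 𝒰) (grading 𝒰)).injective
    ((LinearMap.congr_fun h3 a).trans
      (map_add (GradedTensorProduct.of k (grading 𝒰) (grading 𝒰)) _ _).symm)

end AlgHom

end GSym

/-! ### Laurent series in `ħ` -/

section Laurent

variable {k V W : Type*} [Field k] [Ring V] [Algebra k V] [Ring W] [Algebra k W]

/-- The power `ħⁿ`, `n ∈ ℤ`, as a Laurent series. -/
def hb (V : Type*) [Ring V] (n : ℤ) : LaurentSeries V := HahnSeries.single n 1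

theorem coeff_hb_mul (n m : ℤ) (v : LaurentSeries V) :
    (hb V n * v).coeff m = v.coeff (m - n) := by
  rw [hb, HahnSeries.coeff_single_mul, one_mul]

theorem hb_comm (n : ℤ) (v : LaurentSeries V) : hb V n * v = v * hb V n := by
  ext m
  rw [coeff_hb_mul, hb, HahnSeries.coeff_mul_single, mul_one]

theorem hb_mul_hb (m n : ℤ) : hb V m * hb V n = hb V (m + n) := by
  rw [hb, hb, HahnSeries.single_mul_single, one_mul, hb]

theorem hb_zero : hb V 0 = 1 := rfl

theorem hb_mul_hb_mul (m n : ℤ) (v : LaurentSeries V) :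
    hb V m * (hb V n * v) = hb V (m + n) * v := by rw [← mul_assoc, hb_mul_hb]

theorem hb_neg_mul_cancel (n : ℤ) (v : LaurentSeries V) : hb V (-n) * (hb V n * v) = v := by
  rw [hb_mul_hb_mul, neg_add_cancel, hb_zero, one_mul]

theorem hb_mul_neg_cancel (n : ℤ) (v : LaurentSeries V) : hb V n * (hb V (-n) * v) = v := by
  rw [hb_mul_hb_mul, add_neg_cancel, hb_zero, one_mul]

theorem hb_mul_injective (n : ℤ) {v w : LaurentSeries V} (h : hb V n * v = hb V n * w) :
    v = w := by
  rw [← hb_neg_mul_cancel n v, h, hb_neg_mul_cancel]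

variable (k) in
/-- The inclusion of power series into Laurent series. -/
def ps : PowerSeries V →ₐ[k] LaurentSeries V := HahnSeries.ofPowerSeriesAlg ℤ k

theorem ps_apply (v : PowerSeries V) : ps k v = HahnSeries.ofPowerSeries ℤ V v := rfl

theorem ps_injective : Function.Injective (ps k : PowerSeries V → LaurentSeries V) :=
  HahnSeries.ofPowerSeries_injective

theorem ps_X_pow (n : ℕ) : ps k (PowerSeries.X ^ n : PowerSeries V) = hb V n := by
  rw [ps_apply, HahnSeries.ofPowerSeries_X_pow]; rfl

theorem ps_X_pow_mul (n : ℕ) (v : PowerSeries V) :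
    ps k (PowerSeries.X ^ n * v) = hb V n * ps k v := by
  rw [map_mul, ps_X_pow]

variable (k) in
theorem exists_hb_mul_eq_ps (v : LaurentSeries V) :
    ∃ (n : ℤ) (w : PowerSeries V), hb V n * v = ps k w :=
  ⟨-v.order, v.powerSeriesPart, (LaurentSeries.ofPowerSeries_powerSeriesPart v).symm⟩

theorem hextend_X_pow_mul {𝒲 : ℤ → Submodule k W} [SetLike.GradedMonoid 𝒲]
    (f : V →ₗ[k] HSeries 𝒲) (n : ℕ) (v : PowerSeries V) :
    hextend f (PowerSeries.X ^ n * v) = PowerSeries.X ^ n * hextend f v := by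
  have h1 : ∀ v, hextend f (PowerSeries.X * v) = PowerSeries.X * hextend f v := by
    intro v
    refine PowerSeries.ext fun m => ?_
    cases m with
    | zero => simp [hextend]
    | succ m =>
      rw [PowerSeries.coeff_succ_X_mul]
      simp only [hextend, LinearMap.coe_mk, AddHom.coe_mk, PowerSeries.coeff_mk]
      rw [Finset.Nat.sum_antidiagonal_succ']
      simp [PowerSeries.coeff_succ_X_mul]
  induction n with
  | zero => simp
  | succ n ih => rw [pow_succ', pow_succ', mul_assoc, h1, ih, mul_assoc]

theorem hextend_C {𝒲 : ℤ → Submodule k W} [SetLike.GradedMonoid 𝒲]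
    (f : V →ₗ[k] HSeries 𝒲) (v : V) : hextend f (PowerSeries.C v) = f v := by
  refine PowerSeries.ext fun m => ?_
  simp only [hextend, LinearMap.coe_mk, AddHom.coe_mk, PowerSeries.coeff_mk]
  rw [Finset.sum_eq_single (m, 0)]
  · simp [hcoeff]
  · intro b hb hne
    rw [Finset.HasAntidiagonal.mem_antidiagonal] at hb
    have : b.2 ≠ 0 := fun h => hne (Prod.ext (by simpa [h] using hb) h)
    rw [PowerSeries.coeff_C, if_neg this, map_zero, map_zero]
  · simp

/-- The extensions compose: `(g f)[[ħ]] = g[[ħ]] f[[ħ]]`. -/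
theorem hextend_hextend {Z : Type*} [Ring Z] [Algebra k Z] {𝒲 : ℤ → Submodule k W}
    [SetLike.GradedMonoid 𝒲] {𝒵 : ℤ → Submodule k Z} [SetLike.GradedMonoid 𝒵]
    {g : W →ₗ[k] HSeries 𝒵} {d : ℤ} (hg : IsHomog 𝒲 (hGrading 𝒵) d g) (f : V →ₗ[k] HSeries 𝒲)
    (v : PowerSeries V) : hextend g (hextend f v) = hextend (hext hg ∘ₗ f) v := by
  refine PowerSeries.ext fun m => ?_
  have e : ∀ (i : ℕ) (x : V), hcoeff 𝒵 i ((hext hg ∘ₗ f) x) =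
      ∑ ab ∈ Finset.HasAntidiagonal.antidiagonal i, hcoeff 𝒵 ab.1 (g (hcoeff 𝒲 ab.2 (f x))) := by
    intro i x
    change PowerSeries.coeff i (hextend g (f x : PowerSeries W)) = _
    simp only [hextend, LinearMap.coe_mk, AddHom.coe_mk, PowerSeries.coeff_mk]
    rfl
  simp only [hextend, LinearMap.coe_mk, AddHom.coe_mk, PowerSeries.coeff_mk, e, map_sum]
  rw [Finset.sum_sigma', Finset.sum_sigma']
  refine Finset.sum_nbij' (fun x => ⟨(x.1.1 + x.2.1, x.2.2), (x.1.1, x.2.1)⟩)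
    (fun x => ⟨(x.2.1, x.2.2 + x.1.2), (x.2.2, x.1.2)⟩) ?_ ?_ ?_ ?_ ?_
  all_goals
    rintro ⟨⟨a, b⟩, ⟨c, d⟩⟩ h
    simp only [Finset.mem_sigma, Finset.HasAntidiagonal.mem_antidiagonal] at h ⊢
  · exact ⟨by rw [add_assoc, h.2, h.1], trivial⟩
  · exact ⟨by rw [← add_assoc, h.2, h.1], trivial⟩
  · obtain ⟨h1, rfl⟩ := h; rfl
  · obtain ⟨h1, rfl⟩ := h; rfl

/-- The `k((ħ))`-linear continuous extension `V((ħ)) → W((ħ))` of `f : V → W[[ħ]]`. -/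
def lext {𝒲 : ℤ → Submodule k W} [SetLike.GradedMonoid 𝒲] (f : V →ₗ[k] HSeries 𝒲) :
    LaurentSeries V →ₗ[k] LaurentSeries W :=
  have key : ∀ (n m : ℤ) (v w : PowerSeries V) (x : LaurentSeries V), hb V n * x = ps k v →
      hb V m * x = ps k w → hb W (-n) * ps k (hextend f v) = hb W (-m) * ps k (hextend f w) := by
    have h1 : ∀ (n : ℤ) (j : ℕ) (v w : PowerSeries V) (x : LaurentSeries V),
        hb V n * x = ps k v → hb V (n + j) * x = ps k w →
        hb W (-n) * ps k (hextend f v) = hb W (-(n + j)) * ps k (hextend f w) := by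
      intro n j v w x hv hw
      have : w = PowerSeries.X ^ j * v := ps_injective (k := k) (by
        rw [ps_X_pow_mul, ← hv, ← hw, hb_mul_hb_mul, add_comm])
      rw [this, hextend_X_pow_mul, ps_X_pow_mul, hb_mul_hb_mul]
      congr 2; ring
    intro n m v w x hv hw
    rcases le_total n m with h | h
    · obtain ⟨j, rfl⟩ := Int.le.dest h
      exact h1 n j v w x hv hw
    · obtain ⟨j, rfl⟩ := Int.le.dest h
      exact (h1 m j w v x hw hv).symm
  have up : ∀ (n : ℤ) (v : PowerSeries V) (x : LaurentSeries V), hb V n * x = ps k v →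
      ∀ j : ℕ, hb V (n + j) * x = ps k (PowerSeries.X ^ j * v) := by
    intro n v x h j
    rw [ps_X_pow_mul, ← h, hb_mul_hb_mul, add_comm]
  { toFun := fun v => hb W (-(exists_hb_mul_eq_ps k v).choose) *
      ps k (hextend f (exists_hb_mul_eq_ps k v).choose_spec.choose)
    map_add' := fun x y => by
      have hx := (exists_hb_mul_eq_ps k x).choose_spec.choose_spec
      have hy := (exists_hb_mul_eq_ps k y).choose_spec.choose_spec
      have hxy := (exists_hb_mul_eq_ps k (x + y)).choose_spec.choose_spec
      generalize (exists_hb_mul_eq_ps k x).choose_spec.choose = v at *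
      generalize (exists_hb_mul_eq_ps k x).choose = n at *
      generalize (exists_hb_mul_eq_ps k y).choose_spec.choose = w at *
      generalize (exists_hb_mul_eq_ps k y).choose = m at *
      generalize (exists_hb_mul_eq_ps k (x + y)).choose_spec.choose = u at *
      generalize (exists_hb_mul_eq_ps k (x + y)).choose = r at *
      have hx' := up _ _ _ hx (max n m - n).toNat
      have hy' := up _ _ _ hy (max n m - m).toNat
      rw [Int.toNat_of_nonneg (by omega), add_sub_cancel] at hx' hy'
      rw [key _ _ _ _ _ hx hx', key _ _ _ _ _ hy hy', ← mul_add, ← map_add, ← map_add]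
      refine key _ _ _ _ _ hxy ?_
      rw [mul_add, hx', hy', map_add]
    map_smul' := fun c x => by
      have hx := (exists_hb_mul_eq_ps k x).choose_spec.choose_spec
      have hxy := (exists_hb_mul_eq_ps k (c • x)).choose_spec.choose_spec
      generalize (exists_hb_mul_eq_ps k x).choose_spec.choose = v at *
      generalize (exists_hb_mul_eq_ps k x).choose = n at *
      generalize (exists_hb_mul_eq_ps k (c • x)).choose_spec.choose = u at *
      generalize (exists_hb_mul_eq_ps k (c • x)).choose = r at *
      rw [RingHom.id_apply, ← mul_smul_comm, ← map_smul, ← map_smul]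
      refine key _ _ _ _ _ hxy ?_
      rw [mul_smul_comm, hx, map_smul] }

theorem lext_of_eq {𝒲 : ℤ → Submodule k W} [SetLike.GradedMonoid 𝒲] (f : V →ₗ[k] HSeries 𝒲)
    {n : ℤ} {v : PowerSeries V} {x : LaurentSeries V} (h : hb V n * x = ps k v) :
    lext f x = hb W (-n) * ps k (hextend f v) := by
  have hx := (exists_hb_mul_eq_ps k x).choose_spec.choose_spec
  change hb W (-(exists_hb_mul_eq_ps k x).choose) *
      ps k (hextend f (exists_hb_mul_eq_ps k x).choose_spec.choose) = _
  generalize (exists_hb_mul_eq_ps k x).choose_spec.choose = w at *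
  generalize (exists_hb_mul_eq_ps k x).choose = m at *
  rcases le_total n m with h' | h'
  · obtain ⟨j, rfl⟩ := Int.le.dest h'
    have : w = PowerSeries.X ^ j * v := ps_injective (k := k) (by
      rw [ps_X_pow_mul, ← h, ← hx, hb_mul_hb_mul, add_comm])
    rw [this, hextend_X_pow_mul, ps_X_pow_mul, hb_mul_hb_mul]
    congr 2; ring
  · obtain ⟨j, rfl⟩ := Int.le.dest h'
    have : v = PowerSeries.X ^ j * w := ps_injective (k := k) (by
      rw [ps_X_pow_mul, ← h, ← hx, hb_mul_hb_mul, add_comm])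
    rw [this, hextend_X_pow_mul, ps_X_pow_mul, hb_mul_hb_mul]
    congr 2; ring

theorem lext_ps {𝒲 : ℤ → Submodule k W} [SetLike.GradedMonoid 𝒲] (f : V →ₗ[k] HSeries 𝒲)
    (v : PowerSeries V) : lext f (ps k v) = ps k (hextend f v) := by
  rw [lext_of_eq f (n := 0) (v := v) (by rw [hb_zero, one_mul]), neg_zero, hb_zero, one_mul]

theorem lext_hb_mul {𝒲 : ℤ → Submodule k W} [SetLike.GradedMonoid 𝒲] (f : V →ₗ[k] HSeries 𝒲)
    (n : ℤ) (x : LaurentSeries V) : lext f (hb V n * x) = hb W n * lext f x := by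
  obtain ⟨m, v, h⟩ := exists_hb_mul_eq_ps k x
  rw [lext_of_eq f h, lext_of_eq f (n := m - n) (v := v) (by
    rw [hb_mul_hb_mul, sub_add_cancel, h]), hb_mul_hb_mul]
  congr 2; ring

/-- The part of degree `p` of the Laurent series, where `|ħ| = 2`. -/
def lGrading (𝒱 : ℤ → Submodule k V) (p : ℤ) : Submodule k (LaurentSeries V) where
  carrier := {v | ∀ n : ℤ, v.coeff n ∈ 𝒱 (p - 2 * n)}
  zero_mem' n := by simp
  add_mem' ha hb n := by rw [HahnSeries.coeff_add]; exact add_mem (ha n) (hb n)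
  smul_mem' c v hv n := by
    rw [HahnSeries.coeff_smul]; exact Submodule.smul_mem _ c (hv n)

theorem hb_mul_mem {𝒱 : ℤ → Submodule k V} {p : ℤ} {v : LaurentSeries V}
    (hv : v ∈ lGrading 𝒱 p) (n : ℤ) : hb V n * v ∈ lGrading 𝒱 (p + 2 * n) := by
  intro m
  rw [coeff_hb_mul]
  have := hv (m - n)
  convert this using 2
  ring

theorem ps_mem {𝒱 : ℤ → Submodule k V} {p : ℤ} {v : PowerSeries V}
    (hv : v ∈ hHomog 𝒱 p) : ps k v ∈ lGrading 𝒱 p := by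
  intro n
  rw [ps_apply, PowerSeries.coeff_coe]
  split_ifs with h
  · exact zero_mem _
  · have := hv n.natAbs
    rwa [Int.natCast_natAbs, abs_of_nonneg (by omega)] at this

instance (𝒱 : ℤ → Submodule k V) [SetLike.GradedMonoid 𝒱] :
    SetLike.GradedMonoid (lGrading 𝒱) where
  one_mem := by
    have := ps_mem (hHomog_one 𝒱)
    rwa [map_one] at this
  mul_mem p q a b ha hb n := by
    rw [HahnSeries.coeff_mul]
    refine Submodule.sum_mem _ fun ij hij => ?_
    rw [Finset.mem_antidiagonal] at hij
    have := SetLike.GradedMul.mul_mem (ha ij.1) (hb ij.2)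
    rw [← hij.2.2]
    convert this using 2
    ring

instance (𝒱 : ℤ → Submodule k V) [SetLike.GradedMonoid 𝒱] [GrComm 𝒱] :
    GrComm (lGrading 𝒱) where
  comm p q a b ha hb := by
    ext n
    rw [HahnSeries.coeff_smul, HahnSeries.coeff_mul, HahnSeries.coeff_mul, Finset.smul_sum]
    refine Finset.sum_bij' (fun ij _ => (ij.2, ij.1)) (fun ij _ => (ij.2, ij.1)) ?_ ?_ ?_ ?_ ?_
    · intro ij hij
      rw [Finset.mem_antidiagonal] at hij ⊢
      exact ⟨hij.2.1, hij.1, by rw [add_comm]; exact hij.2.2⟩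
    · intro ij hij
      rw [Finset.mem_antidiagonal] at hij ⊢
      exact ⟨hij.2.1, hij.1, by rw [add_comm]; exact hij.2.2⟩
    · intro ij _; rfl
    · intro ij _; rfl
    · intro ij _
      have h := GrComm.comm (k := k) _ _ _ _ (ha ij.1) (hb ij.2)
      have e : (p - 2 * ij.1) * (q - 2 * ij.2) =
        p * q + 2 * (-(p * ij.2) - q * ij.1 + 2 * ij.1 * ij.2) := by ring
      rw [e, zpow_add₀ (by simp), zpow_mul (-1 : k) 2] at h
      simpa using h

/-- The inclusion of `V[[ħ]]` into the Laurent series. -/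
def inc (𝒱 : ℤ → Submodule k V) [SetLike.GradedMonoid 𝒱] : HSeries 𝒱 →ₐ[k] LaurentSeries V :=
  (ps k).comp (HSeries 𝒱).val

theorem inc_apply (𝒱 : ℤ → Submodule k V) [SetLike.GradedMonoid 𝒱] (v : HSeries 𝒱) :
    inc 𝒱 v = ps k (v : PowerSeries V) := rfl

theorem inc_injective (𝒱 : ℤ → Submodule k V) [SetLike.GradedMonoid 𝒱] :
    Function.Injective (inc 𝒱) := fun _ _ h => Subtype.ext (ps_injective h)

theorem inc_mem {𝒱 : ℤ → Submodule k V} [SetLike.GradedMonoid 𝒱] {p : ℤ} {v : HSeries 𝒱}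
    (hv : v ∈ hGrading 𝒱 p) : inc 𝒱 v ∈ lGrading 𝒱 p := ps_mem hv

theorem lext_inc {𝒱 : ℤ → Submodule k V} [SetLike.GradedMonoid 𝒱] {𝒲 : ℤ → Submodule k W}
    [SetLike.GradedMonoid 𝒲] {f : V →ₗ[k] HSeries 𝒲} {d : ℤ} (hf : IsHomog 𝒱 (hGrading 𝒲) d f)
    (v : HSeries 𝒱) : lext f (inc 𝒱 v) = inc 𝒲 (hext hf v) := lext_ps f v

variable {𝒱 : ℤ → Submodule k V} [GradedAlgebra 𝒱]

theorem hmonomial_coe (n : ℕ) (v : V) :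
    (hmonomial 𝒱 n v : PowerSeries V) = PowerSeries.X ^ n * PowerSeries.C v := by
  refine PowerSeries.ext fun m => ?_
  change PowerSeries.coeff m (PowerSeries.monomial n v) = _
  rw [PowerSeries.coeff_monomial, PowerSeries.coeff_X_pow_mul', PowerSeries.coeff_C]
  split_ifs <;> first | rfl | omega

theorem inc_hmonomial (n : ℕ) (v : V) :
    inc 𝒱 (hmonomial 𝒱 n v) = hb V n * inc 𝒱 (hmonomial 𝒱 0 v) := by
  rw [inc_apply, inc_apply, hmonomial_coe, hmonomial_coe, ps_X_pow_mul, pow_zero, one_mul]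

theorem lext_hmonomial {𝒲 : ℤ → Submodule k W} [SetLike.GradedMonoid 𝒲]
    (f : V →ₗ[k] HSeries 𝒲) (v : V) : lext f (inc 𝒱 (hmonomial 𝒱 0 v)) = inc 𝒲 (f v) := by
  rw [inc_apply, hmonomial_coe, pow_zero, one_mul, lext_ps, hextend_C]; rfl

theorem hmonomial_zero_mul (v w : V) :
    hmonomial 𝒱 0 (v * w) = hmonomial 𝒱 0 v * hmonomial 𝒱 0 w := by
  refine Subtype.ext ?_
  rw [MulMemClass.coe_mul, hmonomial_coe, hmonomial_coe, hmonomial_coe]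
  simp

theorem hmonomial_zero_one : hmonomial 𝒱 0 1 = 1 := by
  refine Subtype.ext ?_
  rw [hmonomial_coe]; simp

theorem hmonomial_mem {p : ℤ} {v : V} (hv : v ∈ 𝒱 p) (n : ℕ) :
    hmonomial 𝒱 n v ∈ hGrading 𝒱 (p + 2 * n) := by
  rw [mem_hGrading]
  intro j
  change PowerSeries.coeff j (PowerSeries.monomial n v) ∈ _
  rw [PowerSeries.coeff_monomial]
  split_ifs with h
  · subst h; simpa using hv
  · exact zero_mem _

theorem hdiv_coe (m : ℕ) (v : HSeries 𝒱) (n : ℕ) :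
    PowerSeries.coeff n (hdiv 𝒱 m v : PowerSeries V) =
      PowerSeries.coeff (n + m) (v : PowerSeries V) := by
  change PowerSeries.coeff n (divAux k V m v) = _
  simp [divAux]

/-- Division by `ħᵐ` is exact if the coefficients of order `< m` vanish. -/
theorem X_pow_mul_hdiv (m : ℕ) (v : HSeries 𝒱) (h : ∀ n < m, hcoeff 𝒱 n v = 0) :
    (PowerSeries.X : PowerSeries V) ^ m * (hdiv 𝒱 m v : PowerSeries V) = (v : PowerSeries V) := by
  refine PowerSeries.ext fun n => ?_
  rw [PowerSeries.coeff_X_pow_mul']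
  split_ifs with hn
  · rw [hdiv_coe, Nat.sub_add_cancel hn]
  · exact (h n (by omega)).symm

theorem hb_mul_inc_hdiv (m : ℕ) (v : HSeries 𝒱) (h : ∀ n < m, hcoeff 𝒱 n v = 0) :
    hb V m * inc 𝒱 (hdiv 𝒱 m v) = inc 𝒱 v := by
  rw [inc_apply, inc_apply, ← ps_X_pow_mul, X_pow_mul_hdiv m v h]

theorem hdiv_mem {p : ℤ} {v : HSeries 𝒱} (hv : v ∈ hGrading 𝒱 p) (m : ℕ) :
    hdiv 𝒱 m v ∈ hGrading 𝒱 (p - 2 * m) := by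
  rw [mem_hGrading] at hv ⊢
  intro n
  rw [hdiv_coe]
  have := hv (n + m)
  convert this using 2
  push_cast; ring

end Laurent

namespace GSym

/-! ### Rescaling the symmetric powers by powers of `ħ` -/

section Scale

variable {k U V : Type*} [Field k] [AddCommGroup U] [Module k U] [Ring V] [Algebra k V]
  (𝒰 : ℤ → Submodule k U) [Decomposition 𝒰]

/-- The map `f` multiplied by `ħ^{um}` on `Sᵐ`. -/
def scale (u : ℤ) (f : GSym 𝒰 →ₗ[k] LaurentSeries V) : GSym 𝒰 →ₗ[k] LaurentSeries V :=
  weightwise 𝒰 fun m => LinearMap.mulLeft k (hb V (u * m)) ∘ₗ f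

theorem scale_wprod (u : ℤ) (f : GSym 𝒰 →ₗ[k] LaurentSeries V) (l : List (ℤ × U)) :
    scale 𝒰 u f (wprod 𝒰 l) = hb V (u * l.length) * f (wprod 𝒰 l) := by
  rw [scale, weightwise_wprod]; rfl

theorem scale_one (u : ℤ) (f : GSym 𝒰 →ₗ[k] LaurentSeries V) : scale 𝒰 u f 1 = f 1 := by
  have := scale_wprod 𝒰 u f []
  simpa [hb_zero] using this

theorem scale_mulι (u : ℤ) (f : GSym 𝒰 →ₗ[k] LaurentSeries V) (x : U) :
    scale 𝒰 u f ∘ₗ mulι 𝒰 x =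
      LinearMap.mulLeft k (hb V u) ∘ₗ scale 𝒰 u (f ∘ₗ mulι 𝒰 x) := by
  refine ext_words 𝒰 fun l hl => ?_
  have h := scale_wprod 𝒰 u f ((0, x) :: l)
  rw [LinearMap.comp_apply, LinearMap.comp_apply, scale_wprod, LinearMap.mulLeft_apply,
    hb_mul_hb_mul]
  refine h.trans ?_
  rw [List.length_cons, wprod_cons]
  congr 2
  push_cast; ring

theorem scale_koszul (u d : ℤ) (f : GSym 𝒰 →ₗ[k] LaurentSeries V) :
    scale 𝒰 u f ∘ₗ koszul (grading 𝒰) d = scale 𝒰 u (f ∘ₗ koszul (grading 𝒰) d) := by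
  refine ext_words 𝒰 fun l hl => ?_
  rw [LinearMap.comp_apply, scale_wprod, LinearMap.comp_apply, koszul_wprod 𝒰 d hl, map_smul,
    map_smul, scale_wprod, mul_smul_comm]

theorem conv_scale (u : ℤ) (f g : GSym 𝒰 →ₗ[k] LaurentSeries V) :
    conv 𝒰 (scale 𝒰 u f) (scale 𝒰 u g) = scale 𝒰 u (conv 𝒰 f g) := by
  refine ext_words 𝒰 fun l hl => ?_
  induction l generalizing f g with
  | nil => simp [scale_one]
  | cons t l ih =>
    obtain ⟨ht, hl⟩ := isWord_cons.1 hl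
    have h := LinearMap.congr_fun (scale_mulι 𝒰 u (conv 𝒰 f g) t.2) (wprod 𝒰 l)
    rw [LinearMap.comp_apply, LinearMap.comp_apply] at h
    have h' : mulι 𝒰 t.2 (wprod 𝒰 l) = wprod 𝒰 (t :: l) := rfl
    rw [h'] at h
    rw [conv_cons 𝒰 ht, scale_mulι 𝒰 u f, scale_mulι 𝒰 u g, scale_koszul, mulLeft_conv,
      conv_mulLeft 𝒰 (hb_comm u), LinearMap.comp_apply, LinearMap.comp_apply, ih _ _ hl,
      ih _ _ hl, h, conv_mulι 𝒰 ht, ← map_add]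
    congr 1
    rw [scale_wprod, scale_wprod, scale_wprod, LinearMap.add_apply, mul_add]

theorem scale_convUnit (u : ℤ) :
    scale 𝒰 u (convUnit 𝒰 (LaurentSeries V)) = convUnit 𝒰 (LaurentSeries V) := by
  refine ext_words 𝒰 fun l hl => ?_
  cases l with
  | nil => simp [scale_one]
  | cons t l => rw [scale_wprod, wprod_cons, convUnit_mul, mul_zero]

theorem scale_convPow (u : ℤ) (f : GSym 𝒰 →ₗ[k] LaurentSeries V) (n : ℕ) :
    scale 𝒰 u (convPow 𝒰 f n) = convPow 𝒰 (scale 𝒰 u f) n := by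
  induction n with
  | zero => exact scale_convUnit 𝒰 u
  | succ n ih => rw [convPow_succ, ← conv_scale, ih, convPow_succ]

theorem scale_convExp (u : ℤ) (f : GSym 𝒰 →ₗ[k] LaurentSeries V) :
    scale 𝒰 u (convExp 𝒰 f) = convExp 𝒰 (scale 𝒰 u f) := by
  refine ext_words 𝒰 fun l hl => ?_
  simp only [scale_wprod, convExp, weightwise_wprod, LinearMap.sum_apply, LinearMap.smul_apply,
    ← scale_convPow, Finset.mul_sum, mul_smul_comm]

end Scale

end GSym

/-! ### The transform `θ`, which absorbs the powers of `ħ` -/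

section Theta

open GSym

variable {k G V W : Type*} [Field k] [AddCommGroup G] [Module k G] [Ring V] [Algebra k V]
  [Ring W] [Algebra k W]
  {𝒢 : ℤ → Submodule k G} [Decomposition 𝒢]
  {𝒱 : ℤ → Submodule k V} [GradedAlgebra 𝒱] {𝒲 : ℤ → Submodule k W} [GradedAlgebra 𝒲]

theorem regrade_ι {𝒰 𝒰' : ℤ → Submodule k G} (c : ℤ) (h : ∀ p, 𝒰 p ≤ 𝒰' (p + 2 * c)) (x : G) :
    regrade 𝒰 𝒰' c h (ι 𝒰 x) = ι 𝒰' x := by rw [regrade, lift_ι]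

theorem regrade_wprod {𝒰 𝒰' : ℤ → Submodule k G} (c : ℤ) (h : ∀ p, 𝒰 p ≤ 𝒰' (p + 2 * c))
    (l : List (ℤ × G)) :
    regrade 𝒰 𝒰' c h (wprod 𝒰 l) = wprod 𝒰' (l.map fun t => (t.1 + 2 * c, t.2)) := by
  induction l with
  | nil => simp
  | cons t l ih => rw [wprod_cons, map_mul, ih, regrade_ι]; rfl

theorem isWord_regrade {𝒰 𝒰' : ℤ → Submodule k G} (c : ℤ) (h : ∀ p, 𝒰 p ≤ 𝒰' (p + 2 * c))
    {l : List (ℤ × G)} (hl : IsWord 𝒰 l) :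
    IsWord 𝒰' (l.map fun t => (t.1 + 2 * c, t.2)) := by
  intro t ht
  obtain ⟨s, hs, rfl⟩ := List.mem_map.1 ht
  exact h _ (hl s hs)

theorem sum_map_regrade (c : ℤ) (l : List (ℤ × G)) :
    ((l.map fun t => (t.1 + 2 * c, t.2)).map Prod.fst).sum =
      (l.map Prod.fst).sum + 2 * c * l.length := by
  induction l with
  | nil => simp
  | cons t l ih =>
    rw [List.map_cons, List.map_cons, List.sum_cons, ih, List.map_cons, List.sum_cons,
      List.length_cons]
    push_cast; ring

theorem isCoalgHom_regrade {𝒰 𝒰' : ℤ → Submodule k G} [Decomposition 𝒰] [Decomposition 𝒰']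
    (c : ℤ) (h : ∀ p, 𝒰 p ≤ 𝒰' (p + 2 * c)) :
    IsCoalgHom 𝒰 𝒰' (regrade 𝒰 𝒰' c h).toLinearMap :=
  isCoalgHom_of_algHom _ LinearMap.id c (fun p _ hx => h p hx) (fun x => regrade_ι c h x)

theorem isCoalgHom_susp : IsCoalgHom (shift 𝒢 1) (shift 𝒢 (-1)) (susp 𝒢).toLinearMap :=
  isCoalgHom_regrade _ _

theorem susp_desusp (a : GSym (shift 𝒢 (-1))) : susp 𝒢 (desusp 𝒢 a) = a := by
  suffices (susp 𝒢).comp (desusp 𝒢) = AlgHom.id k _ from AlgHom.congr_fun this a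
  refine hom_ext fun x => ?_
  simp [susp, desusp, regrade_ι]

theorem desusp_susp (a : GSym (shift 𝒢 1)) : desusp 𝒢 (susp 𝒢 a) = a := by
  suffices (desusp 𝒢).comp (susp 𝒢) = AlgHom.id k _ from AlgHom.congr_fun this a
  refine hom_ext fun x => ?_
  simp [susp, desusp, regrade_ι]

/-- The suspension of a word. -/
def suspWord (l : List (ℤ × G)) : List (ℤ × G) := l.map fun t => (t.1 + 2 * 1, t.2)

/-- The desuspension of a word. -/
def desuspWord (l : List (ℤ × G)) : List (ℤ × G) := l.map fun t => (t.1 + 2 * (-1), t.2)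

theorem susp_wprod (l : List (ℤ × G)) :
    susp 𝒢 (wprod (shift 𝒢 1) l) = wprod (shift 𝒢 (-1)) (suspWord l) := regrade_wprod _ _ l

theorem isWord_suspWord {l : List (ℤ × G)} (hl : IsWord (shift 𝒢 1) l) :
    IsWord (shift 𝒢 (-1)) (suspWord l) :=
  isWord_regrade (𝒰 := shift 𝒢 1) (𝒰' := shift 𝒢 (-1)) 1
    (fun p => le_of_eq (congrArg 𝒢 (by ring))) hl

theorem desusp_wprod (l : List (ℤ × G)) :
    desusp 𝒢 (wprod (shift 𝒢 (-1)) l) = wprod (shift 𝒢 1) (desuspWord l) := regrade_wprod _ _ l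

theorem isWord_desuspWord {l : List (ℤ × G)} (hl : IsWord (shift 𝒢 (-1)) l) :
    IsWord (shift 𝒢 1) (desuspWord l) :=
  isWord_regrade (𝒰 := shift 𝒢 (-1)) (𝒰' := shift 𝒢 1) (-1)
    (fun p => le_of_eq (congrArg 𝒢 (by ring))) hl

theorem length_suspWord (l : List (ℤ × G)) : (suspWord l).length = l.length := by
  simp [suspWord]

theorem length_desuspWord (l : List (ℤ × G)) : (desuspWord l).length = l.length := by
  simp [desuspWord]

theorem sum_suspWord (l : List (ℤ × G)) :
    ((suspWord l).map Prod.fst).sum = (l.map Prod.fst).sum + 2 * l.length := by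
  rw [suspWord, sum_map_regrade]; ring

theorem sum_desuspWord (l : List (ℤ × G)) :
    ((desuspWord l).map Prod.fst).sum = (l.map Prod.fst).sum - 2 * l.length := by
  rw [desuspWord, sum_map_regrade]; ring

theorem wprod_eq_susp (l : List (ℤ × G)) :
    wprod (shift 𝒢 (-1)) l = susp 𝒢 (wprod (shift 𝒢 1) (desuspWord l)) := by
  rw [← desusp_wprod, susp_desusp]

/-- The transform of `f : S(𝔤[-1]) → V[[ħ]]` is the map `S(𝔤[1]) → V((ħ))` equal to `ħ^{-m} f` on
`Sᵐ`. -/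
def theta (f : GSym (shift 𝒢 (-1)) →ₗ[k] HSeries 𝒱) : GSym (shift 𝒢 1) →ₗ[k] LaurentSeries V :=
  scale (shift 𝒢 1) (-1) ((inc 𝒱).toLinearMap ∘ₗ f ∘ₗ (susp 𝒢).toLinearMap)

theorem theta_wprod (f : GSym (shift 𝒢 (-1)) →ₗ[k] HSeries 𝒱) (l : List (ℤ × G)) :
    theta f (wprod (shift 𝒢 1) l) =
      hb V (-(l.length : ℤ)) * inc 𝒱 (f (susp 𝒢 (wprod (shift 𝒢 1) l))) := by
  rw [theta, scale_wprod, neg_one_mul]; rfl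

theorem inc_eq_theta (f : GSym (shift 𝒢 (-1)) →ₗ[k] HSeries 𝒱) (l : List (ℤ × G)) :
    inc 𝒱 (f (susp 𝒢 (wprod (shift 𝒢 1) l))) =
      hb V l.length * theta f (wprod (shift 𝒢 1) l) := by
  rw [theta_wprod, hb_mul_neg_cancel]

theorem theta_one (f : GSym (shift 𝒢 (-1)) →ₗ[k] HSeries 𝒱) : theta f 1 = inc 𝒱 (f 1) := by
  rw [theta, scale_one]; simp

theorem theta_isHomog {f : GSym (shift 𝒢 (-1)) →ₗ[k] HSeries 𝒱} {d : ℤ}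
    (hf : IsHomog (grading (shift 𝒢 (-1))) (hGrading 𝒱) d f) :
    IsHomog (grading (shift 𝒢 1)) (lGrading 𝒱) d (theta f) := by
  refine isHomog_of_words _ _ fun l hl => ?_
  rw [theta_wprod, susp_wprod]
  have := hb_mul_mem (inc_mem (hf.word (isWord_suspWord hl))) (-(l.length : ℤ))
  rw [sum_suspWord] at this
  convert this using 2
  ring

theorem theta_convExp {f : GSym (shift 𝒢 (-1)) →ₗ[k] HSeries 𝒱} (hf : f 1 = 0) :
    theta (convExp (shift 𝒢 (-1)) f) = convExp (shift 𝒢 1) (theta f) := by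
  rw [theta, convExp_comp_coalgHom isCoalgHom_susp hf, algHom_convExp, scale_convExp]; rfl

/-- The inclusion `S(𝔤[-1]) → S(𝔤[-1])[[ħ]]` of the constants has as its transform the map
`w ↦ ħ^{-m} w`; every transform is obtained from it by extension to Laurent series. -/
theorem lext_theta (f : GSym (shift 𝒢 (-1)) →ₗ[k] HSeries 𝒱) (a : GSym (shift 𝒢 1)) :
    lext f (theta (hmonomial (grading (shift 𝒢 (-1))) 0) a) = theta f a := by
  suffices lext f ∘ₗ theta (hmonomial (grading (shift 𝒢 (-1))) 0) = theta f from
    LinearMap.congr_fun this a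
  refine ext_words _ fun l hl => ?_
  rw [LinearMap.comp_apply, theta_wprod, theta_wprod, lext_hb_mul, lext_hmonomial]

theorem lext_theta_hext {T : V →ₗ[k] HSeries 𝒲} {d : ℤ} (hT : IsHomog 𝒱 (hGrading 𝒲) d T)
    (f : GSym (shift 𝒢 (-1)) →ₗ[k] HSeries 𝒱) (a : GSym (shift 𝒢 1)) :
    lext T (theta f a) = theta (hext hT ∘ₗ f) a := by
  suffices lext T ∘ₗ theta f = theta (hext hT ∘ₗ f) from LinearMap.congr_fun this a
  refine ext_words _ fun l hl => ?_
  rw [LinearMap.comp_apply, theta_wprod, theta_wprod, lext_hb_mul, lext_inc hT]; rfl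

/-- The equation `exp(φ) Δ' = Δ exp(φ)` in terms of transforms, for an operator `Δ'` on `S(𝔤[-1])`
that corresponds to an operator `D` on `S(𝔤[1])`. -/
theorem comm_iff_theta {D : GSym (shift 𝒢 1) →ₗ[k] GSym (shift 𝒢 1)}
    {Δ' : GSym (shift 𝒢 (-1)) →ₗ[k] HSeries (grading (shift 𝒢 (-1)))}
    (hD : ∀ a, theta Δ' a = theta (hmonomial (grading (shift 𝒢 (-1))) 0) (D a))
    (Δ : V →ₗ[k] HSeries 𝒱) (E : GSym (shift 𝒢 (-1)) →ₗ[k] HSeries 𝒱) :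
    (∀ x, hextend E (Δ' x : PowerSeries (GSym (shift 𝒢 (-1)))) =
      hextend Δ (E x : PowerSeries V)) ↔ theta E ∘ₗ D = lext Δ ∘ₗ theta E := by
  have h1 : ∀ l, ps k (hextend E (Δ' (susp 𝒢 (wprod (shift 𝒢 1) l)) :
      PowerSeries (GSym (shift 𝒢 (-1))))) =
      hb V l.length * theta E (D (wprod (shift 𝒢 1) l)) := by
    intro l
    rw [← lext_ps, ← inc_apply, inc_eq_theta, lext_hb_mul, hD, lext_theta]
  have h2 : ∀ l, ps k (hextend Δ (E (susp 𝒢 (wprod (shift 𝒢 1) l)) : PowerSeries V)) =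
      hb V l.length * lext Δ (theta E (wprod (shift 𝒢 1) l)) := by
    intro l
    rw [← lext_ps, ← inc_apply, inc_eq_theta, lext_hb_mul]
  constructor
  · intro h
    refine ext_words _ fun l hl => ?_
    have := congrArg (ps k) (h (susp 𝒢 (wprod (shift 𝒢 1) l)))
    rw [h1, h2] at this
    exact hb_mul_injective _ this
  · intro h
    have key : (ps k).toLinearMap ∘ₗ hextend E ∘ₗ (HSeries _).val.toLinearMap ∘ₗ Δ' =
        (ps k).toLinearMap ∘ₗ hextend Δ ∘ₗ (HSeries _).val.toLinearMap ∘ₗ E := by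
      refine ext_words _ fun l hl => ?_
      rw [wprod_eq_susp]
      refine (h1 (desuspWord l)).trans (Eq.trans ?_ (h2 (desuspWord l)).symm)
      congr 1
      exact LinearMap.congr_fun h _
    intro x
    exact ps_injective (LinearMap.congr_fun key x)

end Theta

/-! ### The correspondence between the maps `φ` and the coalgebra morphisms `F` -/

section Adjunction

open GSym

variable {k G V : Type*} [Field k] [AddCommGroup G] [Module k G] [Ring V] [Algebra k V]
  {𝒢 : ℤ → Submodule k G} [Decomposition 𝒢]
  {𝒱 : ℤ → Submodule k V} [GradedAlgebra 𝒱] [GrComm 𝒱]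

variable (𝒱) in
/-- The algebra homomorphism `S(V[[ħ]][2]) → V((ħ))`, `a₁ ⋯ a_m ↦ ħ^{-m} a₁ ⋯ a_m`. -/
def muh : GSym (shift (hShift 𝒱) 1) →ₐ[k] LaurentSeries V :=
  lift (shift (hShift 𝒱) 1) (LinearMap.mulLeft k (hb V (-1)) ∘ₗ (inc 𝒱).toLinearMap) (by
    have h : ∀ (p : ℤ) (x : HSeries 𝒱), x ∈ shift (hShift 𝒱) 1 p →
        (LinearMap.mulLeft k (hb V (-1)) ∘ₗ (inc 𝒱).toLinearMap) x ∈ lGrading 𝒱 p := by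
      intro p x hx
      have := hb_mul_mem (inc_mem (show x ∈ hGrading 𝒱 (1 + (1 + p)) from hx)) (-1)
      have e : 1 + (1 + p) + 2 * (-1) = p := by ring
      rw [e] at this
      exact this
    intro p q x y hx hy
    exact GrComm.comm _ _ _ _ (h p x hx) (h q y hy))

theorem muh_ι (a : HSeries 𝒱) : muh 𝒱 (ι _ a) = hb V (-1) * inc 𝒱 a := by
  rw [muh, lift_ι]; rfl

theorem hMultiplication_ι (a : HSeries 𝒱) : hMultiplication 𝒱 (ι _ a) = a := by
  rw [hMultiplication, AlgHom.comp_apply, regrade_ι, lift_ι]; rfl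

theorem theta_hMultiplication :
    theta (𝒢 := hShift 𝒱) (hMultiplication 𝒱).toLinearMap = (muh 𝒱).toLinearMap := by
  refine ext_words _ fun l hl => ?_
  rw [theta_wprod]
  induction l with
  | nil => simp [hb_zero]
  | cons t l ih =>
    have ih := ih (isWord_cons.1 hl).2
    rw [AlgHom.toLinearMap_apply, AlgHom.toLinearMap_apply] at ih ⊢
    rw [wprod_cons, map_mul, map_mul, map_mul, map_mul, muh_ι, ← ih]
    have e : susp (hShift 𝒱) (ι (shift (hShift 𝒱) 1) t.2) = ι (shift (hShift 𝒱) (-1)) t.2 :=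
      regrade_ι _ _ _
    rw [e, hMultiplication_ι, mul_assoc, ← mul_assoc (inc 𝒱 t.2), ← hb_comm, mul_assoc,
      hb_mul_hb_mul, List.length_cons]
    congr 2
    push_cast; ring

theorem adjComponents_wprod (φ : GSym (shift 𝒢 (-1)) →ₗ[k] HSeries 𝒱) (l : List (ℤ × G)) :
    adjComponents 𝒢 φ (wprod (shift 𝒢 1) l) =
      hdiv 𝒱 (l.length - 1) (φ (susp 𝒢 (wprod (shift 𝒢 1) l))) := by
  rw [adjComponents, weightwise_wprod]; rfl

theorem adjComponents_one {φ : GSym (shift 𝒢 (-1)) →ₗ[k] HSeries 𝒱} (hφ : φ 1 = 0) :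
    adjComponents 𝒢 φ 1 = 0 := by
  have := adjComponents_wprod φ []
  rw [wprod_nil, map_one (susp 𝒢), hφ, map_zero] at this
  exact this

theorem adjComponents_isHomog {φ : GSym (shift 𝒢 (-1)) →ₗ[k] HSeries 𝒱}
    (hφ : IsHomog (grading (shift 𝒢 (-1))) (hGrading 𝒱) 0 φ) (hφ1 : φ 1 = 0) :
    IsHomog (grading (shift 𝒢 1)) (grading (shift (hShift 𝒱) 1)) 0
      (ι (shift (hShift 𝒱) 1) ∘ₗ adjComponents 𝒢 φ) := by
  refine isHomog_of_words _ _ fun l hl => ?_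
  refine ι_mem_grading _ ?_
  cases l with
  | nil => rw [wprod_nil, adjComponents_one hφ1]; exact zero_mem _
  | cons t l =>
    rw [adjComponents_wprod, susp_wprod]
    have := hdiv_mem (hφ.word (isWord_suspWord hl)) ((t :: l).length - 1)
    rw [sum_suspWord] at this
    change _ ∈ hGrading 𝒱 (1 + (1 + _))
    convert this using 2
    rw [List.length_cons]
    push_cast [Nat.add_sub_cancel]
    ring

/-- `φ = ħ⁻¹ ∑ ħⁿ φₙ` where `φₙ` vanishes on `S^{>n}`. -/
def HasOrder {U : Type*} [AddCommGroup U] [Module k U] (𝒰 : ℤ → Submodule k U)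
    (φ : GSym 𝒰 →ₗ[k] HSeries 𝒱) : Prop :=
  ∀ n m : ℕ, 1 ≤ n → n < m → ∀ x ∈ symPow 𝒰 m, hcoeff 𝒱 (n - 1) (φ x) = 0

theorem HasOrder.hcoeff_eq_zero {U : Type*} [AddCommGroup U] [Module k U]
    {𝒰 : ℤ → Submodule k U} {φ : GSym 𝒰 →ₗ[k] HSeries 𝒱} (hφ : HasOrder 𝒰 φ) {m n : ℕ}
    {x : GSym 𝒰} (hx : x ∈ symPow 𝒰 m) (hn : n < m - 1) : hcoeff 𝒱 n (φ x) = 0 :=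
  hφ (n + 1) m (by omega) (by omega) x hx

theorem hasOrder_of_words {U : Type*} [AddCommGroup U] [Module k U]
    {𝒰 : ℤ → Submodule k U} [Decomposition 𝒰] {φ : GSym 𝒰 →ₗ[k] HSeries 𝒱}
    (h : ∀ l, IsWord 𝒰 l → ∀ n < l.length - 1, hcoeff 𝒱 n (φ (wprod 𝒰 l)) = 0) :
    HasOrder 𝒰 φ := by
  intro n m hn hm x hx
  exact symPow_ext 𝒰 (f := hcoeff 𝒱 (n - 1) ∘ₗ φ) (g := 0)
    (fun l hl hlm => h l hl (n - 1) (by omega)) hx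

theorem theta_eq_adjComponents {φ : GSym (shift 𝒢 (-1)) →ₗ[k] HSeries 𝒱} (hφ1 : φ 1 = 0)
    (hφ : HasOrder (shift 𝒢 (-1)) φ) :
    theta φ = (muh 𝒱).toLinearMap ∘ₗ ι (shift (hShift 𝒱) 1) ∘ₗ adjComponents 𝒢 φ := by
  refine ext_words _ fun l hl => ?_
  rw [LinearMap.comp_apply, LinearMap.comp_apply, AlgHom.toLinearMap_apply, muh_ι, theta_wprod]
  cases l with
  | nil => rw [wprod_nil, map_one (susp 𝒢), hφ1, adjComponents_one hφ1]; simp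
  | cons t l =>
    rw [adjComponents_wprod]
    have hm : susp 𝒢 (wprod (shift 𝒢 1) (t :: l)) ∈
        symPow (shift 𝒢 (-1)) (t :: l).length := by
      rw [susp_wprod, ← length_suspWord]
      exact wprod_mem_symPow _ _
    rw [← hb_mul_inc_hdiv ((t :: l).length - 1) (φ (susp 𝒢 (wprod (shift 𝒢 1) (t :: l))))
      fun n hn => hφ.hcoeff_eq_zero hm hn, hb_mul_hb_mul]
    congr 2
    rw [List.length_cons]
    push_cast [Nat.add_sub_cancel]
    ring

/-- `θ(exp φ) = μ_ħ F` for the coalgebra morphism `F` with the components `ħ^{1-m} φ`. -/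
theorem theta_convExp_eq_muh_adj {φ : GSym (shift 𝒢 (-1)) →ₗ[k] HSeries 𝒱} (hφ1 : φ 1 = 0)
    (hφ : HasOrder (shift 𝒢 (-1)) φ) :
    theta (convExp (shift 𝒢 (-1)) φ) = (muh 𝒱).toLinearMap ∘ₗ adj 𝒢 φ := by
  rw [theta_convExp hφ1, theta_eq_adjComponents hφ1 hφ, adj, algHom_convExp]

variable [CharZero k]

theorem isCoalgHom_adj {φ : GSym (shift 𝒢 (-1)) →ₗ[k] HSeries 𝒱}
    (hφ : IsHomog (grading (shift 𝒢 (-1))) (hGrading 𝒱) 0 φ) (hφ1 : φ 1 = 0) :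
    IsCoalgHom (shift 𝒢 1) (shift (hShift 𝒱) 1) (adj 𝒢 φ) :=
  isCoalgHom_convExp (adjComponents_isHomog hφ hφ1) (adjComponents_one hφ1)

theorem adj_isHomog {φ : GSym (shift 𝒢 (-1)) →ₗ[k] HSeries 𝒱}
    (hφ : IsHomog (grading (shift 𝒢 (-1))) (hGrading 𝒱) 0 φ) (hφ1 : φ 1 = 0) :
    IsHomog (grading (shift 𝒢 1)) (grading (shift (hShift 𝒱) 1)) 0 (adj 𝒢 φ) :=
  convExp_isHomog _ _ (adjComponents_isHomog hφ hφ1)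

theorem toCogen_adj {φ : GSym (shift 𝒢 (-1)) →ₗ[k] HSeries 𝒱}
    (hφ : IsHomog (grading (shift 𝒢 (-1))) (hGrading 𝒱) 0 φ) (hφ1 : φ 1 = 0) :
    toCogen (shift (hShift 𝒱) 1) ∘ₗ adj 𝒢 φ = adjComponents 𝒢 φ :=
  toCogen_convExp (adjComponents_isHomog hφ hφ1) (adjComponents_one hφ1)

theorem corresponds_adj {φ : GSym (shift 𝒢 (-1)) →ₗ[k] HSeries 𝒱}
    (hφ : IsHomog (grading (shift 𝒢 (-1))) (hGrading 𝒱) 0 φ) (hφ1 : φ 1 = 0)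
    (ho : HasOrder (shift 𝒢 (-1)) φ) : Corresponds 𝒢 φ (adj 𝒢 φ) := by
  intro m hm x hx
  have h1 : toCogen (shift (hShift 𝒱) 1) (adj 𝒢 φ x) = hdiv 𝒱 (m - 1) (φ (susp 𝒢 x)) := by
    refine (LinearMap.congr_fun (toCogen_adj hφ hφ1) x).trans ?_
    refine symPow_ext (shift 𝒢 1) (f := adjComponents 𝒢 φ)
      (g := hdiv 𝒱 (m - 1) ∘ₗ φ ∘ₗ (susp 𝒢).toLinearMap) (fun l _ hlm => ?_) hx
    rw [adjComponents_wprod, hlm]; rfl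
  rw [h1, X_pow_mul_hdiv]
  intro n hn
  refine symPow_ext (shift 𝒢 1) (f := hcoeff 𝒱 n ∘ₗ φ ∘ₗ (susp 𝒢).toLinearMap) (g := 0)
    (fun l hl hlm => ?_) hx
  refine ho.hcoeff_eq_zero (m := m) ?_ hn
  rw [AlgHom.toLinearMap_apply, susp_wprod, ← hlm, ← length_suspWord]
  exact wprod_mem_symPow _ _

/-- If `θ(exp χ) = μ_ħ F` for a coalgebra morphism `F`, then `χ = ħ^{m-1} f` on `Sᵐ`, where `f` is
the projection of `F` to the cogenerators. -/
theorem hasOrder_and_adj_eq {χ : GSym (shift 𝒢 (-1)) →ₗ[k] HSeries 𝒱}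
    (hχ : IsHomog (grading (shift 𝒢 (-1))) (hGrading 𝒱) 0 χ) (hχ1 : χ 1 = 0)
    {F : GSym (shift 𝒢 1) →ₗ[k] GSym (shift (hShift 𝒱) 1)}
    (hF : IsCoalgHom (shift 𝒢 1) (shift (hShift 𝒱) 1) F)
    (hF0 : IsHomog (grading (shift 𝒢 1)) (grading (shift (hShift 𝒱) 1)) 0 F)
    (h : theta (convExp (shift 𝒢 (-1)) χ) = (muh 𝒱).toLinearMap ∘ₗ F) :
    HasOrder (shift 𝒢 (-1)) χ ∧ adj 𝒢 χ = F := by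
  have hE := eq_convExp_of_isCoalgHom hF
  have hf : ∀ a, muh 𝒱 (ι (shift (hShift 𝒱) 1) (toCogen (shift (hShift 𝒱) 1) (F a))) =
      hb V (-1) * inc 𝒱 (toCogen (shift (hShift 𝒱) 1) (F a)) := fun a => muh_ι _
  have key : theta χ = (muh 𝒱).toLinearMap ∘ₗ (ι (shift (hShift 𝒱) 1) ∘ₗ
      toCogen (shift (hShift 𝒱) 1) ∘ₗ F) := by
    refine convExp_injective (shift 𝒢 1) (lGrading 𝒱) (theta_isHomog hχ)
      (by rw [theta_one, hχ1, map_zero]) ?_ (by simp [hF.one, toCogen_one]) ?_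
    · intro p a ha
      have h1 := toCogen_mem (hF0 p a ha)
      have h2 := hb_mul_mem (inc_mem (show _ ∈ hGrading 𝒱 (1 + (1 + (p + 0))) from h1)) (-1)
      rw [LinearMap.comp_apply, AlgHom.toLinearMap_apply, LinearMap.comp_apply,
        LinearMap.comp_apply, hf]
      convert h2 using 2
      ring
    · rw [← theta_convExp hχ1, h, ← algHom_convExp, ← hE]
  have hval : ∀ l, 1 ≤ l.length → χ (susp 𝒢 (wprod (shift 𝒢 1) l)) =
      (PowerSeries.X : PowerSeries V) ^ (l.length - 1) *
        ((toCogen (shift (hShift 𝒱) 1) (F (wprod (shift 𝒢 1) l)) : HSeries 𝒱) :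
          PowerSeries V) := by
    intro l hl
    refine ps_injective (k := k) ?_
    rw [ps_X_pow_mul, ← inc_apply, ← inc_apply, inc_eq_theta, key, LinearMap.comp_apply,
      AlgHom.toLinearMap_apply, LinearMap.comp_apply, LinearMap.comp_apply, hf, hb_mul_hb_mul]
    congr 2
    push_cast [hl]
    ring
  refine ⟨hasOrder_of_words fun l hl n hn => ?_, ?_⟩
  · rw [wprod_eq_susp]
    refine (congrArg (PowerSeries.coeff n)
      (hval (desuspWord l) (by rw [length_desuspWord]; omega))).trans ?_
    rw [PowerSeries.coeff_X_pow_mul',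
      length_desuspWord, if_neg (by omega)]
  · rw [hE, adj]
    congr 2
    refine ext_words _ fun l hl => ?_
    cases l with
    | nil => simp [adjComponents_one hχ1, hF.one, toCogen_one]
    | cons t l =>
      rw [adjComponents_wprod]
      refine Subtype.ext (PowerSeries.ext fun n => ?_)
      rw [hdiv_coe, hval _ (by simp), PowerSeries.coeff_X_pow_mul', if_pos (by omega),
        Nat.add_sub_cancel]
      rfl

end Adjunction

/-! ### Differential operators -/

section DiffOp

variable {k A : Type*} [Field k] [Ring A] [Algebra k A] (𝒜 : ℤ → Submodule k A)

/-- The operators `T` with `[[…[T, L_{a₁}], …], L_{aₙ}] = 0` for all `a₁, …, aₙ`, that is, the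
differential operators of order `≤ n - 1`. -/
def diffOp [Decomposition 𝒜] : ℕ → Submodule k (Module.End k A)
  | 0 => ⊥
  | n + 1 => ⨅ a : A, (diffOp n).comap (commL 𝒜 a)

theorem mem_diffOp_succ [Decomposition 𝒜] {n : ℕ} {T : Module.End k A} :
    T ∈ diffOp 𝒜 (n + 1) ↔ ∀ a, commL 𝒜 a T ∈ diffOp 𝒜 n := by
  simp [diffOp]

theorem mem_diffOp_iff [Decomposition 𝒜] {n : ℕ} {T : Module.End k A} :
    T ∈ diffOp 𝒜 n ↔ ∀ l : List A, l.length = n → iterComm 𝒜 T l = 0 := by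
  induction n generalizing T with
  | zero =>
    refine ⟨fun h l hl => ?_, fun h => h [] rfl⟩
    rw [List.length_eq_zero_iff.1 hl]
    exact h
  | succ n ih =>
    rw [mem_diffOp_succ]
    constructor
    · intro h l hl
      cases l with
      | nil => simp at hl
      | cons a l => exact ih.1 (h a) l (by simpa using hl)
    · intro h a
      exact ih.2 fun l hl => h (a :: l) (by simpa using hl)

theorem diffOp_le_succ [Decomposition 𝒜] (n : ℕ) : diffOp 𝒜 n ≤ diffOp 𝒜 (n + 1) := by
  induction n with
  | zero =>
    intro T hT
    rw [(Submodule.mem_bot k).1 hT]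
    exact zero_mem _
  | succ n ih =>
    intro T hT
    rw [mem_diffOp_succ] at hT ⊢
    exact fun a => ih (hT a)

theorem diffOp_mono [Decomposition 𝒜] : Monotone (diffOp 𝒜) :=
  monotone_nat_of_le_succ (diffOp_le_succ 𝒜)

variable [CharZero k] [GradedAlgebra 𝒜]

theorem even_odd_ext {M : Type*} [AddCommGroup M] [Module k M] {f g : A →ₗ[k] M}
    (he : ∀ q, Even q → ∀ a ∈ 𝒜 q, f a = g a) (ho : ∀ q, Odd q → ∀ a ∈ 𝒜 q, f a = g a) :
    f = g :=
  linearMap_ext_homog 𝒜 fun q a ha => (Int.even_or_odd q).elim (fun h => he q h a ha)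
    fun h => ho q h a ha

theorem mul_eq_parity_mul [GrComm 𝒜] {q : ℤ} (hq : Odd q) {a : A} (ha : a ∈ 𝒜 q) (b : A) :
    b * a = a * parity 𝒜 b := by
  suffices (LinearMap.mulRight k a) = LinearMap.mulLeft k a ∘ₗ parity 𝒜 from
    LinearMap.congr_fun this b
  refine linearMap_ext_homog 𝒜 fun p b hb => ?_
  rw [LinearMap.mulRight_apply, LinearMap.comp_apply, LinearMap.mulLeft_apply,
    parity_of_mem 𝒜 hb, GrComm.comm p q b a hb ha, mul_smul_comm]
  congr 1
  rw [mul_comm, zpow_mul, hq.neg_one_zpow]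

theorem mul_comm_of_even [GrComm 𝒜] {q : ℤ} (hq : Even q) {a : A} (ha : a ∈ 𝒜 q) (b : A) :
    b * a = a * b := by
  suffices (LinearMap.mulRight k a) = LinearMap.mulLeft k a from
    LinearMap.congr_fun this b
  refine linearMap_ext_homog 𝒜 fun p b hb => ?_
  rw [LinearMap.mulRight_apply, LinearMap.mulLeft_apply, GrComm.comm p q b a hb ha,
    (hq.mul_left p).neg_one_zpow, one_smul]

theorem commL_mulLeft_mul [GrComm 𝒜] (b : A) (T : Module.End k A) (a : A) :
    commL 𝒜 a (LinearMap.mulLeft k b * T) = LinearMap.mulLeft k b * commL 𝒜 a T := by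
  suffices (commL 𝒜).flip (LinearMap.mulLeft k b * T) =
      LinearMap.mulLeft k (LinearMap.mulLeft k b) ∘ₗ (commL 𝒜).flip T from
    LinearMap.congr_fun this a
  refine even_odd_ext 𝒜 (fun q hq a ha => ?_) (fun q hq a ha => ?_)
  · refine LinearMap.ext fun x => ?_
    simp only [LinearMap.flip_apply, LinearMap.comp_apply, LinearMap.mulLeft_apply,
      commL_even 𝒜 ha hq, Module.End.mul_apply, mul_sub, ← mul_assoc, mul_comm_of_even 𝒜 hq ha b]
  · refine LinearMap.ext fun x => ?_
    simp only [LinearMap.flip_apply, LinearMap.comp_apply, LinearMap.mulLeft_apply,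
      commL_odd 𝒜 ha hq, Module.End.mul_apply, mul_sub, ← mul_assoc, parity_mul,
      mul_eq_parity_mul 𝒜 hq ha b]

theorem commL_mul_mulLeft_even [GrComm 𝒜] (b : A) (T : Module.End k A) {q : ℤ} (hq : Even q)
    {a : A} (ha : a ∈ 𝒜 q) :
    commL 𝒜 a (T * LinearMap.mulLeft k b) = commL 𝒜 a T * LinearMap.mulLeft k b := by
  refine LinearMap.ext fun x => ?_
  simp only [LinearMap.mulLeft_apply, commL_even 𝒜 ha hq, Module.End.mul_apply, ← mul_assoc,
    mul_comm_of_even 𝒜 hq ha b]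

theorem commL_mul_mulLeft_odd [GrComm 𝒜] (b : A) (T : Module.End k A) {q : ℤ} (hq : Odd q)
    {a : A} (ha : a ∈ 𝒜 q) :
    commL 𝒜 a (T * LinearMap.mulLeft k b) =
      commL 𝒜 a T * LinearMap.mulLeft k (parity 𝒜 b) := by
  refine LinearMap.ext fun x => ?_
  simp only [LinearMap.mulLeft_apply, commL_odd 𝒜 ha hq, Module.End.mul_apply, ← mul_assoc,
    mul_eq_parity_mul 𝒜 hq ha b, parity_mul, parity_parity]

theorem mem_diffOp_succ_of_homog {n : ℕ} {T : Module.End k A}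
    (h : ∀ q, ∀ a ∈ 𝒜 q, commL 𝒜 a T ∈ diffOp 𝒜 n) : T ∈ diffOp 𝒜 (n + 1) := by
  rw [mem_diffOp_succ]
  intro a
  induction a using Decomposition.inductionOn 𝒜 with
  | zero => rw [map_zero]; exact zero_mem _
  | @homogeneous p m => exact h p m m.2
  | add x y hx hy => rw [map_add]; exact add_mem hx hy

theorem mulLeft_mul_mem_diffOp [GrComm 𝒜] {n : ℕ} {T : Module.End k A} (hT : T ∈ diffOp 𝒜 n)
    (b : A) : LinearMap.mulLeft k b * T ∈ diffOp 𝒜 n := by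
  induction n generalizing T with
  | zero =>
    rw [(Submodule.mem_bot k).1 hT, mul_zero]
    exact zero_mem _
  | succ n ih =>
    rw [mem_diffOp_succ] at hT ⊢
    intro a
    rw [commL_mulLeft_mul]
    exact ih (hT a)

theorem mul_mulLeft_mem_diffOp [GrComm 𝒜] {n : ℕ} {T : Module.End k A} (hT : T ∈ diffOp 𝒜 n)
    (b : A) : T * LinearMap.mulLeft k b ∈ diffOp 𝒜 n := by
  induction n generalizing T b with
  | zero =>
    rw [(Submodule.mem_bot k).1 hT, zero_mul]
    exact zero_mem _
  | succ n ih =>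
    rw [mem_diffOp_succ] at hT
    refine mem_diffOp_succ_of_homog 𝒜 fun q a ha => ?_
    rcases Int.even_or_odd q with hq | hq
    · rw [commL_mul_mulLeft_even 𝒜 b T hq ha]
      exact ih (hT a) _
    · rw [commL_mul_mulLeft_odd 𝒜 b T hq ha]
      exact ih (hT a) _

/-- The Leibniz rule `[T, L_{ab}] = [T, L_a] L_b + (-1)^{|T||a|} L_a [T, L_b]`. -/
theorem commL_mul {T : Module.End k A} {d p q : ℤ} (hT : IsHomog 𝒜 𝒜 d T) {a b : A}
    (ha : a ∈ 𝒜 p) (hb : b ∈ 𝒜 q) :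
    commL 𝒜 (a * b) T = commL 𝒜 a T * LinearMap.mulLeft k b +
      ((-1 : k) ^ (d * p)) • (LinearMap.mulLeft k a * commL 𝒜 b T) := by
  refine LinearMap.ext fun x => ?_
  simp only [LinearMap.add_apply, LinearMap.smul_apply, Module.End.mul_apply,
    LinearMap.mulLeft_apply]
  rw [commL_apply_of_homog 𝒜 hT (SetLike.GradedMul.mul_mem ha hb), commL_apply_of_homog 𝒜 hT ha,
    commL_apply_of_homog 𝒜 hT hb, mul_assoc, mul_sub, smul_sub, mul_smul_comm, smul_smul,
    ← zpow_add₀ (by simp), mul_add, mul_assoc]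
  abel

theorem commL_one {T : Module.End k A} {d : ℤ} (hT : IsHomog 𝒜 𝒜 d T) : commL 𝒜 1 T = 0 := by
  refine LinearMap.ext fun x => ?_
  rw [commL_apply_of_homog 𝒜 hT SetLike.GradedOne.one_mem]
  simp

end DiffOp

/-! ### The differential operators `Dₙ` -/

section Coderivations

open GSym

variable {k U : Type*} [Field k] [AddCommGroup U] [Module k U]
  {𝒰 : ℤ → Submodule k U} [Decomposition 𝒰]

namespace GSym

theorem conv_koszul_mulLeft {B : Type*} [Ring B] [Algebra k B] {ℬ : ℤ → Submodule k B} [GrComm ℬ]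
    {f : GSym 𝒰 →ₗ[k] B} {e p : ℤ} (hf : IsHomog (grading 𝒰) ℬ e f) {b : B} (hb : b ∈ ℬ p)
    (g : GSym 𝒰 →ₗ[k] B) :
    conv 𝒰 (f ∘ₗ koszul (grading 𝒰) p) (LinearMap.mulLeft k b ∘ₗ g) =
      ((-1 : k) ^ (e * p)) • (LinearMap.mulLeft k b ∘ₗ conv 𝒰 f g) := by
  suffices LinearMap.mul' k B ∘ₗ TensorProduct.map (f ∘ₗ koszul (grading 𝒰) p)
      (LinearMap.mulLeft k b ∘ₗ g) =
      ((-1 : k) ^ (e * p)) • (LinearMap.mulLeft k b ∘ₗ LinearMap.mul' k B ∘ₗ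
        TensorProduct.map f g) by
    rw [conv, ← LinearMap.comp_assoc, this]; rfl
  refine TensorProduct.ext (linearMap_ext_homog (grading 𝒰) fun q u hu =>
    LinearMap.ext fun v => ?_)
  simp only [LinearMap.comp_apply, LinearMap.smul_apply,
    TensorProduct.map_tmul, LinearMap.mul'_apply, LinearMap.mulLeft_apply, TensorProduct.mk_apply,
    LinearMap.compr₂ₛₗ_apply]
  rw [koszul_of_mem _ _ hu, map_smul, smul_mul_assoc, ← mul_assoc, ← mul_assoc,
    GrComm.comm _ _ _ _ (hf q u hu) hb, smul_mul_assoc, smul_smul, ← zpow_add₀ (by simp)]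
  congr 1
  have : p * q + (q + e) * p = e * p + 2 * (p * q) := by ring
  rw [this, zpow_add₀ (by simp), zpow_mul (-1 : k) 2]
  simp

end GSym

variable [CharZero k]

theorem commL_conv_id {d : GSym 𝒰 →ₗ[k] U} {e p : ℤ}
    (hd : IsHomog (grading 𝒰) (grading 𝒰) e (ι 𝒰 ∘ₗ d)) {x : U} (hx : x ∈ 𝒰 p) :
    commL (grading 𝒰) (ι 𝒰 x) (conv 𝒰 (ι 𝒰 ∘ₗ d) LinearMap.id) =
      conv 𝒰 (ι 𝒰 ∘ₗ d ∘ₗ mulι 𝒰 x) LinearMap.id := by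
  have hT : IsHomog (grading 𝒰) (grading 𝒰) e (conv 𝒰 (ι 𝒰 ∘ₗ d) LinearMap.id) :=
    (conv_isHomog_add 𝒰 (grading 𝒰) hd isHomog_id).of_eq (add_zero e)
  refine LinearMap.ext fun a => ?_
  rw [commL_apply_of_homog _ hT (ι_mem_grading 𝒰 hx), sub_eq_iff_eq_add]
  have h1 := LinearMap.congr_fun (conv_mulι 𝒰 hx (ι 𝒰 ∘ₗ d) LinearMap.id) a
  have h2 := LinearMap.congr_fun
    (conv_koszul_mulLeft hd (ι_mem_grading 𝒰 hx) (LinearMap.id : GSym 𝒰 →ₗ[k] GSym 𝒰)) a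
  rw [LinearMap.add_apply] at h1
  exact h1.trans (congrArg _ h2)

/-- A coderivation of `S(U)` whose components vanish on `S^{≥ n}` is a differential operator of
order `≤ n - 1`: the commutator with the multiplication by `x ∈ U` is again a coderivation, with
the components `d(x ·)`. -/
theorem conv_id_mem_diffOp {d : GSym 𝒰 →ₗ[k] U} {e : ℤ}
    (hd : IsHomog (grading 𝒰) (grading 𝒰) e (ι 𝒰 ∘ₗ d)) {n : ℕ}
    (hn : ∀ l, n ≤ l.length → d (wprod 𝒰 l) = 0) :
    conv 𝒰 (ι 𝒰 ∘ₗ d) LinearMap.id ∈ diffOp (grading 𝒰) n := by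
  induction n generalizing d e with
  | zero =>
    have : d = 0 := ext_words 𝒰 fun l _ => hn l (Nat.zero_le _)
    rw [this, LinearMap.comp_zero, conv_zero_left]
    exact zero_mem _
  | succ n ih =>
    have hT : IsHomog (grading 𝒰) (grading 𝒰) e (conv 𝒰 (ι 𝒰 ∘ₗ d) LinearMap.id) :=
      (conv_isHomog_add 𝒰 (grading 𝒰) hd isHomog_id).of_eq (add_zero e)
    rw [mem_diffOp_succ]
    intro a
    induction a using word_induction (𝒰 := 𝒰) with
    | zero => rw [map_zero]; exact zero_mem _
    | add a b ha hb => rw [map_add]; exact add_mem ha hb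
    | smul c a ha => rw [map_smul]; exact Submodule.smul_mem _ _ ha
    | word l hl =>
      induction l with
      | nil =>
        rw [wprod_nil, commL_one _ hT]
        exact zero_mem _
      | cons t l ihl =>
        obtain ⟨ht, hl⟩ := isWord_cons.1 hl
        rw [wprod_cons, commL_mul _ hT (ι_mem_grading 𝒰 ht) (wprod_mem 𝒰 hl)]
        refine add_mem (mul_mulLeft_mem_diffOp _ ?_ _)
          (Submodule.smul_mem _ _ (mulLeft_mul_mem_diffOp _ (ihl hl) _))
        rw [commL_conv_id hd ht]
        exact ih (isHomog_comp_mulι 𝒰 (grading 𝒰) hd ht) fun l hl => hn (t :: l) (by simpa using hl)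

end Coderivations

/-! ### The `BV∞`-algebra of an `L∞`-algebra -/

section BVofLInf

open GSym

variable {k G V : Type*} [Field k] [AddCommGroup G] [Module k G] [Ring V] [Algebra k V]
  {𝒢 : ℤ → Submodule k G} [Decomposition 𝒢] {𝒱 : ℤ → Submodule k V} [GradedAlgebra 𝒱]

theorem theta_injective {f g : GSym (shift 𝒢 (-1)) →ₗ[k] HSeries 𝒱} (h : theta f = theta g) :
    f = g := by
  refine ext_words _ fun l hl => inc_injective 𝒱 ?_
  rw [wprod_eq_susp, inc_eq_theta, inc_eq_theta, h]

/-- The transform of an algebra homomorphism is multiplicative. -/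
theorem theta_mul (α : GSym (shift 𝒢 (-1)) →ₐ[k] HSeries 𝒱) (a b : GSym (shift 𝒢 1)) :
    theta α.toLinearMap (a * b) = theta α.toLinearMap a * theta α.toLinearMap b := by
  induction a using word_induction (𝒰 := shift 𝒢 1) with
  | zero => simp
  | add a a' h h' => rw [add_mul, map_add, h, h', map_add, add_mul]
  | smul c a h => rw [smul_mul_assoc, map_smul, h, map_smul, smul_mul_assoc]
  | word l hl =>
    induction b using word_induction (𝒰 := shift 𝒢 1) with
    | zero => simp
    | add b b' h h' => rw [mul_add, map_add, h, h', map_add, mul_add]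
    | smul c b h => rw [mul_smul_comm, map_smul, h, map_smul, mul_smul_comm]
    | word l' hl' =>
      rw [← wprod_append, theta_wprod, theta_wprod, theta_wprod, wprod_append, map_mul,
        AlgHom.toLinearMap_apply, AlgHom.toLinearMap_apply, AlgHom.toLinearMap_apply, map_mul,
        map_mul, mul_assoc (hb V _), ← mul_assoc (inc 𝒱 _) (hb V _), ← hb_comm, mul_assoc (hb V _),
        hb_mul_hb_mul, List.length_append]
      congr 2
      push_cast; ring

variable (𝒱) in
/-- The inclusion of the constants `V → V[[ħ]]` as an algebra homomorphism. -/
def hconst : V →ₐ[k] HSeries 𝒱 :=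
  AlgHom.ofLinearMap (hmonomial 𝒱 0) hmonomial_zero_one hmonomial_zero_mul

variable (𝒢) in
/-- The algebra homomorphism `S(𝔤[1]) → S(𝔤[-1])((ħ))`, `x ↦ ħ⁻¹ x` for `x ∈ 𝔤`. -/
def thetaHom : GSym (shift 𝒢 1) →ₐ[k] LaurentSeries (GSym (shift 𝒢 (-1))) :=
  AlgHom.ofLinearMap (theta (hmonomial (grading (shift 𝒢 (-1))) 0))
    (by rw [theta_one, hmonomial_zero_one, map_one])
    (theta_mul (hconst (grading (shift 𝒢 (-1)))))

theorem thetaHom_apply (a : GSym (shift 𝒢 1)) :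
    thetaHom 𝒢 a = theta (hmonomial (grading (shift 𝒢 (-1))) 0) a := rfl

theorem thetaHom_ι (x : G) : thetaHom 𝒢 (ι (shift 𝒢 1) x) =
    hb _ (-1) * inc _ (hmonomial (grading (shift 𝒢 (-1))) 0 (ι (shift 𝒢 (-1)) x)) := by
  have := theta_wprod (hmonomial (grading (shift 𝒢 (-1))) 0) [((0 : ℤ), x)]
  rw [wprod_cons, wprod_nil, mul_one] at this
  rw [thetaHom_apply, this]
  simp only [susp, regrade_ι]
  simp

variable {D : GSym (shift 𝒢 1) →ₗ[k] GSym (shift 𝒢 1)}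

theorem coderComponent_wprod_eq_zero {n : ℕ} {l : List (ℤ × G)} (hl : IsWord (shift 𝒢 (-1)) l)
    (hn : l.length < n) : coderComponent 𝒢 D n (wprod (shift 𝒢 (-1)) l) = 0 := by
  refine conv_eq_zero_of_words _ _ _ hl fun l₁ l₂ h => ?_
  have := h.length_eq
  rw [List.length_append] at this
  simp only [LinearMap.comp_apply]
  rw [proj_wprod, if_neg (by omega)]
  simp

theorem hcoeff_hmonomial (n m : ℕ) (v : V) :
    hcoeff 𝒱 n (hmonomial 𝒱 m v) = if n = m then v else 0 := by
  change PowerSeries.coeff n (PowerSeries.monomial m v) = _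
  rw [PowerSeries.coeff_monomial]

theorem hcoeff_comp_bvOfLInf {n : ℕ} (hn : 1 ≤ n) :
    hcoeff (grading (shift 𝒢 (-1))) (n - 1) ∘ₗ bvOfLInf 𝒢 D = coderComponent 𝒢 D n := by
  refine ext_words _ fun l hl => ?_
  rw [LinearMap.comp_apply, bvOfLInf, weightwise_wprod, LinearMap.sum_apply, map_sum]
  simp only [LinearMap.comp_apply, hcoeff_hmonomial]
  by_cases h : n ≤ l.length
  · rw [Finset.sum_eq_single n]
    · simp
    · intro j hj hjn
      rw [Finset.mem_Icc] at hj
      rw [if_neg (by omega)]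
    · intro h'
      exact absurd (Finset.mem_Icc.2 ⟨hn, h⟩) h'
  · rw [coderComponent_wprod_eq_zero hl (by omega)]
    refine Finset.sum_eq_zero fun j hj => ?_
    rw [Finset.mem_Icc] at hj
    rw [if_neg (by omega)]

theorem coderComponent_arg_isHomog (hD : IsHomog (grading (shift 𝒢 1)) (grading (shift 𝒢 1)) 1 D)
    (n : ℕ) : IsHomog (grading (shift 𝒢 (-1))) (grading (shift 𝒢 (-1))) (3 - 2 * n)
      (ι (shift 𝒢 (-1)) ∘ₗ toCogen (shift 𝒢 1) ∘ₗ D ∘ₗ (desusp 𝒢).toLinearMap ∘ₗ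
        proj (shift 𝒢 (-1)) n) := by
  refine isHomog_of_words _ _ fun l hl => ?_
  simp only [LinearMap.comp_apply, AlgHom.toLinearMap_apply]
  rw [proj_wprod]
  split_ifs with h
  · refine ι_mem_grading _ ?_
    rw [desusp_wprod]
    have := toCogen_mem (hD.word (isWord_desuspWord hl))
    rw [sum_desuspWord, h] at this
    change _ ∈ 𝒢 (-1 + _)
    change _ ∈ 𝒢 (1 + _) at this
    convert this using 2
    ring
  · simp

theorem coderComponent_isHomog (hD : IsHomog (grading (shift 𝒢 1)) (grading (shift 𝒢 1)) 1 D)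
    (n : ℕ) : IsHomog (grading (shift 𝒢 (-1))) (grading (shift 𝒢 (-1))) (3 - 2 * n)
      (coderComponent 𝒢 D n) :=
  (conv_isHomog_add _ _ (coderComponent_arg_isHomog hD n) isHomog_id).of_eq (add_zero _)

theorem bvOfLInf_isHomog (hD : IsHomog (grading (shift 𝒢 1)) (grading (shift 𝒢 1)) 1 D) :
    IsHomog (grading (shift 𝒢 (-1))) (hGrading (grading (shift 𝒢 (-1)))) 1 (bvOfLInf 𝒢 D) := by
  refine isHomog_of_words _ _ fun l hl => ?_
  rw [bvOfLInf, weightwise_wprod, LinearMap.sum_apply]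
  refine Submodule.sum_mem _ fun n hn => ?_
  rw [Finset.mem_Icc] at hn
  have := hmonomial_mem ((coderComponent_isHomog hD n).word hl) (n - 1)
  rw [LinearMap.comp_apply]
  convert this using 2
  push_cast [hn.1]
  ring

theorem _root_.HBV.IsCoderivation.isCoder {U : Type*} [AddCommGroup U] [Module k U]
    {𝒰 : ℤ → Submodule k U} [Decomposition 𝒰] {D : GSym 𝒰 →ₗ[k] GSym 𝒰}
    (hD : IsCoderivation 𝒰 D) : IsCoder 𝒰 1 D := by
  intro a
  rw [koszul_one]
  exact hD.coder a

variable [CharZero k]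

/-- The operator `Δ_𝔤` corresponds to `D` under the embedding `x ↦ ħ⁻¹ x` of `S(𝔤[1])` into
`S(𝔤[-1])((ħ))`. -/
theorem theta_bvOfLInf (hD : IsLInf 𝒢 D) (a : GSym (shift 𝒢 1)) :
    theta (bvOfLInf 𝒢 D) a = theta (hmonomial (grading (shift 𝒢 (-1))) 0) (D a) := by
  suffices theta (bvOfLInf 𝒢 D) = (thetaHom 𝒢).toLinearMap ∘ₗ D from LinearMap.congr_fun this a
  refine ext_words _ fun l hl => ?_
  have hDc := eq_conv_of_isCoder hD.isCoder hD.homog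
  set pD := toCogen (shift 𝒢 1) ∘ₗ D with hpD
  set I := (inc (grading (shift 𝒢 (-1)))).comp (hconst (grading (shift 𝒢 (-1)))) with hI
  -- the image of `D` is the extension of its components, which take values in `𝔤` and so acquire
  -- the factor `ħ⁻¹`
  have hR : (thetaHom 𝒢).toLinearMap ∘ₗ D = conv (shift 𝒢 1)
      ((thetaHom 𝒢).toLinearMap ∘ₗ ι (shift 𝒢 1) ∘ₗ pD) (thetaHom 𝒢).toLinearMap := by
    conv_lhs => rw [hDc, algHom_conv]
    rfl
  have hS : (thetaHom 𝒢).toLinearMap =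
      scale (shift 𝒢 1) (-1) (I.toLinearMap ∘ₗ (susp 𝒢).toLinearMap) := rfl
  have hj : ∀ j : ℕ, I.toLinearMap ∘ₗ coderComponent 𝒢 D j ∘ₗ (susp 𝒢).toLinearMap =
      conv (shift 𝒢 1) (I.toLinearMap ∘ₗ ι (shift 𝒢 (-1)) ∘ₗ pD ∘ₗ proj (shift 𝒢 1) j)
        (I.toLinearMap ∘ₗ (susp 𝒢).toLinearMap) := by
    intro j
    rw [coderComponent, conv_comp_coalgHom isCoalgHom_susp, algHom_conv]
    congr 1
    refine ext_words _ fun l hl => ?_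
    simp only [LinearMap.comp_apply, AlgHom.toLinearMap_apply, susp_wprod, proj_wprod,
      length_suspWord, hpD]
    split_ifs
    · rw [← susp_wprod, desusp_susp]
    · simp
  have hL : theta (bvOfLInf 𝒢 D) (wprod (shift 𝒢 1) l) = ∑ j ∈ Finset.Icc 1 l.length,
      hb _ (j - 1 : ℤ) * conv (shift 𝒢 1)
        (scale (shift 𝒢 1) (-1) (I.toLinearMap ∘ₗ ι (shift 𝒢 (-1)) ∘ₗ pD ∘ₗ
          proj (shift 𝒢 1) j))
        (thetaHom 𝒢).toLinearMap (wprod (shift 𝒢 1) l) := by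
    rw [theta_wprod, susp_wprod, bvOfLInf, weightwise_wprod, length_suspWord,
      LinearMap.sum_apply, map_sum, Finset.mul_sum]
    refine Finset.sum_congr rfl fun j hj' => ?_
    rw [hS, conv_scale, ← hj, scale_wprod, hb_mul_hb_mul, LinearMap.comp_apply, inc_hmonomial,
      hb_mul_hb_mul, LinearMap.comp_apply, LinearMap.comp_apply, AlgHom.toLinearMap_apply,
      AlgHom.toLinearMap_apply, susp_wprod]
    have e : -(l.length : ℤ) + ((j - 1 : ℕ) : ℤ) = (j - 1 : ℤ) + -1 * l.length := by
      push_cast [(Finset.mem_Icc.1 hj').1]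
      ring
    rw [e]
    rfl
  rw [hL, hR]
  -- the coefficient `ħ^{j-1}` of `D_j` makes up for the drop of the length by `j - 1`
  have h2 : ∀ j : ℕ, hb _ (j - 1 : ℤ) * conv (shift 𝒢 1)
        (scale (shift 𝒢 1) (-1) (I.toLinearMap ∘ₗ ι (shift 𝒢 (-1)) ∘ₗ pD ∘ₗ
          proj (shift 𝒢 1) j))
        (thetaHom 𝒢).toLinearMap (wprod (shift 𝒢 1) l) =
      conv (shift 𝒢 1) ((thetaHom 𝒢).toLinearMap ∘ₗ ι (shift 𝒢 1) ∘ₗ pD ∘ₗ proj (shift 𝒢 1) j)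
        (thetaHom 𝒢).toLinearMap (wprod (shift 𝒢 1) l) := by
    intro j
    have := LinearMap.congr_fun (mulLeft_conv (shift 𝒢 1) (hb _ (j - 1 : ℤ))
      (scale (shift 𝒢 1) (-1) (I.toLinearMap ∘ₗ ι (shift 𝒢 (-1)) ∘ₗ pD ∘ₗ
          proj (shift 𝒢 1) j)) (thetaHom 𝒢).toLinearMap) (wprod (shift 𝒢 1) l)
    refine this.symm.trans ?_
    congr 2
    refine ext_words _ fun l' _ => ?_
    rw [LinearMap.comp_apply, LinearMap.mulLeft_apply, scale_wprod]
    simp only [LinearMap.comp_apply, proj_wprod, AlgHom.toLinearMap_apply]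
    split_ifs with h
    · have e : (j : ℤ) - 1 + -1 * l'.length = -1 := by rw [h]; ring
      rw [thetaHom_ι, hb_mul_hb_mul, e]
      rfl
    · simp
  rw [Finset.sum_congr rfl fun j _ => h2 j, ← LinearMap.sum_apply, ← conv_sum_left]
  refine conv_congr_left _ hl fun l' hl' hle => ?_
  simp only [LinearMap.sum_apply, LinearMap.comp_apply, proj_wprod]
  cases l' with
  | nil =>
    rw [wprod_nil, hpD, LinearMap.comp_apply, hD.one]
    simp only [AlgHom.toLinearMap_apply, map_zero]
    refine Finset.sum_eq_zero fun j _ => ?_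
    split_ifs
    · rw [LinearMap.comp_apply, hD.one]; simp
    · simp
  | cons t l' =>
    rw [Finset.sum_eq_single (t :: l').length]
    · simp
    · intro j _ hj
      rw [if_neg (Ne.symm hj)]
      simp
    · intro h
      exact absurd (Finset.mem_Icc.2 ⟨by simp, hle⟩) h

theorem isBVInf_bvOfLInf (hD : IsLInf 𝒢 D) :
    IsBVInf (grading (shift 𝒢 (-1))) (bvOfLInf 𝒢 D) where
  homog := bvOfLInf_isHomog hD.homog
  order n hn := by
    intro l hl
    rw [hcoeff_comp_bvOfLInf hn]
    refine (mem_diffOp_iff _).1 ?_ l hl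
    refine conv_id_mem_diffOp (coderComponent_arg_isHomog hD.homog n) fun l hl => ?_
    simp only [LinearMap.comp_apply, proj_wprod]
    rw [if_neg (by omega)]
    simp
  sq v := by
    have h : theta (hext (bvOfLInf_isHomog hD.homog) ∘ₗ bvOfLInf 𝒢 D) =
        theta (0 : GSym (shift 𝒢 (-1)) →ₗ[k] HSeries (grading (shift 𝒢 (-1)))) := by
      refine LinearMap.ext fun a => ?_
      rw [← lext_theta_hext, theta_bvOfLInf hD, lext_theta, theta_bvOfLInf hD, hD.sq, map_zero]
      refine Eq.symm ?_
      induction a using word_induction (𝒰 := shift 𝒢 1) with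
      | zero => simp
      | add a b h h' => rw [map_add, h, h', add_zero]
      | smul c a h => rw [map_smul, h, smul_zero]
      | word l hl => rw [theta_wprod]; simp
    exact congrArg Subtype.val (LinearMap.congr_fun (theta_injective h) v)
  one := by
    have := weightwise_wprod (shift 𝒢 (-1)) (fun m => ∑ n ∈ Finset.Icc 1 m,
      hmonomial (grading (shift 𝒢 (-1))) (n - 1) ∘ₗ coderComponent 𝒢 D n) []
    rw [wprod_nil] at this
    rw [bvOfLInf, this]
    simp

end BVofLInf

/-! ### The higher derived brackets of a homogeneous operator -/

section Koszul

open GSym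

variable {k A : Type*} [Field k] [CharZero k] [Ring A] [Algebra k A] (𝒜 : ℤ → Submodule k A)
  [GradedAlgebra 𝒜] [GrComm 𝒜]

/-- The multiplication `S(A) → A`. -/
def mulHom : GSym 𝒜 →ₐ[k] A := lift 𝒜 LinearMap.id (GrComm.comm (𝒜 := 𝒜))

theorem mulHom_ι (a : A) : mulHom 𝒜 (ι 𝒜 a) = a := by rw [mulHom, lift_ι]; rfl

theorem commL_isHomog {T : Module.End k A} {d p : ℤ} (hT : IsHomog 𝒜 𝒜 d T) {a : A}
    (ha : a ∈ 𝒜 p) : IsHomog 𝒜 𝒜 (p + d) (commL 𝒜 a T) := by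
  intro q x hx
  rw [commL_apply_of_homog 𝒜 hT ha]
  refine sub_mem ?_ (Submodule.smul_mem _ _ ?_)
  · have := hT _ _ (SetLike.GradedMul.mul_mem ha hx)
    convert this using 2
    ring
  · have := SetLike.GradedMul.mul_mem ha (hT _ _ hx)
    convert this using 2
    ring

theorem higherBracket_one (T : Module.End k A) : higherBracket 𝒜 T 1 = T 1 :=
  higherBracket_prod 𝒜 T []

theorem higherBracket_mulι (T : Module.End k A) (a : A) :
    higherBracket 𝒜 T ∘ₗ mulι 𝒜 a = higherBracket 𝒜 (commL 𝒜 a T) := by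
  refine LinearMap.ext fun x => ?_
  change (MulOpposite.unop (iterCommHom 𝒜 (ι 𝒜 a * x)) T) 1 = _
  rw [map_mul, MulOpposite.unop_mul, Module.End.mul_apply, iterCommHom, lift_ι]
  rfl

theorem higherBracket_isHomog {T : Module.End k A} {d : ℤ} (hT : IsHomog 𝒜 𝒜 d T) :
    IsHomog (grading 𝒜) 𝒜 d (higherBracket 𝒜 T) := by
  refine isHomog_of_words _ _ fun l hl => ?_
  induction l generalizing T d with
  | nil =>
    rw [wprod_nil, higherBracket_one]
    exact hT 0 1 SetLike.GradedOne.one_mem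
  | cons t l ih =>
    obtain ⟨ht, hl⟩ := isWord_cons.1 hl
    have := ih (commL_isHomog 𝒜 hT ht) hl
    rw [← higherBracket_mulι] at this
    change (higherBracket 𝒜 T ∘ₗ mulι 𝒜 t.2) (wprod 𝒜 l) ∈ _
    convert this using 2
    rw [List.map_cons, List.sum_cons]
    ring

/-- Koszul's formula: `T(a₁ ⋯ a_m)` is the sum of `± l_n(a_{σ(1)}, …, a_{σ(n)}) a_{σ(n+1)} ⋯
a_{σ(m)}` over all shuffles `σ`. -/
theorem comp_mulHom {T : Module.End k A} {d : ℤ} (hT : IsHomog 𝒜 𝒜 d T) :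
    T ∘ₗ (mulHom 𝒜).toLinearMap =
      conv 𝒜 (higherBracket 𝒜 T) (mulHom 𝒜).toLinearMap := by
  refine ext_words _ fun l hl => ?_
  induction l generalizing T d with
  | nil => rw [wprod_nil, conv_one, higherBracket_one]; simp
  | cons t l ih =>
    obtain ⟨ht, hl⟩ := isWord_cons.1 hl
    have h : (mulHom 𝒜).toLinearMap ∘ₗ mulι 𝒜 t.2 =
        LinearMap.mulLeft k t.2 ∘ₗ (mulHom 𝒜).toLinearMap := by
      refine LinearMap.ext fun x => ?_
      change mulHom 𝒜 (ι 𝒜 t.2 * x) = _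
      rw [map_mul, mulHom_ι]; rfl
    rw [conv_cons 𝒜 ht, higherBracket_mulι, h,
      conv_koszul_mulLeft (higherBracket_isHomog 𝒜 hT) ht, ← ih (commL_isHomog 𝒜 hT ht) hl,
      LinearMap.smul_apply, LinearMap.comp_apply (LinearMap.mulLeft k t.2), ← ih hT hl,
      LinearMap.comp_apply, LinearMap.comp_apply, commL_apply_of_homog 𝒜 hT ht, wprod_cons,
      LinearMap.comp_apply, LinearMap.mulLeft_apply]
    simp only [AlgHom.toLinearMap_apply]
    rw [map_mul, mulHom_ι, sub_add_cancel]

end Koszul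

/-! ### Divisibility of the brackets -/

section Divisibility

variable {k V : Type*} [Field k] [Ring V] [Algebra k V] {𝒱 : ℤ → Submodule k V} [GradedAlgebra 𝒱]

theorem hcoeff_mul (n : ℕ) (v w : HSeries 𝒱) : hcoeff 𝒱 n (v * w) =
    ∑ ij ∈ Finset.HasAntidiagonal.antidiagonal n, hcoeff 𝒱 ij.1 v * hcoeff 𝒱 ij.2 w :=
  PowerSeries.coeff_mul n (v : PowerSeries V) w

theorem hcoeff_hext {W : Type*} [Ring W] [Algebra k W] {𝒲 : ℤ → Submodule k W}
    [SetLike.GradedMonoid 𝒲] {f : V →ₗ[k] HSeries 𝒲} {d : ℤ} (hf : IsHomog 𝒱 (hGrading 𝒲) d f)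
    (n : ℕ) (v : HSeries 𝒱) : hcoeff 𝒲 n (hext hf v) =
    ∑ ij ∈ Finset.HasAntidiagonal.antidiagonal n, hcoeff 𝒲 ij.1 (f (hcoeff 𝒱 ij.2 v)) := by
  exact PowerSeries.coeff_mk n fun m => ∑ ij ∈ Finset.HasAntidiagonal.antidiagonal m,
    hcoeff 𝒲 ij.1 (f (PowerSeries.coeff ij.2 (v : PowerSeries V)))

theorem hext_isHomog {W : Type*} [Ring W] [Algebra k W] {𝒲 : ℤ → Submodule k W}
    [SetLike.GradedMonoid 𝒲] {f : V →ₗ[k] HSeries 𝒲} {d : ℤ} (hf : IsHomog 𝒱 (hGrading 𝒲) d f) :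
    IsHomog (hGrading 𝒱) (hGrading 𝒲) d (hext hf) := fun _ _ hv => hextend_mem hf hv

theorem hcoeff_mem {p : ℤ} {v : HSeries 𝒱} (hv : v ∈ hGrading 𝒱 p) (n : ℕ) :
    hcoeff 𝒱 n v ∈ 𝒱 (p - 2 * n) := hv n

theorem hcoeff_parity (n : ℕ) (v : HSeries 𝒱) :
    hcoeff 𝒱 n (parity (hGrading 𝒱) v) = parity 𝒱 (hcoeff 𝒱 n v) := by
  suffices hcoeff 𝒱 n ∘ₗ parity (hGrading 𝒱) = parity 𝒱 ∘ₗ hcoeff 𝒱 n from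
    LinearMap.congr_fun this v
  refine linearMap_ext_homog (hGrading 𝒱) fun p v hv => ?_
  rw [LinearMap.comp_apply, LinearMap.comp_apply, parity_of_mem _ hv,
    parity_of_mem _ (hcoeff_mem hv n), map_smul]
  congr 1
  rw [sub_eq_add_neg, ← mul_neg, zpow_add₀ (by simp), zpow_mul (-1 : k) 2]
  simp

theorem sum_antidiagonal_assoc {M : Type*} [AddCommMonoid M] (φ : ℕ → ℕ → ℕ → M) (m : ℕ) :
    ∑ p ∈ Finset.HasAntidiagonal.antidiagonal m,
      ∑ q ∈ Finset.HasAntidiagonal.antidiagonal p.2, φ p.1 q.1 q.2 =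
    ∑ p ∈ Finset.HasAntidiagonal.antidiagonal m,
      ∑ q ∈ Finset.HasAntidiagonal.antidiagonal p.1, φ q.1 q.2 p.2 := by
  rw [Finset.sum_sigma', Finset.sum_sigma']
  refine Finset.sum_bij' (fun x _ => ⟨(x.1.1 + x.2.1, x.2.2), (x.1.1, x.2.1)⟩)
    (fun x _ => ⟨(x.2.1, x.2.2 + x.1.2), (x.2.2, x.1.2)⟩) ?_ ?_ ?_ ?_ ?_
  · rintro ⟨⟨a, b⟩, ⟨c, d⟩⟩ h
    simp only [Finset.mem_sigma, Finset.HasAntidiagonal.mem_antidiagonal] at h ⊢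
    obtain ⟨rfl, rfl⟩ := h
    simp [add_assoc]
  · rintro ⟨⟨a, b⟩, ⟨c, d⟩⟩ h
    simp only [Finset.mem_sigma, Finset.HasAntidiagonal.mem_antidiagonal] at h ⊢
    obtain ⟨rfl, rfl⟩ := h
    simp [add_assoc]
  · rintro ⟨⟨a, b⟩, ⟨c, d⟩⟩ h
    simp only [Finset.mem_sigma, Finset.HasAntidiagonal.mem_antidiagonal] at h
    obtain ⟨_, rfl⟩ := h
    rfl
  · rintro ⟨⟨a, b⟩, ⟨c, d⟩⟩ h
    simp only [Finset.mem_sigma, Finset.HasAntidiagonal.mem_antidiagonal] at h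
    obtain ⟨_, rfl⟩ := h
    rfl
  · rintro ⟨⟨a, b⟩, ⟨c, d⟩⟩ h
    rfl

/-- `S` is the `ħ`-linear operator `∑ ħⁱ Sᵢ` on `V[[ħ]]` with `Sᵢ` of order `≤ i + 1 - n`; in
particular `Sᵢ = 0` for `i + 1 < n`. The truncated subtraction gives `diffOp 0 = ⊥` in this case. -/
def HasSymbol (𝒱 : ℤ → Submodule k V) [GradedAlgebra 𝒱] (n : ℕ)
    (S : Module.End k (HSeries 𝒱)) : Prop :=
  ∃ F : ℕ → Module.End k V, (∀ i, F i ∈ diffOp 𝒱 (i + 2 - n)) ∧ ∀ m v, hcoeff 𝒱 m (S v) =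
    ∑ p ∈ Finset.HasAntidiagonal.antidiagonal m, F p.1 (hcoeff 𝒱 p.2 v)

theorem commL_mem_diffOp {A : Type*} [Ring A] [Algebra k A] (𝒜 : ℤ → Submodule k A)
    [Decomposition 𝒜] {n : ℕ} {T : Module.End k A} (hT : T ∈ diffOp 𝒜 n) (a : A) :
    commL 𝒜 a T ∈ diffOp 𝒜 (n - 1) := by
  cases n with
  | zero =>
    rw [(Submodule.mem_bot k).1 hT, map_zero]
    exact zero_mem _
  | succ n => exact (mem_diffOp_succ 𝒜).1 hT a

/-- A commutator with the multiplication by a series lowers the orders of all coefficients by one.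
-/
theorem HasSymbol.commL {n : ℕ} {S : Module.End k (HSeries 𝒱)} (hS : HasSymbol 𝒱 n S)
    (a : HSeries 𝒱) : HasSymbol 𝒱 (n + 1) (commL (hGrading 𝒱) a S) := by
  obtain ⟨F, hF, h⟩ := hS
  refine ⟨fun i => ∑ q ∈ Finset.HasAntidiagonal.antidiagonal i,
    HBV.commL 𝒱 (hcoeff 𝒱 q.2 a) (F q.1), fun i => Submodule.sum_mem _ fun q hq => ?_,
    fun m v => ?_⟩
  · have := Finset.HasAntidiagonal.mem_antidiagonal.1 hq
    exact diffOp_mono 𝒱 (by omega) (commL_mem_diffOp 𝒱 (hF q.1) _)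
  · have e1 : hcoeff 𝒱 m (S (a * v)) = ∑ p ∈ Finset.HasAntidiagonal.antidiagonal m,
        ∑ q ∈ Finset.HasAntidiagonal.antidiagonal p.1,
          F q.1 (hcoeff 𝒱 q.2 a * hcoeff 𝒱 p.2 v) := by
      rw [h, ← sum_antidiagonal_assoc fun i j s => F i (hcoeff 𝒱 j a * hcoeff 𝒱 s v)]
      refine Finset.sum_congr rfl fun p _ => ?_
      rw [hcoeff_mul, map_sum]
    have e2 : ∀ (b : HSeries 𝒱) (τ τ' : Module.End k (HSeries 𝒱)) (σ σ' : Module.End k V),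
        (∀ n v, hcoeff 𝒱 n (τ v) = σ (hcoeff 𝒱 n v)) →
        (∀ n v, hcoeff 𝒱 n (τ' v) = σ' (hcoeff 𝒱 n v)) →
        hcoeff 𝒱 m (b * τ (S (τ' v))) = ∑ p ∈ Finset.HasAntidiagonal.antidiagonal m,
          ∑ q ∈ Finset.HasAntidiagonal.antidiagonal p.1,
            hcoeff 𝒱 q.2 b * σ (F q.1 (σ' (hcoeff 𝒱 p.2 v))) := by
      intro b τ τ' σ σ' hτ hτ'
      have : ∀ p : ℕ × ℕ, ∑ q ∈ Finset.HasAntidiagonal.antidiagonal p.1,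
            hcoeff 𝒱 q.2 b * σ (F q.1 (σ' (hcoeff 𝒱 p.2 v))) =
          ∑ q ∈ Finset.HasAntidiagonal.antidiagonal p.1,
            hcoeff 𝒱 q.1 b * σ (F q.2 (σ' (hcoeff 𝒱 p.2 v))) := fun p =>
        (Finset.Nat.sum_antidiagonal_swap (n := p.1)
          (f := fun q => hcoeff 𝒱 q.1 b * σ (F q.2 (σ' (hcoeff 𝒱 p.2 v)))))
      rw [Finset.sum_congr rfl fun p _ => this p, ← sum_antidiagonal_assoc
        fun j i s => hcoeff 𝒱 j b * σ (F i (σ' (hcoeff 𝒱 s v))), hcoeff_mul]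
      refine Finset.sum_congr rfl fun p _ => ?_
      rw [hτ, h, map_sum, Finset.mul_sum]
      refine Finset.sum_congr rfl fun q _ => ?_
      rw [hτ']
    have e3 := e2 (a + parity (hGrading 𝒱) a) LinearMap.id LinearMap.id LinearMap.id LinearMap.id
      (fun _ _ => rfl) (fun _ _ => rfl)
    have e4 := e2 (a - parity (hGrading 𝒱) a) _ _ _ _ hcoeff_parity hcoeff_parity
    simp only [LinearMap.id_apply] at e3
    rw [commL_apply, map_sub, map_smul, map_add, e1, e3, e4, ← Finset.sum_add_distrib,
      Finset.smul_sum, ← Finset.sum_sub_distrib]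
    refine Finset.sum_congr rfl fun p _ => ?_
    rw [LinearMap.sum_apply, ← Finset.sum_add_distrib, Finset.smul_sum,
      ← Finset.sum_sub_distrib]
    refine Finset.sum_congr rfl fun q _ => ?_
    rw [commL_apply, map_add, map_sub, hcoeff_parity]

theorem HasSymbol.hcoeff_eq_zero {n : ℕ} {S : Module.End k (HSeries 𝒱)} (hS : HasSymbol 𝒱 n S)
    (v : HSeries 𝒱) {m : ℕ} (hm : m < n - 1) : hcoeff 𝒱 m (S v) = 0 := by
  obtain ⟨F, hF, h⟩ := hS
  rw [h]
  refine Finset.sum_eq_zero fun p hp => ?_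
  have := Finset.HasAntidiagonal.mem_antidiagonal.1 hp
  have h0 := hF p.1
  rw [show p.1 + 2 - n = 0 by omega] at h0
  rw [(Submodule.mem_bot k).1 h0, LinearMap.zero_apply]

theorem IsBVInf.hasSymbol {Δ : V →ₗ[k] HSeries 𝒱} (hΔ : IsBVInf 𝒱 Δ) :
    HasSymbol 𝒱 0 (hext hΔ.homog) :=
  ⟨fun i => hcoeff 𝒱 i ∘ₗ Δ, fun i => (mem_diffOp_iff 𝒱).2 fun l hl =>
    hΔ.order (i + 1) (by omega) l hl, fun m v => hcoeff_hext hΔ.homog m v⟩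

theorem HasSymbol.iterComm {n : ℕ} {S : Module.End k (HSeries 𝒱)} (hS : HasSymbol 𝒱 n S)
    (l : List (HSeries 𝒱)) : HasSymbol 𝒱 (n + l.length) (iterComm (hGrading 𝒱) S l) := by
  induction l generalizing n S with
  | nil => exact hS
  | cons a l ih =>
    have := ih (hS.commL a)
    rwa [add_assoc, add_comm 1, ← List.length_cons (a := a)] at this

end Divisibility

/-! ### The `L∞`-algebra of a `BV∞`-algebra -/

section Derived

open GSym

variable {k V : Type*} [Field k] [CharZero k] [Ring V] [Algebra k V]
  {𝒱 : ℤ → Submodule k V} [GradedAlgebra 𝒱] [GrComm 𝒱]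
  {Δ : V →ₗ[k] HSeries 𝒱} (hΔ : IsBVInf 𝒱 Δ)

theorem eq_zero_of_eq_neg_one_smul {M : Type*} [AddCommGroup M] [Module k M] {x : M}
    (h : x = (-1 : k) • x) : x = 0 := by
  have h2 : (2 : k) • x = 0 := by
    rw [two_smul]
    nth_rewrite 1 [h]
    rw [neg_one_smul, neg_add_cancel]
  exact (smul_eq_zero.1 h2).resolve_left two_ne_zero

theorem hRegrade_wprod (l : List (ℤ × HSeries 𝒱)) :
    hRegrade 𝒱 (wprod (shift (hShift 𝒱) 1) l) =
      wprod (hGrading 𝒱) (l.map fun t => (t.1 + 2 * 1, t.2)) := regrade_wprod _ _ l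

theorem isCoalgHom_hRegrade :
    IsCoalgHom (shift (hShift 𝒱) 1) (hGrading 𝒱) (hRegrade 𝒱).toLinearMap :=
  isCoalgHom_regrade _ _

theorem isWord_hRegrade {l : List (ℤ × HSeries 𝒱)} (hl : IsWord (shift (hShift 𝒱) 1) l) :
    IsWord (hGrading 𝒱) (l.map fun t => (t.1 + 2 * 1, t.2)) :=
  isWord_regrade (𝒰 := shift (hShift 𝒱) 1) (𝒰' := hGrading 𝒱) 1
    (fun p => le_of_eq (congrArg (hGrading 𝒱) (by ring))) hl

theorem hcoeff_hBracket {n : ℕ} {x : GSym (shift (hShift 𝒱) 1)}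
    (hx : x ∈ symPow (shift (hShift 𝒱) 1) n) {m : ℕ} (hm : m < n - 1) :
    hcoeff 𝒱 m (hBracket hΔ x) = 0 := by
  refine symPow_ext (shift (hShift 𝒱) 1) (f := hcoeff 𝒱 m ∘ₗ hBracket hΔ) (g := 0)
    (fun l hl hlm => ?_) hx
  rw [LinearMap.comp_apply, hBracket, LinearMap.comp_apply, AlgHom.toLinearMap_apply,
    hRegrade_wprod]
  have := higherBracket_prod (hGrading 𝒱) (hext hΔ.homog) (l.map Prod.snd)
  have e : wprod (hGrading 𝒱) (l.map fun t => (t.1 + 2 * 1, t.2)) =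
      ((l.map Prod.snd).map (ι (hGrading 𝒱))).prod := by
    rw [wprod, List.map_map, List.map_map]; rfl
  rw [e, this]
  refine (hΔ.hasSymbol.iterComm _).hcoeff_eq_zero _ ?_
  rw [List.length_map]
  omega

theorem modifiedBracket_apply {n : ℕ} {x : GSym (shift (hShift 𝒱) 1)}
    (hx : x ∈ symPow (shift (hShift 𝒱) 1) n) :
    modifiedBracket hΔ x = hdiv 𝒱 (n - 1) (hBracket hΔ x) := by
  refine symPow_ext (shift (hShift 𝒱) 1) (f := modifiedBracket hΔ)
    (g := hdiv 𝒱 (n - 1) ∘ₗ hBracket hΔ) (fun l hl hlm => ?_) hx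
  rw [modifiedBracket, weightwise_wprod, hlm]

theorem hBracket_eq_X_pow_mul {n : ℕ} {x : GSym (shift (hShift 𝒱) 1)}
    (hx : x ∈ symPow (shift (hShift 𝒱) 1) n) : (hBracket hΔ x : PowerSeries V) =
      PowerSeries.X ^ (n - 1) * (modifiedBracket hΔ x : PowerSeries V) := by
  rw [modifiedBracket_apply hΔ hx, X_pow_mul_hdiv _ _ fun m hm => hcoeff_hBracket hΔ hx hm]

theorem hext_one : hext hΔ.homog 1 = 0 := by
  refine Subtype.ext ?_
  change hextend Δ 1 = 0
  rw [← map_one (PowerSeries.C (R := V)), hextend_C, hΔ.one]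
  rfl

theorem hext_hext (v : HSeries 𝒱) : hext hΔ.homog (hext hΔ.homog v) = 0 := by
  refine Subtype.ext ?_
  change hextend Δ (hextend Δ v) = 0
  rw [hextend_hextend hΔ.homog]
  have : hext hΔ.homog ∘ₗ Δ = 0 := LinearMap.ext fun w => Subtype.ext (hΔ.sq w)
  rw [this]
  ext m
  simp [hextend]

theorem hBracket_one : hBracket hΔ 1 = 0 := by
  rw [hBracket, LinearMap.comp_apply, AlgHom.toLinearMap_apply, map_one (hRegrade 𝒱),
    higherBracket_one, hext_one hΔ]

theorem modifiedBracket_one : modifiedBracket hΔ 1 = 0 := by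
  have := modifiedBracket_apply hΔ (wprod_mem_symPow (shift (hShift 𝒱) 1) [])
  rw [wprod_nil, hBracket_one, map_zero] at this
  exact this

theorem modifiedBracket_isHomog : IsHomog (grading (shift (hShift 𝒱) 1))
    (grading (shift (hShift 𝒱) 1)) 1 (ι (shift (hShift 𝒱) 1) ∘ₗ modifiedBracket hΔ) := by
  refine isHomog_of_words _ _ fun l hl => ι_mem_grading _ ?_
  cases l with
  | nil => rw [wprod_nil, modifiedBracket_one]; exact zero_mem _
  | cons t l =>
    rw [modifiedBracket_apply hΔ (wprod_mem_symPow _ _), hBracket, LinearMap.comp_apply,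
      AlgHom.toLinearMap_apply, hRegrade_wprod]
    have h := hdiv_mem ((higherBracket_isHomog _
      (hext_isHomog hΔ.homog)).word (isWord_hRegrade hl)) ((t :: l).length - 1)
    rw [sum_map_regrade] at h
    change _ ∈ hGrading 𝒱 (1 + (1 + _))
    convert h using 2
    rw [List.length_cons]
    push_cast [Nat.add_sub_cancel]
    ring

theorem derivedLInf_isHomog : IsHomog (grading (shift (hShift 𝒱) 1))
    (grading (shift (hShift 𝒱) 1)) 1 (derivedLInf hΔ) :=
  (conv_isHomog_add _ _ (modifiedBracket_isHomog hΔ) isHomog_id).of_eq (add_zero _)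

theorem isCoder_derivedLInf : IsCoder (shift (hShift 𝒱) 1) 1 (derivedLInf hΔ) :=
  isCoder_conv_id (modifiedBracket_isHomog hΔ)

theorem derivedLInf_one : derivedLInf hΔ 1 = 0 := by
  rw [derivedLInf, conv_one, LinearMap.comp_apply, modifiedBracket_one, map_zero, zero_mul]

theorem muh_eq_scale : (muh 𝒱).toLinearMap = scale (shift (hShift 𝒱) 1) (-1)
    ((inc 𝒱).toLinearMap ∘ₗ (mulHom (hGrading 𝒱)).toLinearMap ∘ₗ (hRegrade 𝒱).toLinearMap) := by
  have : (hMultiplication 𝒱).comp (susp (hShift 𝒱)) =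
      (mulHom (hGrading 𝒱)).comp (hRegrade 𝒱) := by
    refine hom_ext fun x => ?_
    have e1 : susp (hShift 𝒱) (ι (shift (hShift 𝒱) 1) x) = ι (shift (hShift 𝒱) (-1)) x :=
      regrade_ι _ _ _
    have e2 : hRegrade 𝒱 (ι (shift (hShift 𝒱) 1) x) = ι (hGrading 𝒱) x := regrade_ι _ _ _
    rw [AlgHom.comp_apply, AlgHom.comp_apply, e1, e2, hMultiplication_ι, mulHom_ι]
  have h2 := congrArg AlgHom.toLinearMap this
  rw [← theta_hMultiplication, theta]
  congr 2

theorem muh_modifiedBracket :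
    (muh 𝒱).toLinearMap ∘ₗ ι (shift (hShift 𝒱) 1) ∘ₗ modifiedBracket hΔ =
      scale (shift (hShift 𝒱) 1) (-1) ((inc 𝒱).toLinearMap ∘ₗ hBracket hΔ) := by
  refine ext_words _ fun l hl => ?_
  rw [scale_wprod, LinearMap.comp_apply, LinearMap.comp_apply, LinearMap.comp_apply,
    AlgHom.toLinearMap_apply, AlgHom.toLinearMap_apply, muh_ι]
  cases l with
  | nil => rw [wprod_nil, modifiedBracket_one, hBracket_one]; simp
  | cons t l =>
    rw [modifiedBracket_apply hΔ (wprod_mem_symPow _ _)]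
    rw [← hb_mul_inc_hdiv ((t :: l).length - 1) (hBracket hΔ _) fun m hm =>
      hcoeff_hBracket hΔ (wprod_mem_symPow _ _) hm, hb_mul_hb_mul, List.length_cons]
    congr 2
    push_cast [Nat.add_sub_cancel]
    ring

/-- Under the map `a₁ ⋯ a_m ↦ ħ^{-m} a₁ ⋯ a_m`, the codifferential given by the modified brackets
corresponds to the operator `Δ`. -/
theorem lext_muh : lext Δ ∘ₗ (muh 𝒱).toLinearMap = (muh 𝒱).toLinearMap ∘ₗ derivedLInf hΔ := by
  have h : (muh 𝒱).toLinearMap ∘ₗ derivedLInf hΔ = scale (shift (hShift 𝒱) 1) (-1)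
      ((inc 𝒱).toLinearMap ∘ₗ hext hΔ.homog ∘ₗ (mulHom (hGrading 𝒱)).toLinearMap ∘ₗ
        (hRegrade 𝒱).toLinearMap) := by
    rw [derivedLInf, algHom_conv, muh_modifiedBracket, LinearMap.comp_id, muh_eq_scale, conv_scale,
      ← algHom_conv, hBracket, ← conv_comp_coalgHom (isCoalgHom_hRegrade (𝒱 := 𝒱)),
      ← comp_mulHom (hGrading 𝒱) (hext_isHomog hΔ.homog)]
    rfl
  rw [h, muh_eq_scale]
  refine ext_words _ fun l hl => ?_
  rw [LinearMap.comp_apply, scale_wprod, scale_wprod, lext_hb_mul]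
  congr 1
  exact lext_inc hΔ.homog _

theorem muh_ι_injective {a : HSeries 𝒱} (h : muh 𝒱 (ι _ a) = 0) : a = 0 := by
  rw [muh_ι] at h
  refine inc_injective 𝒱 (hb_mul_injective (-1) ?_)
  rw [h, map_zero, mul_zero]

/-- A linear map of the form `(μ_ħ ι e) * F`, for `F(1) = 1`, vanishes only if `e` does. -/
theorem eq_zero_of_conv_muh {G : Type*} [AddCommGroup G] [Module k G] {𝒢 : ℤ → Submodule k G}
    [Decomposition 𝒢] {e : GSym 𝒢 →ₗ[k] HSeries 𝒱} {F : GSym 𝒢 →ₗ[k] LaurentSeries V}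
    (hF : F 1 = 1) (h : conv 𝒢 ((muh 𝒱).toLinearMap ∘ₗ ι _ ∘ₗ e) F = 0) : e = 0 := by
  rw [← conv_zero_left 𝒢 F] at h
  have h2 := conv_right_cancel 𝒢 hF h
  exact LinearMap.ext fun a => muh_ι_injective (LinearMap.congr_fun h2 a)

theorem isLInf_derivedLInf : IsLInf (hShift 𝒱) (derivedLInf hΔ) where
  homog := derivedLInf_isHomog hΔ
  coder a := by
    have := isCoder_derivedLInf hΔ a
    rwa [koszul_one] at this
  one := derivedLInf_one hΔ
  sq := by
    set f := ι (shift (hShift 𝒱) 1) ∘ₗ modifiedBracket hΔ with hf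
    have hD : derivedLInf hΔ = conv _ f LinearMap.id := rfl
    have hff : conv _ (f ∘ₗ koszul (grading (shift (hShift 𝒱) 1)) 1) f = 0 := by
      have h := conv_comm (shift (hShift 𝒱) 1) (f := f) (g := f) (e := 1) (d := 1)
        fun p q a b ha hb => GrComm.comm _ _ _ _ (modifiedBracket_isHomog hΔ p a ha)
          (modifiedBracket_isHomog hΔ q b hb)
      rw [mul_one, zpow_one] at h
      exact LinearMap.ext fun a => by
        have h2 := LinearMap.congr_fun h a
        rw [LinearMap.smul_apply] at h2
        exact eq_zero_of_eq_neg_one_smul (k := k) h2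
    have h1 : derivedLInf hΔ ∘ₗ derivedLInf hΔ =
        conv _ (ι (shift (hShift 𝒱) 1) ∘ₗ modifiedBracket hΔ ∘ₗ derivedLInf hΔ)
          LinearMap.id := by
      have h := conv_comp_coder _ (isCoder_derivedLInf hΔ) f LinearMap.id
      have h0 : conv _ (f ∘ₗ koszul (grading (shift (hShift 𝒱) 1)) 1) (derivedLInf hΔ) = 0 := by
        rw [hD, ← conv_assoc, hff, conv_zero_left]
      rw [LinearMap.id_comp, h0, add_zero] at h
      exact h
    have h2 : (muh 𝒱).toLinearMap ∘ₗ derivedLInf hΔ ∘ₗ derivedLInf hΔ = 0 := by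
      rw [← LinearMap.comp_assoc, ← lext_muh, LinearMap.comp_assoc, ← lext_muh, muh_eq_scale]
      refine ext_words _ fun l hl => ?_
      rw [LinearMap.comp_apply, LinearMap.comp_apply, scale_wprod, lext_hb_mul, lext_hb_mul]
      have e := (congrArg (lext Δ) (lext_inc hΔ.homog ((mulHom (hGrading 𝒱)) ((hRegrade 𝒱)
        (wprod (shift (hShift 𝒱) 1) l))))).trans (lext_inc hΔ.homog _)
      rw [hext_hext hΔ, map_zero] at e
      refine (congrArg _ e).trans ?_
      rw [mul_zero, LinearMap.zero_apply]
    rw [h1, algHom_conv] at h2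
    have h3 := eq_zero_of_conv_muh (F := (muh 𝒱).toLinearMap ∘ₗ LinearMap.id) (by simp) h2
    intro a
    have h4 := LinearMap.congr_fun h1 a
    rw [h3, LinearMap.comp_zero, conv_zero_left] at h4
    exact h4

end Derived

namespace GSym

section Perm

variable {k U : Type*} [Field k] [AddCommGroup U] [Module k U] {𝒰 : ℤ → Submodule k U}

theorem wprod_perm {l l' : List (ℤ × U)} (h : l.Perm l') (hl : IsWord 𝒰 l) :
    ∃ c : k, wprod 𝒰 l = c • wprod 𝒰 l' := by
  induction h with
  | nil => exact ⟨1, (one_smul _ _).symm⟩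
  | cons t _ ih =>
    obtain ⟨c, hc⟩ := ih (isWord_cons.1 hl).2
    exact ⟨c, by rw [wprod_cons, hc, mul_smul_comm, wprod_cons]⟩
  | swap s t l =>
    obtain ⟨ht, hl⟩ := isWord_cons.1 hl
    obtain ⟨hs, hl⟩ := isWord_cons.1 hl
    exact ⟨_, by rw [wprod_cons, wprod_cons, ← mul_assoc, ι_comm 𝒰 ht hs, smul_mul_assoc,
      mul_assoc, ← wprod_cons, ← wprod_cons]⟩
  | trans h1 _ ih1 ih2 =>
    obtain ⟨c, hc⟩ := ih1 hl
    obtain ⟨d, hd⟩ := ih2 fun t ht => hl t (h1.mem_iff.2 ht)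
    exact ⟨c * d, by rw [hc, hd, smul_smul]⟩

theorem IsWord.perm {l l' : List (ℤ × U)} (hl : IsWord 𝒰 l) (h : l'.Perm l) : IsWord 𝒰 l' :=
  fun t ht => hl t (h.mem_iff.1 ht)

theorem mulι_add (x y : U) : mulι 𝒰 (x + y) = mulι 𝒰 x + mulι 𝒰 y := by
  refine LinearMap.ext fun a => ?_
  change ι 𝒰 (x + y) * a = ι 𝒰 x * a + ι 𝒰 y * a
  rw [map_add, add_mul]

theorem mulι_smul (c : k) (x : U) : mulι 𝒰 (c • x) = c • mulι 𝒰 x := by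
  refine LinearMap.ext fun a => ?_
  change ι 𝒰 (c • x) * a = c • (ι 𝒰 x * a)
  rw [map_smul, smul_mul_assoc]

theorem mulι_zero : mulι 𝒰 (0 : U) = 0 := by
  refine LinearMap.ext fun a => ?_
  change ι 𝒰 0 * a = 0
  rw [map_zero, zero_mul]

end Perm

end GSym

/-! ### Filtration by the powers of `ħ` -/

section Filtration

variable {k V : Type*} [Field k] [Ring V] [Algebra k V] (𝒱 : ℤ → Submodule k V) [GradedAlgebra 𝒱]

/-- The ideal `ħᴺ V[[ħ]]`. -/
def hIdeal (N : ℕ) : Submodule k (HSeries 𝒱) := ⨅ n : Fin N, LinearMap.ker (hcoeff 𝒱 n)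

variable {𝒱}

theorem mem_hIdeal {N : ℕ} {v : HSeries 𝒱} :
    v ∈ hIdeal 𝒱 N ↔ ∀ n < N, hcoeff 𝒱 n v = 0 := by
  simp only [hIdeal, Submodule.mem_iInf, LinearMap.mem_ker]
  exact ⟨fun h n hn => h ⟨n, hn⟩, fun h n => h n n.2⟩

theorem hIdeal_anti {M N : ℕ} (h : M ≤ N) : hIdeal 𝒱 N ≤ hIdeal 𝒱 M := fun _ hv =>
  mem_hIdeal.2 fun n hn => mem_hIdeal.1 hv n (by omega)

theorem mul_mem_hIdeal {M N : ℕ} {v w : HSeries 𝒱} (hv : v ∈ hIdeal 𝒱 M)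
    (hw : w ∈ hIdeal 𝒱 N) : v * w ∈ hIdeal 𝒱 (M + N) := by
  refine mem_hIdeal.2 fun n hn => ?_
  rw [hcoeff_mul]
  refine Finset.sum_eq_zero fun ij hij => ?_
  have := Finset.HasAntidiagonal.mem_antidiagonal.1 hij
  by_cases h : ij.1 < M
  · rw [mem_hIdeal.1 hv _ h, zero_mul]
  · rw [mem_hIdeal.1 hw ij.2 (by omega), mul_zero]

variable (𝒱) in
/-- The element `ħʲ` of `V[[ħ]]`. -/
def hbar (j : ℕ) : HSeries 𝒱 := hmonomial 𝒱 j 1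

theorem hbar_mul_coe (j : ℕ) (v : HSeries 𝒱) :
    ((hbar 𝒱 j * v : HSeries 𝒱) : PowerSeries V) = PowerSeries.X ^ j * (v : PowerSeries V) := by
  change (hmonomial 𝒱 j 1 : PowerSeries V) * v = _
  rw [hmonomial_coe, map_one, mul_one]

theorem hbar_mul_mem_hIdeal (j : ℕ) (v : HSeries 𝒱) : hbar 𝒱 j * v ∈ hIdeal 𝒱 j := by
  refine mem_hIdeal.2 fun n hn => ?_
  change PowerSeries.coeff n ((hbar 𝒱 j * v : HSeries 𝒱) : PowerSeries V) = 0
  rw [hbar_mul_coe, PowerSeries.coeff_X_pow_mul', if_neg (by omega)]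

theorem hbar_mem_hIdeal (j : ℕ) : hbar 𝒱 j ∈ hIdeal 𝒱 j := by
  simpa using hbar_mul_mem_hIdeal j (1 : HSeries 𝒱)

theorem hext_hbar_mul {W : Type*} [Ring W] [Algebra k W] {𝒲 : ℤ → Submodule k W}
    [GradedAlgebra 𝒲] {f : V →ₗ[k] HSeries 𝒲} {d : ℤ} (hf : IsHomog 𝒱 (hGrading 𝒲) d f)
    (j : ℕ) (v : HSeries 𝒱) : hext hf (hbar 𝒱 j * v) = hbar 𝒲 j * hext hf v := by
  refine Subtype.ext ?_
  rw [hbar_mul_coe]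
  change hextend f ((hbar 𝒱 j * v : HSeries 𝒱) : PowerSeries V) = _
  rw [hbar_mul_coe, hextend_X_pow_mul]
  rfl

theorem hext_hmonomial {W : Type*} [Ring W] [Algebra k W] {𝒲 : ℤ → Submodule k W}
    [GradedAlgebra 𝒲] {f : V →ₗ[k] HSeries 𝒲} {d : ℤ} (hf : IsHomog 𝒱 (hGrading 𝒲) d f)
    (v : V) : hext hf (hmonomial 𝒱 0 v) = f v := by
  refine Subtype.ext ?_
  change hextend f (hmonomial 𝒱 0 v : PowerSeries V) = _
  rw [hmonomial_coe, pow_zero, one_mul, hextend_C]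

/-- A power series is the sum of its first `M` terms and a multiple of `ħᴹ`. -/
theorem eq_sum_add_hbar_mul (M : ℕ) (v : HSeries 𝒱) :
    v = (∑ j ∈ Finset.range M, hbar 𝒱 j * hmonomial 𝒱 0 (hcoeff 𝒱 j v)) +
      hbar 𝒱 M * hdiv 𝒱 M v := by
  have h0 : ∀ (j n : ℕ) (w : V), hcoeff 𝒱 n (hbar 𝒱 j * hmonomial 𝒱 0 w) =
      if n = j then w else 0 := by
    intro j n w
    change PowerSeries.coeff n ((hbar 𝒱 j * hmonomial 𝒱 0 w : HSeries 𝒱) : PowerSeries V) = _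
    rw [hbar_mul_coe, hmonomial_coe, pow_zero, one_mul, PowerSeries.coeff_X_pow_mul',
      PowerSeries.coeff_C]
    split_ifs <;> first | rfl | omega
  refine Subtype.ext (PowerSeries.ext fun n => ?_)
  change hcoeff 𝒱 n v = hcoeff 𝒱 n (_ + _)
  rw [map_add, map_sum]
  have h1 : hcoeff 𝒱 n (hbar 𝒱 M * hdiv 𝒱 M v) = if M ≤ n then hcoeff 𝒱 n v else 0 := by
    change PowerSeries.coeff n ((hbar 𝒱 M * hdiv 𝒱 M v : HSeries 𝒱) : PowerSeries V) = _
    rw [hbar_mul_coe, PowerSeries.coeff_X_pow_mul']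
    split_ifs with h
    · rw [hdiv_coe, Nat.sub_add_cancel h]
      rfl
    · rfl
  rw [h1, Finset.sum_congr rfl fun j _ => h0 j n _, Finset.sum_ite_eq]
  simp only [Finset.mem_range]
  split_ifs <;> first | (exfalso; omega) | simp

end Filtration

/-! ### Divisibility of `ψ ⋄ p₁` -/

section Counit

open GSym

variable {k U V : Type*} [Field k] [CharZero k] [AddCommGroup U] [Module k U] [Ring V]
  [Algebra k V] {𝒰 : ℤ → Submodule k U} [Decomposition 𝒰]
  {𝒱 : ℤ → Submodule k V} [GradedAlgebra 𝒱] [GrComm 𝒱]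

/-- The formula `convLog_mulι` for an element `x` that need not be homogeneous. -/
theorem convLog_mulι' {𝒲 : ℤ → Submodule k U} [Decomposition 𝒲] {B : Type*} [Ring B] [Algebra k B]
    (ℬ : ℤ → Submodule k B) [SetLike.GradedMonoid ℬ] [GrComm ℬ] {Φ : GSym 𝒲 →ₗ[k] B}
    (hΦ : IsHomog (grading 𝒲) ℬ 0 Φ) (hΦ1 : Φ 1 = 1) (x : U) :
    convLog 𝒲 Φ ∘ₗ mulι 𝒲 x = conv 𝒲 (Φ ∘ₗ mulι 𝒲 x) (convInv 𝒲 Φ) := by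
  induction x using Decomposition.inductionOn 𝒲 with
  | zero => rw [mulι_zero, LinearMap.comp_zero, LinearMap.comp_zero, conv_zero_left]
  | @homogeneous p m => exact convLog_mulι 𝒲 ℬ hΦ hΦ1 m.2
  | add x y hx hy =>
    rw [mulι_add, LinearMap.comp_add, LinearMap.comp_add, hx, hy, conv_add_left]

theorem hMultiplication_isHomog {W : Type*} [Ring W] [Algebra k W] (𝒲 : ℤ → Submodule k W)
    [GradedAlgebra 𝒲] [GrComm 𝒲] : IsHomog (grading (shift (hShift 𝒲) (-1))) (hGrading 𝒲) 0
      (hMultiplication 𝒲).toLinearMap := by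
  refine isHomog_of_words _ _ fun l hl => ?_
  rw [add_zero, AlgHom.toLinearMap_apply]
  induction l with
  | nil => simpa using (SetLike.GradedOne.one_mem : (1 : HSeries 𝒲) ∈ hGrading 𝒲 0)
  | cons t l ih =>
    obtain ⟨ht, hl⟩ := isWord_cons.1 hl
    rw [wprod_cons, map_mul, hMultiplication_ι]
    refine SetLike.GradedMul.mul_mem ?_ (ih hl)
    change t.2 ∈ hGrading 𝒲 (1 + (-1 + t.1)) at ht
    rwa [← add_assoc, add_neg_cancel, zero_add] at ht

variable {ψ : GSym 𝒰 →ₗ[k] HSeries 𝒱} (hψ : IsHomog (grading 𝒰) (hGrading 𝒱) 0 ψ)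

/-- The map `exp(ψ) ∘ μ` on `S(S(U)[[ħ]])`. -/
def expMul : GSym (shift (hShift (grading 𝒰)) (-1)) →ₗ[k] HSeries 𝒱 :=
  expExt hψ ∘ₗ (hMultiplication (grading 𝒰)).toLinearMap

theorem expExt_one : expExt hψ 1 = 1 := by
  rw [← hmonomial_zero_one, expExt, hext_hmonomial, convExp_one]

theorem expMul_one : expMul hψ 1 = 1 := by
  rw [expMul, LinearMap.comp_apply, AlgHom.toLinearMap_apply, map_one (hMultiplication _),
    expExt_one]

theorem expMul_isHomog : IsHomog (grading (shift (hShift (grading 𝒰)) (-1))) (hGrading 𝒱) 0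
    (expMul hψ) :=
  ((hext_isHomog (convExp_isHomog 𝒰 (hGrading 𝒱) hψ)).comp
    (hMultiplication_isHomog (grading 𝒰))).of_eq (add_zero 0)

theorem diamondCounit_isHomog : IsHomog (grading (shift (hShift (grading 𝒰)) (-1))) (hGrading 𝒱) 0
    (diamondCounit hψ) :=
  convLog_isHomog _ _ (expMul_isHomog hψ)

theorem diamondCounit_mulι (a : HSeries (grading 𝒰)) :
    diamondCounit hψ ∘ₗ mulι (shift (hShift (grading 𝒰)) (-1)) a =
      conv _ (expMul hψ ∘ₗ mulι _ a) (convInv _ (expMul hψ)) :=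
  convLog_mulι' (hGrading 𝒱) (expMul_isHomog hψ) (expMul_one hψ) a

theorem expMul_mulι (a : HSeries (grading 𝒰)) :
    expMul hψ ∘ₗ mulι (shift (hShift (grading 𝒰)) (-1)) a =
      conv _ (diamondCounit hψ ∘ₗ mulι _ a) (expMul hψ) := by
  rw [diamondCounit_mulι, conv_assoc, convInv_conv _ (expMul_one hψ), conv_convUnit]

theorem expMul_ι_mul (a : HSeries (grading 𝒰)) (w : GSym (shift (hShift (grading 𝒰)) (-1))) :
    expMul hψ (ι _ a * w) = expExt hψ (a * hMultiplication (grading 𝒰) w) := by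
  rw [expMul, LinearMap.comp_apply, AlgHom.toLinearMap_apply, map_mul, hMultiplication_ι]

theorem expMul_mulι_one : expMul hψ ∘ₗ mulι (shift (hShift (grading 𝒰)) (-1)) 1 = expMul hψ := by
  refine LinearMap.ext fun w => ?_
  refine (expMul_ι_mul hψ 1 w).trans ?_
  rw [one_mul]; rfl

theorem expMul_mulι_mul (a b : HSeries (grading 𝒰)) :
    expMul hψ ∘ₗ mulι (shift (hShift (grading 𝒰)) (-1)) (a * b) =
      (expMul hψ ∘ₗ mulι _ a) ∘ₗ mulι _ b := by
  refine LinearMap.ext fun w => ?_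
  have h1 := expMul_ι_mul hψ (a * b) w
  have h2 := expMul_ι_mul hψ a (ι _ b * w)
  rw [map_mul (hMultiplication _), hMultiplication_ι] at h2
  rw [mul_assoc] at h1
  exact h1.trans h2.symm

theorem expMul_mulι_hbar_mul (j : ℕ) (a : HSeries (grading 𝒰)) :
    expMul hψ ∘ₗ mulι (shift (hShift (grading 𝒰)) (-1)) (hbar _ j * a) =
      LinearMap.mulLeft k (hbar 𝒱 j) ∘ₗ expMul hψ ∘ₗ mulι _ a := by
  refine LinearMap.ext fun w => ?_
  refine (expMul_ι_mul hψ _ w).trans ?_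
  rw [mul_assoc, expExt, hext_hbar_mul]
  exact congrArg (fun v => hbar 𝒱 j * v) (expMul_ι_mul hψ a w).symm

theorem diamondCounit_mulι_one :
    diamondCounit hψ ∘ₗ mulι (shift (hShift (grading 𝒰)) (-1)) 1 = convUnit _ _ := by
  rw [diamondCounit_mulι, expMul_mulι_one, conv_convInv _ (expMul_one hψ)]

theorem diamondCounit_mulι_hbar_mul (j : ℕ) (a : HSeries (grading 𝒰)) :
    diamondCounit hψ ∘ₗ mulι (shift (hShift (grading 𝒰)) (-1)) (hbar _ j * a) =
      LinearMap.mulLeft k (hbar 𝒱 j) ∘ₗ diamondCounit hψ ∘ₗ mulι _ a := by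
  rw [diamondCounit_mulι, expMul_mulι_hbar_mul, mulLeft_conv, diamondCounit_mulι]

/-- The values of `κ = ψ ⋄ p₁` at products:
`κ(ab ⋅ w) = κ(a ⋅ b ⋅ w) + ∑ ± κ(a ⋅ w') κ(b ⋅ w'')`. -/
theorem diamondCounit_mulι_mul (a : HSeries (grading 𝒰)) {b : HSeries (grading 𝒰)} {p : ℤ}
    (hb : b ∈ shift (hShift (grading 𝒰)) (-1) p) :
    diamondCounit hψ ∘ₗ mulι (shift (hShift (grading 𝒰)) (-1)) (a * b) =
      (diamondCounit hψ ∘ₗ mulι _ a) ∘ₗ mulι _ b +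
        conv _ ((diamondCounit hψ ∘ₗ mulι _ a) ∘ₗ koszul (grading _) p)
          (diamondCounit hψ ∘ₗ mulι _ b) := by
  refine conv_right_cancel _ (expMul_one hψ) ?_
  rw [← expMul_mulι, expMul_mulι_mul, expMul_mulι, conv_mulι _ hb, expMul_mulι hψ b,
    conv_add_left, conv_assoc]

/-- The inclusion `S(U) → S(S(U)[[ħ]])` induced by `U → S(U)[[ħ]]`. -/
def letterHom (𝒰 : ℤ → Submodule k U) [Decomposition 𝒰] :
    GSym 𝒰 →ₐ[k] GSym (shift (hShift (grading 𝒰)) (-1)) :=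
  lift 𝒰 (ι _ ∘ₗ hmonomial (grading 𝒰) 0 ∘ₗ ι 𝒰) (by
    have h : ∀ (p : ℤ) (x : U), x ∈ 𝒰 p → hmonomial (grading 𝒰) 0 (ι 𝒰 x) ∈
        shift (hShift (grading 𝒰)) (-1) p := by
      intro p x hx
      have := hmonomial_mem (ι_mem_grading 𝒰 hx) 0
      change _ ∈ hGrading (grading 𝒰) (1 + (-1 + p))
      convert this using 2
      push_cast; ring
    intro p q x y hx hy
    exact ι_comm _ (h p x hx) (h q y hy))

theorem letterHom_ι (x : U) :
    letterHom 𝒰 (ι 𝒰 x) = ι _ (hmonomial (grading 𝒰) 0 (ι 𝒰 x)) := by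
  rw [letterHom, lift_ι]; rfl

theorem letter_mem {p : ℤ} {x : U} (hx : x ∈ 𝒰 p) : hmonomial (grading 𝒰) 0 (ι 𝒰 x) ∈
    shift (hShift (grading 𝒰)) (-1) (p + 2 * 0) := by
  have := hmonomial_mem (ι_mem_grading 𝒰 hx) 0
  change _ ∈ hGrading (grading 𝒰) (1 + (-1 + (p + 2 * 0)))
  convert this using 2
  push_cast; ring

theorem isCoalgHom_letterHom :
    IsCoalgHom 𝒰 (shift (hShift (grading 𝒰)) (-1)) (letterHom 𝒰).toLinearMap :=
  isCoalgHom_of_algHom (letterHom 𝒰) (hmonomial (grading 𝒰) 0 ∘ₗ ι 𝒰) 0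
    (fun _ _ hx => letter_mem hx) letterHom_ι

theorem hMultiplication_letterHom (w : GSym 𝒰) :
    hMultiplication (grading 𝒰) (letterHom 𝒰 w) = hmonomial (grading 𝒰) 0 w := by
  suffices (hMultiplication (grading 𝒰)).comp (letterHom 𝒰) = hconst (grading 𝒰) from
    AlgHom.congr_fun this w
  refine hom_ext fun x => ?_
  rw [AlgHom.comp_apply, letterHom_ι, hMultiplication_ι]
  rfl

/-- On products of elements of `U`, the map `ψ ⋄ p₁` is `ψ`. -/
theorem diamondCounit_letterHom (hψ1 : ψ 1 = 0) (w : GSym 𝒰) :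
    diamondCounit hψ (letterHom 𝒰 w) = ψ w := by
  suffices diamondCounit hψ ∘ₗ (letterHom 𝒰).toLinearMap = ψ from LinearMap.congr_fun this w
  have h : expMul hψ ∘ₗ (letterHom 𝒰).toLinearMap = convExp 𝒰 ψ := by
    refine LinearMap.ext fun w => ?_
    have e : expMul hψ (letterHom 𝒰 w) =
      expExt hψ (hMultiplication (grading 𝒰) (letterHom 𝒰 w)) := rfl
    rw [LinearMap.comp_apply, AlgHom.toLinearMap_apply, e, hMultiplication_letterHom, expExt,
      hext_hmonomial]
  change convLog _ (expMul hψ) ∘ₗ _ = ψ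
  rw [convLog_comp_coalgHom isCoalgHom_letterHom (expMul_one hψ), h,
    convLog_convExp 𝒰 (hGrading 𝒱) hψ hψ1]

/-- The homogeneous elements of `U`, as elements of `S(U)[[ħ]]`. -/
def IsLetter (𝒰 : ℤ → Submodule k U) [Decomposition 𝒰] (t : ℤ × HSeries (grading 𝒰)) : Prop :=
  ∃ x ∈ 𝒰 t.1, t.2 = hmonomial (grading 𝒰) 0 (ι 𝒰 x)

open Classical in
/-- The number of factors of a product that are not elements of `U`. -/
def nonLetters (l : List (ℤ × HSeries (grading 𝒰))) : ℕ :=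
  l.countP fun t => ¬ IsLetter 𝒰 t

theorem nonLetters_perm {l l' : List (ℤ × HSeries (grading 𝒰))} (h : l.Perm l') :
    nonLetters l = nonLetters l' := by
  classical exact h.countP_eq _

theorem nonLetters_append (l l' : List (ℤ × HSeries (grading 𝒰))) :
    nonLetters (l ++ l') = nonLetters l + nonLetters l' := List.countP_append

theorem nonLetters_cons_of_isLetter {t : ℤ × HSeries (grading 𝒰)} (ht : IsLetter 𝒰 t)
    (l : List (ℤ × HSeries (grading 𝒰))) : nonLetters (t :: l) = nonLetters l := by
  classical exact List.countP_cons_of_neg (by simpa using ht)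

theorem nonLetters_cons_of_not {t : ℤ × HSeries (grading 𝒰)} (ht : ¬ IsLetter 𝒰 t)
    (l : List (ℤ × HSeries (grading 𝒰))) : nonLetters (t :: l) = nonLetters l + 1 := by
  classical exact List.countP_cons_of_pos (by simpa using ht)

theorem exists_perm_cons_of_nonLetters {l : List (ℤ × HSeries (grading 𝒰))}
    (h : nonLetters l ≠ 0) : ∃ t l', ¬ IsLetter 𝒰 t ∧ l.Perm (t :: l') := by
  classical
  obtain ⟨t, ht, hn⟩ := List.countP_pos_iff.1 (Nat.pos_of_ne_zero h)
  exact ⟨t, l.erase t, by simpa using hn, List.perm_cons_erase ht⟩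

theorem exists_eq_letterHom {l : List (ℤ × HSeries (grading 𝒰))} (h : nonLetters l = 0) :
    ∃ l', IsWord 𝒰 l' ∧ l'.length = l.length ∧ wprod _ l = letterHom 𝒰 (wprod 𝒰 l') := by
  induction l with
  | nil => exact ⟨[], isWord_nil 𝒰, rfl, by simp⟩
  | cons t l ih =>
    by_cases ht : IsLetter 𝒰 t
    · rw [nonLetters_cons_of_isLetter ht] at h
      obtain ⟨l', hl', hlen, he⟩ := ih h
      obtain ⟨x, hx, hxe⟩ := ht
      refine ⟨(t.1, x) :: l', isWord_cons.2 ⟨hx, hl'⟩, by simp [hlen], ?_⟩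
      rw [wprod_cons, wprod_cons, map_mul, letterHom_ι, ← he, hxe]
    · rw [nonLetters_cons_of_not ht] at h
      omega

/-- The maps `f` such that `f(a₁ ⋯ a_r)` is divisible by `ħʳ` if at most `m` of the factors are not
elements of `U`. -/
def IsDivisible (m : ℕ) (f : GSym (shift (hShift (grading 𝒰)) (-1)) →ₗ[k] HSeries 𝒱) : Prop :=
  ∀ l, IsWord (shift (hShift (grading 𝒰)) (-1)) l → nonLetters l ≤ m →
    f (wprod _ l) ∈ hIdeal 𝒱 l.length

variable {hψ} {m : ℕ}

theorem isDivisible_mulι_letter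
    (h : ∀ l, IsWord (shift (hShift (grading 𝒰)) (-1)) l → nonLetters l ≤ m →
      diamondCounit hψ (wprod _ l) ∈ hIdeal 𝒱 (l.length - 1)) {p : ℤ} {x : U} (hx : x ∈ 𝒰 p) :
    IsDivisible m (diamondCounit hψ ∘ₗ mulι _ (hmonomial (grading 𝒰) 0 (ι 𝒰 x))) := by
  intro l hl hm
  have hx' := letter_mem hx
  rw [mul_zero, add_zero] at hx'
  have := h ((p, hmonomial (grading 𝒰) 0 (ι 𝒰 x)) :: l) (isWord_cons.2 ⟨hx', hl⟩)
    (by rwa [nonLetters_cons_of_isLetter ⟨x, hx, rfl⟩])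
  rwa [List.length_cons, Nat.add_sub_cancel] at this

theorem isDivisible_conv {f g : GSym (shift (hShift (grading 𝒰)) (-1)) →ₗ[k] HSeries 𝒱} (p : ℤ)
    (hf : IsDivisible m f) (hg : IsDivisible m g) :
    IsDivisible m (conv _ (f ∘ₗ koszul (grading _) p) g) := by
  intro l hl hm
  refine conv_wprod_mem _ _ _ _ hl fun l₁ l₂ hp => ?_
  have hw := isWord_append.1 (hl.perm hp)
  have hn := nonLetters_perm hp
  rw [nonLetters_append] at hn
  rw [← hp.length_eq, List.length_append, LinearMap.comp_apply, koszul_wprod _ _ hw.1, map_smul]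
  exact mul_mem_hIdeal (Submodule.smul_mem _ _ (hf l₁ hw.1 (by omega))) (hg l₂ hw.2 (by omega))

/-- A new factor `x₁ ⋯ x_s` with `xᵢ ∈ U` does not affect divisibility, by induction on `s`: the
formula for products splits off the factor `x₁`, which is an element of `U`. -/
theorem isDivisible_mulι_word
    (h : ∀ l, IsWord (shift (hShift (grading 𝒰)) (-1)) l → nonLetters l ≤ m →
      diamondCounit hψ (wprod _ l) ∈ hIdeal 𝒱 (l.length - 1)) {w : List (ℤ × U)}
    (hw : IsWord 𝒰 w) :
    IsDivisible m (diamondCounit hψ ∘ₗ mulι _ (hmonomial (grading 𝒰) 0 (wprod 𝒰 w))) := by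
  induction w with
  | nil =>
    intro l hl hm
    rw [wprod_nil, hmonomial_zero_one, diamondCounit_mulι_one]
    cases l with
    | nil => exact mem_hIdeal.2 fun n hn => absurd hn (Nat.not_lt_zero n)
    | cons t l => rw [wprod_cons, convUnit_mul]; exact zero_mem _
  | cons t w ih =>
    obtain ⟨ht, hw⟩ := isWord_cons.1 hw
    have hb : hmonomial (grading 𝒰) 0 (wprod 𝒰 w) ∈
        shift (hShift (grading 𝒰)) (-1) (w.map Prod.fst).sum := by
      have := hmonomial_mem (wprod_mem 𝒰 hw) 0
      change _ ∈ hGrading (grading 𝒰) (1 + (-1 + (w.map Prod.fst).sum))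
      convert this using 2
      push_cast; ring
    have ha := letter_mem ht
    rw [mul_zero, add_zero] at ha
    rw [wprod_cons, hmonomial_zero_mul, diamondCounit_mulι_mul hψ _ hb]
    have h1 := isDivisible_mulι_letter h ht
    intro l hl hm
    rw [LinearMap.add_apply]
    refine add_mem ?_ (isDivisible_conv _ h1 (ih hw) l hl hm)
    -- the factor from `U` may be moved past the other new factor
    have h2 := ih hw ((t.1, hmonomial (grading 𝒰) 0 (ι 𝒰 t.2)) :: l) (isWord_cons.2 ⟨ha, hl⟩)
      (by rwa [nonLetters_cons_of_isLetter ⟨t.2, ht, rfl⟩])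
    obtain ⟨c, hc⟩ := wprod_perm (List.Perm.swap
      (((w.map Prod.fst).sum, hmonomial (grading 𝒰) 0 (wprod 𝒰 w)) : ℤ × HSeries (grading 𝒰))
      (t.1, hmonomial (grading 𝒰) 0 (ι 𝒰 t.2)) l)
      (isWord_cons.2 ⟨ha, isWord_cons.2 ⟨hb, hl⟩⟩)
    have h3 : diamondCounit hψ (wprod _ ((t.1, hmonomial (grading 𝒰) 0 (ι 𝒰 t.2)) ::
        ((w.map Prod.fst).sum, hmonomial (grading 𝒰) 0 (wprod 𝒰 w)) :: l)) ∈
        hIdeal 𝒱 l.length := by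
      rw [hc, map_smul]
      exact Submodule.smul_mem _ _ (hIdeal_anti (by simp) h2)
    exact h3

/-- If `κ = ψ ⋄ p₁` is divisible by `ħ^{r-1}` on the words of length `r` with at most `m` factors
not in `U`, this remains true with one further factor `a ∈ S(U)[[ħ]]`. Only finitely many
coefficients of `a` matter, as the remaining ones contribute multiples of a high power of `ħ`. -/
theorem isDivisible_mulι
    (h : ∀ l, IsWord (shift (hShift (grading 𝒰)) (-1)) l → nonLetters l ≤ m →
      diamondCounit hψ (wprod _ l) ∈ hIdeal 𝒱 (l.length - 1)) (a : HSeries (grading 𝒰)) :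
    IsDivisible m (diamondCounit hψ ∘ₗ mulι _ a) := by
  have hc : ∀ w : GSym 𝒰,
      IsDivisible m (diamondCounit hψ ∘ₗ mulι _ (hmonomial (grading 𝒰) 0 w)) := by
    intro w
    induction w using word_induction (𝒰 := 𝒰) with
    | word l hl => exact isDivisible_mulι_word h hl
    | zero =>
      intro l hl hm
      rw [map_zero, mulι_zero, LinearMap.comp_zero]
      exact zero_mem _
    | add a b ha hb =>
      intro l hl hm
      rw [map_add, mulι_add, LinearMap.comp_add]
      exact add_mem (ha l hl hm) (hb l hl hm)
    | smul c a ha =>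
      intro l hl hm
      rw [map_smul, mulι_smul, LinearMap.comp_smul]
      exact Submodule.smul_mem _ _ (ha l hl hm)
  intro l hl hm
  let K : HSeries (grading 𝒰) →ₗ[k] HSeries 𝒱 :=
    { toFun := fun b => diamondCounit hψ (ι _ b * wprod _ l)
      map_add' := fun b b' => by rw [map_add, add_mul, map_add]
      map_smul' := fun c b => by rw [map_smul, smul_mul_assoc, map_smul]; rfl }
  have hK : ∀ j b, K (hbar _ j * b) = hbar 𝒱 j * K b := fun j b =>
    LinearMap.congr_fun (diamondCounit_mulι_hbar_mul hψ j b) (wprod _ l)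
  change K a ∈ _
  rw [eq_sum_add_hbar_mul l.length a, map_add, map_sum]
  refine add_mem (Submodule.sum_mem _ fun j _ => ?_) ?_
  · rw [hK]
    refine hIdeal_anti (Nat.le_add_left _ j) (mul_mem_hIdeal (hbar_mem_hIdeal j) ?_)
    exact hc _ l hl hm
  · rw [hK]
    exact hbar_mul_mem_hIdeal _ _

/-- The map `ψ ⋄ p₁ = log(exp(ψ) ∘ μ)` maps `Sʳ` to `ħ^{r-1} V[[ħ]]`. The factors that are not
elements of `U` are treated one at a time, by induction on their number; if there are none, the
value is that of `ψ`. -/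
theorem hasOrder_diamondCounit (hψ1 : ψ 1 = 0) (ho : HasOrder 𝒰 ψ) :
    HasOrder (shift (hShift (grading 𝒰)) (-1)) (diamondCounit hψ) := by
  have key : ∀ m l, IsWord (shift (hShift (grading 𝒰)) (-1)) l → nonLetters l ≤ m →
      diamondCounit hψ (wprod _ l) ∈ hIdeal 𝒱 (l.length - 1) := by
    intro m
    induction m with
    | zero =>
      intro l hl hm
      obtain ⟨l', hl', hlen, he⟩ := exists_eq_letterHom (Nat.le_zero.1 hm)
      rw [he, diamondCounit_letterHom hψ hψ1, ← hlen]
      exact mem_hIdeal.2 fun n hn => ho.hcoeff_eq_zero (wprod_mem_symPow 𝒰 l') hn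
    | succ m ih =>
      intro l hl hm
      by_cases h0 : nonLetters l = 0
      · exact ih l hl (by omega)
      · obtain ⟨t, l', ht, hp⟩ := exists_perm_cons_of_nonLetters h0
        have hw := isWord_cons.1 (hl.perm hp.symm)
        obtain ⟨c, hc⟩ := wprod_perm hp hl
        rw [nonLetters_perm hp, nonLetters_cons_of_not ht] at hm
        rw [hc, map_smul, hp.length_eq, List.length_cons, Nat.add_sub_cancel]
        exact Submodule.smul_mem _ _ (isDivisible_mulι ih t.2 l' hw.2 (by omega))
  exact hasOrder_of_words fun l hl n hn => mem_hIdeal.1 (key _ l hl le_rfl) n hn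

end Counit

open GSym

/-! ### The bijection -/

section Bijection

variable {k G V : Type*} [Field k] [CharZero k] [AddCommGroup G] [Module k G] [Ring V]
  [Algebra k V] {𝒢 : ℤ → Submodule k G} [Decomposition 𝒢]
  {𝒱 : ℤ → Submodule k V} [GradedAlgebra 𝒱] [GrComm 𝒱]
  {D : GSym (shift 𝒢 1) →ₗ[k] GSym (shift 𝒢 1)} {Δ : V →ₗ[k] HSeries 𝒱}

theorem IsLInfMorphism.isCoalgHom {H : Type*} [AddCommGroup H] [Module k H]
    {ℋ : ℤ → Submodule k H} [Decomposition ℋ] {D' : GSym (shift ℋ 1) →ₗ[k] GSym (shift ℋ 1)}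
    {F : GSym (shift 𝒢 1) →ₗ[k] GSym (shift ℋ 1)} (hF : IsLInfMorphism D D' F) :
    IsCoalgHom (shift 𝒢 1) (shift ℋ 1) F := ⟨hF.comul, hF.counit, hF.one⟩

theorem IsLInfMorphism.comp {H K : Type*} [AddCommGroup H] [Module k H]
    {ℋ : ℤ → Submodule k H} [Decomposition ℋ] [AddCommGroup K] [Module k K]
    {𝒦 : ℤ → Submodule k K} [Decomposition 𝒦] {D' : GSym (shift ℋ 1) →ₗ[k] GSym (shift ℋ 1)}
    {D'' : GSym (shift 𝒦 1) →ₗ[k] GSym (shift 𝒦 1)}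
    {F : GSym (shift 𝒢 1) →ₗ[k] GSym (shift ℋ 1)}
    {F' : GSym (shift ℋ 1) →ₗ[k] GSym (shift 𝒦 1)} (hF' : IsLInfMorphism D' D'' F')
    (hF : IsLInfMorphism D D' F) : IsLInfMorphism D D'' (F' ∘ₗ F) where
  homog := (hF'.homog.comp hF.homog).of_eq (add_zero 0)
  comul := (hF'.isCoalgHom.comp hF.isCoalgHom).comul
  counit := (hF'.isCoalgHom.comp hF.isCoalgHom).counit
  one := (hF'.isCoalgHom.comp hF.isCoalgHom).one
  comm a := by
    rw [LinearMap.comp_apply, hF.comm, hF'.comm, LinearMap.comp_apply]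

/-- A morphism of coalgebras `F` to `S(V[[ħ]][2])` commutes with the codifferentials as soon as its
composition with `a₁ ⋯ a_m ↦ ħ^{-m} a₁ ⋯ a_m` intertwines `D` and `Δ`, because
`F D - D' F = e * F` for a map `e` with values in the cogenerators. -/
theorem isLInfMorphism_of_muh (hΔ : IsBVInf 𝒱 Δ) (hD : IsLInf 𝒢 D)
    {F : GSym (shift 𝒢 1) →ₗ[k] GSym (shift (hShift 𝒱) 1)}
    (hF : IsCoalgHom (shift 𝒢 1) (shift (hShift 𝒱) 1) F)
    (hF0 : IsHomog (grading (shift 𝒢 1)) (grading (shift (hShift 𝒱) 1)) 0 F)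
    (h : ((muh 𝒱).toLinearMap ∘ₗ F) ∘ₗ D = lext Δ ∘ₗ (muh 𝒱).toLinearMap ∘ₗ F) :
    IsLInfMorphism D (derivedLInf hΔ) F := by
  refine ⟨hF0, hF.comul, hF.counit, hF.one, ?_⟩
  have h1 := coalgHom_comp_coder hF hF0 hD.isCoder hD.homog
  have h2 : derivedLInf hΔ ∘ₗ F =
      conv (shift 𝒢 1) (ι (shift (hShift 𝒱) 1) ∘ₗ modifiedBracket hΔ ∘ₗ F) F := by
    rw [derivedLInf, conv_comp_coalgHom hF]; rfl
  rw [LinearMap.comp_assoc, ← LinearMap.comp_assoc F _ (lext Δ), lext_muh hΔ, LinearMap.comp_assoc,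
    h1, h2, algHom_conv, algHom_conv, ← sub_eq_zero, ← conv_sub_left] at h
  have h3 := eq_zero_of_conv_muh (e := toCogen (shift (hShift 𝒱) 1) ∘ₗ F ∘ₗ D -
    modifiedBracket hΔ ∘ₗ F) (F := (muh 𝒱).toLinearMap ∘ₗ F) (by simp [hF.one]) (by
      rw [LinearMap.comp_sub, LinearMap.comp_sub]
      exact h)
  intro a
  refine (LinearMap.congr_fun h1 a).trans (Eq.trans ?_ (LinearMap.congr_fun h2 a).symm)
  have h4 : toCogen (shift (hShift 𝒱) 1) ∘ₗ F ∘ₗ D = modifiedBracket hΔ ∘ₗ F := sub_eq_zero.1 h3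
  rw [h4]

theorem isLInfMorphism_adj (hΔ : IsBVInf 𝒱 Δ) (hD : IsLInf 𝒢 D)
    {φ : GSym (shift 𝒢 (-1)) →ₗ[k] HSeries 𝒱} (hφ : IsBVMorphism (bvOfLInf 𝒢 D) Δ φ) :
    IsLInfMorphism D (derivedLInf hΔ) (adj 𝒢 φ) := by
  refine isLInfMorphism_of_muh hΔ hD (isCoalgHom_adj hφ.homog hφ.one)
    (adj_isHomog hφ.homog hφ.one) ?_
  rw [← theta_convExp_eq_muh_adj hφ.one hφ.order]
  exact (comm_iff_theta (theta_bvOfLInf hD) Δ _).1 hφ.comm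

theorem isBVMorphism_of_adj (hΔ : IsBVInf 𝒱 Δ) (hD : IsLInf 𝒢 D)
    {φ : GSym (shift 𝒢 (-1)) →ₗ[k] HSeries 𝒱}
    (hφ : IsHomog (grading (shift 𝒢 (-1))) (hGrading 𝒱) 0 φ) (hφ1 : φ 1 = 0)
    (ho : HasOrder (shift 𝒢 (-1)) φ) (h : IsLInfMorphism D (derivedLInf hΔ) (adj 𝒢 φ)) :
    IsBVMorphism (bvOfLInf 𝒢 D) Δ φ := by
  refine ⟨hφ, hφ1, (comm_iff_theta (theta_bvOfLInf hD) Δ _).2 ?_, ho⟩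
  rw [theta_convExp_eq_muh_adj hφ1 ho, ← LinearMap.comp_assoc, lext_muh hΔ, LinearMap.comp_assoc,
    LinearMap.comp_assoc]
  congr 1
  exact LinearMap.ext h.comm

theorem adj_injOn : Set.InjOn (adj 𝒢) {φ | IsBVMorphism (bvOfLInf 𝒢 D) Δ φ} := by
  intro φ hφ χ hχ h
  refine theta_injective ?_
  rw [theta_eq_adjComponents hφ.one hφ.order, theta_eq_adjComponents hχ.one hχ.order,
    ← toCogen_adj hφ.homog hφ.one, h, toCogen_adj hχ.homog hχ.one]

theorem hbar_mem (j : ℕ) : hbar 𝒱 j ∈ hGrading 𝒱 (0 + 2 * j) :=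
  hmonomial_mem SetLike.GradedOne.one_mem j

theorem inc_hbar_mul (j : ℕ) (v : HSeries 𝒱) : inc 𝒱 (hbar 𝒱 j * v) = hb V j * inc 𝒱 v := by
  rw [inc_apply, hbar_mul_coe, ps_X_pow_mul, ← inc_apply]

variable (𝒢) in
/-- The map `φ : S(𝔤[-1]) → V[[ħ]]` equal to `ħ^{m-1} f` on `Sᵐ`, where `f` is the projection of
`F` to the cogenerators. -/
def unadj (F : GSym (shift 𝒢 1) →ₗ[k] GSym (shift (hShift 𝒱) 1)) :
    GSym (shift 𝒢 (-1)) →ₗ[k] HSeries 𝒱 :=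
  weightwise (shift 𝒢 (-1)) fun m => LinearMap.mulLeft k (hbar 𝒱 (m - 1)) ∘ₗ
    toCogen (shift (hShift 𝒱) 1) ∘ₗ F ∘ₗ (desusp 𝒢).toLinearMap

theorem unadj_wprod (F : GSym (shift 𝒢 1) →ₗ[k] GSym (shift (hShift 𝒱) 1)) (l : List (ℤ × G)) :
    unadj 𝒢 F (wprod (shift 𝒢 (-1)) l) = hbar 𝒱 (l.length - 1) *
      toCogen (shift (hShift 𝒱) 1) (F (desusp 𝒢 (wprod (shift 𝒢 (-1)) l))) := by
  rw [unadj, weightwise_wprod]; rfl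

theorem unadj_one {F : GSym (shift 𝒢 1) →ₗ[k] GSym (shift (hShift 𝒱) 1)} (hF : F 1 = 1) :
    unadj 𝒢 F 1 = 0 := by
  have := unadj_wprod F []
  rwa [wprod_nil, map_one (desusp 𝒢), hF, toCogen_one, mul_zero] at this

theorem unadj_isHomog {F : GSym (shift 𝒢 1) →ₗ[k] GSym (shift (hShift 𝒱) 1)} (hF : F 1 = 1)
    (hF0 : IsHomog (grading (shift 𝒢 1)) (grading (shift (hShift 𝒱) 1)) 0 F) :
    IsHomog (grading (shift 𝒢 (-1))) (hGrading 𝒱) 0 (unadj 𝒢 F) := by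
  refine isHomog_of_words _ _ fun l hl => ?_
  cases l with
  | nil => rw [wprod_nil, unadj_one hF]; exact zero_mem _
  | cons t l =>
    rw [unadj_wprod, desusp_wprod]
    have h := toCogen_mem (hF0.word (isWord_desuspWord hl))
    rw [sum_desuspWord] at h
    have h2 := SetLike.GradedMul.mul_mem (hbar_mem (𝒱 := 𝒱) ((t :: l).length - 1))
      (show _ ∈ hGrading 𝒱 (1 + (1 + _)) from h)
    convert h2 using 2
    rw [List.length_cons]
    push_cast [Nat.add_sub_cancel]
    ring

theorem theta_unadj {F : GSym (shift 𝒢 1) →ₗ[k] GSym (shift (hShift 𝒱) 1)} (hF : F 1 = 1) :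
    theta (unadj 𝒢 F) = (muh 𝒱).toLinearMap ∘ₗ ι (shift (hShift 𝒱) 1) ∘ₗ
      toCogen (shift (hShift 𝒱) 1) ∘ₗ F := by
  refine ext_words _ fun l hl => ?_
  rw [theta_wprod, LinearMap.comp_apply, LinearMap.comp_apply, LinearMap.comp_apply,
    AlgHom.toLinearMap_apply, muh_ι]
  cases l with
  | nil => rw [wprod_nil, map_one (susp 𝒢), unadj_one hF, hF, toCogen_one]; simp
  | cons t l =>
    rw [susp_wprod, unadj_wprod, ← susp_wprod, desusp_susp, inc_hbar_mul, hb_mul_hb_mul,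
      length_suspWord, List.length_cons]
    congr 2
    push_cast [Nat.add_sub_cancel]
    ring

theorem adj_surjOn (hΔ : IsBVInf 𝒱 Δ) (hD : IsLInf 𝒢 D) :
    Set.SurjOn (adj 𝒢) {φ | IsBVMorphism (bvOfLInf 𝒢 D) Δ φ}
      {F | IsLInfMorphism D (derivedLInf hΔ) F} := by
  intro F hF
  have hF' := IsLInfMorphism.isCoalgHom hF
  have h1 := unadj_isHomog hF'.one hF.homog
  have h2 := hasOrder_and_adj_eq h1 (unadj_one hF'.one) hF' hF.homog (by
    rw [theta_convExp (unadj_one hF'.one), theta_unadj hF'.one, ← algHom_convExp,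
      ← eq_convExp_of_isCoalgHom hF'])
  exact ⟨unadj 𝒢 F, isBVMorphism_of_adj hΔ hD h1 (unadj_one hF'.one) h2.1 (h2.2.symm ▸ hF), h2.2⟩

end Bijection

/-! ### Compositions -/

section Composition

variable {k G V : Type*} [Field k] [CharZero k] [AddCommGroup G] [Module k G] [Ring V]
  [Algebra k V] {𝒢 : ℤ → Submodule k G} [Decomposition 𝒢]
  {𝒱 : ℤ → Submodule k V} [GradedAlgebra 𝒱] [GrComm 𝒱]
  {U : Type*} [AddCommGroup U] [Module k U] {𝒰 : ℤ → Submodule k U} [Decomposition 𝒰]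
  {ψ : GSym 𝒰 →ₗ[k] HSeries 𝒱} (hψ : IsHomog (grading 𝒰) (hGrading 𝒱) 0 ψ)
  {φ : GSym (shift 𝒢 (-1)) →ₗ[k] HSeries (grading 𝒰)}

theorem expExt_comp_isHomog
    (hφ : IsHomog (grading (shift 𝒢 (-1))) (hGrading (grading 𝒰)) 0 φ) :
    IsHomog (grading (shift 𝒢 (-1))) (hGrading 𝒱) 0
      (expExt hψ ∘ₗ convExp (shift 𝒢 (-1)) φ) :=
  ((hext_isHomog (convExp_isHomog 𝒰 (hGrading 𝒱) hψ)).comp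
    (convExp_isHomog _ _ hφ)).of_eq (add_zero 0)

theorem diamond_isHomog
    (hφ : IsHomog (grading (shift 𝒢 (-1))) (hGrading (grading 𝒰)) 0 φ) :
    IsHomog (grading (shift 𝒢 (-1))) (hGrading 𝒱) 0 (diamond hψ φ) :=
  convLog_isHomog _ _ (expExt_comp_isHomog hψ hφ)

theorem diamond_one : diamond hψ φ 1 = 0 := convLog_one _ _

/-- Since `θ` turns composition with the extension of a map into a composition of maps of Laurent
series, `θ(exp(ψ ⋄ φ)) = exp(ψ) θ(exp φ)`. -/
theorem theta_convExp_diamond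
    (hφ : IsHomog (grading (shift 𝒢 (-1))) (hGrading (grading 𝒰)) 0 φ) :
    theta (convExp (shift 𝒢 (-1)) (diamond hψ φ)) =
      lext (convExp 𝒰 ψ) ∘ₗ theta (convExp (shift 𝒢 (-1)) φ) := by
  rw [diamond, convExp_convLog _ (hGrading 𝒱) (expExt_comp_isHomog hψ hφ)
    (by rw [LinearMap.comp_apply, convExp_one, expExt_one])]
  exact LinearMap.ext fun a =>
    (lext_theta_hext (convExp_isHomog 𝒰 (hGrading 𝒱) hψ) (convExp (shift 𝒢 (-1)) φ) a).symm

end Composition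

/-! ### Naturality in the `L∞`-algebra -/

section NaturalityLInf

variable {k G G' : Type*} [Field k] [CharZero k] [AddCommGroup G] [Module k G] [AddCommGroup G']
  [Module k G'] {𝒢 : ℤ → Submodule k G} [Decomposition 𝒢]
  {𝒢' : ℤ → Submodule k G'} [Decomposition 𝒢']
  {D : GSym (shift 𝒢 1) →ₗ[k] GSym (shift 𝒢 1)} {D' : GSym (shift 𝒢' 1) →ₗ[k] GSym (shift 𝒢' 1)}
  {E : GSym (shift 𝒢' 1) →ₗ[k] GSym (shift 𝒢 1)}

theorem bvOfLInfMorphism_wprod (l : List (ℤ × G')) :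
    bvOfLInfMorphism E (wprod (shift 𝒢' (-1)) l) = hmonomial (grading (shift 𝒢 (-1)))
      (l.length - 1) (ι (shift 𝒢 (-1)) (toCogen (shift 𝒢 1)
        (E (desusp 𝒢' (wprod (shift 𝒢' (-1)) l))))) := by
  rw [bvOfLInfMorphism, weightwise_wprod]; rfl

theorem bvOfLInfMorphism_one (hE : E 1 = 1) : bvOfLInfMorphism E 1 = 0 := by
  have := bvOfLInfMorphism_wprod (E := E) []
  rwa [wprod_nil, map_one (desusp 𝒢'), hE, toCogen_one, map_zero, map_zero] at this

theorem bvOfLInfMorphism_isHomog (hE : E 1 = 1)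
    (hE0 : IsHomog (grading (shift 𝒢' 1)) (grading (shift 𝒢 1)) 0 E) :
    IsHomog (grading (shift 𝒢' (-1))) (hGrading (grading (shift 𝒢 (-1)))) 0
      (bvOfLInfMorphism E) := by
  refine isHomog_of_words _ _ fun l hl => ?_
  cases l with
  | nil => rw [wprod_nil, bvOfLInfMorphism_one hE]; exact zero_mem _
  | cons t l =>
    rw [bvOfLInfMorphism_wprod, desusp_wprod]
    have h := toCogen_mem (hE0.word (isWord_desuspWord hl))
    rw [sum_desuspWord] at h
    have h1 : ∀ (p q : ℤ) (x : G), x ∈ shift 𝒢 1 p → p + 2 = q → x ∈ shift 𝒢 (-1) q := by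
      rintro p _ x hx rfl
      change x ∈ 𝒢 (-1 + (p + 2))
      change x ∈ 𝒢 (1 + p) at hx
      convert hx using 2
      ring
    have h2 := hmonomial_mem (ι_mem_grading _ (h1 _ _ _ h rfl)) ((t :: l).length - 1)
    convert h2 using 2
    rw [List.length_cons]
    push_cast [Nat.add_sub_cancel]
    ring

theorem theta_bvOfLInfMorphism (hE : E 1 = 1) : theta (bvOfLInfMorphism E) =
    (thetaHom 𝒢).toLinearMap ∘ₗ ι (shift 𝒢 1) ∘ₗ toCogen (shift 𝒢 1) ∘ₗ E := by
  refine ext_words _ fun l hl => ?_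
  rw [theta_wprod, LinearMap.comp_apply, LinearMap.comp_apply, LinearMap.comp_apply,
    AlgHom.toLinearMap_apply, thetaHom_ι]
  cases l with
  | nil => rw [wprod_nil, map_one (susp 𝒢'), bvOfLInfMorphism_one hE, hE, toCogen_one]; simp
  | cons t l =>
    rw [susp_wprod, bvOfLInfMorphism_wprod, ← susp_wprod, desusp_susp, inc_hmonomial,
      hb_mul_hb_mul, length_suspWord, List.length_cons]
    congr 2
    push_cast [Nat.add_sub_cancel]
    ring

theorem theta_convExp_bvOfLInfMorphism (hE : IsCoalgHom (shift 𝒢' 1) (shift 𝒢 1) E) :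
    theta (convExp (shift 𝒢' (-1)) (bvOfLInfMorphism E)) = (thetaHom 𝒢).toLinearMap ∘ₗ E := by
  rw [theta_convExp (bvOfLInfMorphism_one hE.one), theta_bvOfLInfMorphism hE.one,
    ← algHom_convExp, ← eq_convExp_of_isCoalgHom hE]

theorem isBVMorphism_bvOfLInfMorphism (hD : IsLInf 𝒢 D) (hD' : IsLInf 𝒢' D')
    (hE : IsLInfMorphism D' D E) :
    IsBVMorphism (bvOfLInf 𝒢' D') (bvOfLInf 𝒢 D) (bvOfLInfMorphism E) := by
  refine ⟨bvOfLInfMorphism_isHomog hE.one hE.homog, bvOfLInfMorphism_one hE.one,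
    (comm_iff_theta (theta_bvOfLInf hD') _ _).2 ?_, ?_⟩
  · rw [theta_convExp_bvOfLInfMorphism hE.isCoalgHom]
    refine LinearMap.ext fun a => ?_
    change thetaHom 𝒢 (E (D' a)) = lext (bvOfLInf 𝒢 D) (thetaHom 𝒢 (E a))
    rw [hE.comm, thetaHom_apply, thetaHom_apply, lext_theta, theta_bvOfLInf hD]
  · refine hasOrder_of_words fun l hl n hn => ?_
    rw [bvOfLInfMorphism_wprod, hcoeff_hmonomial, if_neg (by omega)]

variable {V : Type*} [Ring V] [Algebra k V] {𝒱 : ℤ → Submodule k V} [GradedAlgebra 𝒱] [GrComm 𝒱]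
  {Δ : V →ₗ[k] HSeries 𝒱}

theorem isBVMorphism_diamond_bvOfLInfMorphism (hΔ : IsBVInf 𝒱 Δ) (hD : IsLInf 𝒢 D)
    (hD' : IsLInf 𝒢' D') (hE : IsLInfMorphism D' D E)
    {φ : GSym (shift 𝒢 (-1)) →ₗ[k] HSeries 𝒱} (hφ : IsBVMorphism (bvOfLInf 𝒢 D) Δ φ) :
    IsBVMorphism (bvOfLInf 𝒢' D') Δ (diamond hφ.homog (bvOfLInfMorphism E)) ∧
      adj 𝒢' (diamond hφ.homog (bvOfLInfMorphism E)) = adj 𝒢 φ ∘ₗ E := by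
  have hE0 := bvOfLInfMorphism_isHomog hE.one hE.homog
  have hF := (isLInfMorphism_adj hΔ hD hφ).comp hE
  have h0 : (muh 𝒱).toLinearMap ∘ₗ adj 𝒢 φ ∘ₗ E = theta (convExp (shift 𝒢 (-1)) φ) ∘ₗ E := by
    rw [← LinearMap.comp_assoc, ← theta_convExp_eq_muh_adj hφ.one hφ.order]
  have h := hasOrder_and_adj_eq (diamond_isHomog hφ.homog hE0) (diamond_one hφ.homog)
    hF.isCoalgHom hF.homog (by
      rw [theta_convExp_diamond hφ.homog hE0, theta_convExp_bvOfLInfMorphism hE.isCoalgHom, h0]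
      exact LinearMap.ext fun a => lext_theta _ (E a))
  exact ⟨isBVMorphism_of_adj hΔ hD' (diamond_isHomog hφ.homog hE0) (diamond_one hφ.homog) h.1
    (h.2.symm ▸ hF), h.2⟩

end NaturalityLInf

/-! ### Naturality in the `BV∞`-algebra -/

section NaturalityBV

variable {k U V : Type*} [Field k] [CharZero k] [AddCommGroup U] [Module k U] [Ring V]
  [Algebra k V] {𝒰 : ℤ → Submodule k U} [Decomposition 𝒰]
  {𝒱 : ℤ → Submodule k V} [GradedAlgebra 𝒱] [GrComm 𝒱]
  {Δ' : GSym 𝒰 →ₗ[k] HSeries (grading 𝒰)} {Δ : V →ₗ[k] HSeries 𝒱}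
  {ψ : GSym 𝒰 →ₗ[k] HSeries 𝒱}

theorem theta_convExp_diamondCounit (hψ : IsHomog (grading 𝒰) (hGrading 𝒱) 0 ψ) :
    theta (convExp (shift (hShift (grading 𝒰)) (-1)) (diamondCounit hψ)) =
      lext (convExp 𝒰 ψ) ∘ₗ (muh (grading 𝒰)).toLinearMap := by
  have h : convExp _ (diamondCounit hψ) = expMul hψ :=
    convExp_convLog _ (hGrading 𝒱) (expMul_isHomog hψ) (expMul_one hψ)
  rw [h, ← theta_hMultiplication]
  exact LinearMap.ext fun a =>
    (lext_theta_hext (convExp_isHomog 𝒰 (hGrading 𝒱) hψ) _ a).symm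

theorem diamondCounit_one (hψ : IsHomog (grading 𝒰) (hGrading 𝒱) 0 ψ) :
    diamondCounit hψ 1 = 0 := convLog_one _ _

theorem muh_inducedLInfMorphism (hψ : IsHomog (grading 𝒰) (hGrading 𝒱) 0 ψ) (hψ1 : ψ 1 = 0)
    (ho : HasOrder 𝒰 ψ) : (muh 𝒱).toLinearMap ∘ₗ inducedLInfMorphism hψ =
      lext (convExp 𝒰 ψ) ∘ₗ (muh (grading 𝒰)).toLinearMap := by
  rw [inducedLInfMorphism, ← theta_convExp_eq_muh_adj (diamondCounit_one hψ)
    (hasOrder_diamondCounit hψ1 ho), theta_convExp_diamondCounit]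

theorem hext_convExp_hext (hΔ' : IsBVInf (grading 𝒰) Δ') (hΔ : IsBVInf 𝒱 Δ)
    (hψ : IsBVMorphism Δ' Δ ψ) (v : HSeries (grading 𝒰)) :
    hext (convExp_isHomog 𝒰 (hGrading 𝒱) hψ.homog) (hext hΔ'.homog v) =
      hext hΔ.homog (hext (convExp_isHomog 𝒰 (hGrading 𝒱) hψ.homog) v) := by
  refine Subtype.ext ?_
  change hextend (convExp 𝒰 ψ) (hextend Δ' v) = hextend Δ (hextend (convExp 𝒰 ψ) v)
  rw [hextend_hextend (convExp_isHomog 𝒰 (hGrading 𝒱) hψ.homog), hextend_hextend hΔ.homog]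
  congr 2
  exact LinearMap.ext fun w => Subtype.ext (hψ.comm w)

theorem lext_comm_theta {G W : Type*} [AddCommGroup G] [Module k G] [Ring W] [Algebra k W]
    {𝒢 : ℤ → Submodule k G} [Decomposition 𝒢] {𝒲 : ℤ → Submodule k W} [GradedAlgebra 𝒲]
    {E : V →ₗ[k] HSeries 𝒲} {T : V →ₗ[k] HSeries 𝒱} {T' : W →ₗ[k] HSeries 𝒲} {d e : ℤ}
    {hE : IsHomog 𝒱 (hGrading 𝒲) d E} {hT : IsHomog 𝒱 (hGrading 𝒱) e T}
    {hT' : IsHomog 𝒲 (hGrading 𝒲) e T'}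
    (h : ∀ v, hext hE (hext hT v) = hext hT' (hext hE v))
    (f : GSym (shift 𝒢 (-1)) →ₗ[k] HSeries 𝒱) (a : GSym (shift 𝒢 1)) :
    lext E (lext T (theta f a)) = lext T' (lext E (theta f a)) := by
  rw [lext_theta_hext hT, lext_theta_hext hE, lext_theta_hext hE, lext_theta_hext hT']
  have : hext hE ∘ₗ hext hT ∘ₗ f = hext hT' ∘ₗ hext hE ∘ₗ f := LinearMap.ext fun w => h (f w)
  rw [this]

theorem lext_convExp_lext_muh (hΔ' : IsBVInf (grading 𝒰) Δ') (hΔ : IsBVInf 𝒱 Δ)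
    (hψ : IsBVMorphism Δ' Δ ψ) :
    lext (convExp 𝒰 ψ) ∘ₗ lext Δ' ∘ₗ (muh (grading 𝒰)).toLinearMap =
      lext Δ ∘ₗ lext (convExp 𝒰 ψ) ∘ₗ (muh (grading 𝒰)).toLinearMap := by
  rw [← theta_hMultiplication]
  exact LinearMap.ext fun a => lext_comm_theta (hext_convExp_hext hΔ' hΔ hψ) _ a

theorem isLInfMorphism_inducedLInfMorphism (hΔ' : IsBVInf (grading 𝒰) Δ') (hΔ : IsBVInf 𝒱 Δ)
    (hψ : IsBVMorphism Δ' Δ ψ) :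
    IsLInfMorphism (derivedLInf hΔ') (derivedLInf hΔ) (inducedLInfMorphism hψ.homog) := by
  refine isLInfMorphism_of_muh hΔ (isLInf_derivedLInf hΔ')
    (isCoalgHom_adj (diamondCounit_isHomog hψ.homog) (diamondCounit_one hψ.homog))
    (adj_isHomog (diamondCounit_isHomog hψ.homog) (diamondCounit_one hψ.homog)) ?_
  change ((muh 𝒱).toLinearMap ∘ₗ inducedLInfMorphism hψ.homog) ∘ₗ _ =
    lext Δ ∘ₗ (muh 𝒱).toLinearMap ∘ₗ inducedLInfMorphism hψ.homog
  rw [muh_inducedLInfMorphism hψ.homog hψ.one hψ.order, LinearMap.comp_assoc, ← lext_muh hΔ',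
    lext_convExp_lext_muh hΔ' hΔ hψ]

theorem corresponds_inducedLInfMorphism (hψ : IsBVMorphism Δ' Δ ψ) :
    Corresponds (hShift (grading 𝒰)) (diamondCounit hψ.homog) (inducedLInfMorphism hψ.homog) :=
  corresponds_adj (diamondCounit_isHomog hψ.homog) (diamondCounit_one hψ.homog)
    (hasOrder_diamondCounit hψ.one hψ.order)

variable {G : Type*} [AddCommGroup G] [Module k G] {𝒢 : ℤ → Submodule k G} [Decomposition 𝒢]
  {D : GSym (shift 𝒢 1) →ₗ[k] GSym (shift 𝒢 1)}

theorem isBVMorphism_diamond (hΔ' : IsBVInf (grading 𝒰) Δ') (hΔ : IsBVInf 𝒱 Δ)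
    (hD : IsLInf 𝒢 D) (hψ : IsBVMorphism Δ' Δ ψ)
    {φ : GSym (shift 𝒢 (-1)) →ₗ[k] HSeries (grading 𝒰)}
    (hφ : IsBVMorphism (bvOfLInf 𝒢 D) Δ' φ) :
    IsBVMorphism (bvOfLInf 𝒢 D) Δ (diamond hψ.homog φ) ∧
      adj 𝒢 (diamond hψ.homog φ) = inducedLInfMorphism hψ.homog ∘ₗ adj 𝒢 φ := by
  have hF := (isLInfMorphism_inducedLInfMorphism hΔ' hΔ hψ).comp
    (isLInfMorphism_adj hΔ' hD hφ)
  have h := hasOrder_and_adj_eq (diamond_isHomog hψ.homog hφ.homog) (diamond_one hψ.homog)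
    hF.isCoalgHom hF.homog (by
      rw [theta_convExp_diamond hψ.homog hφ.homog, theta_convExp_eq_muh_adj hφ.one hφ.order,
        ← LinearMap.comp_assoc, ← LinearMap.comp_assoc,
        muh_inducedLInfMorphism hψ.homog hψ.one hψ.order])
  exact ⟨isBVMorphism_of_adj hΔ hD (diamond_isHomog hψ.homog hφ.homog) (diamond_one hψ.homog) h.1
    (h.2.symm ▸ hF), h.2⟩

end NaturalityBV

end HBV

end

theorem mainTheorem2 {k : Type*} [Field k] [CharZero k]
    {G : Type*} [AddCommGroup G] [Module k G] (𝒢 : ℤ → Submodule k G) [DirectSum.Decomposition 𝒢]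
    (D : GSym (shift 𝒢 1) →ₗ[k] GSym (shift 𝒢 1)) (hD : IsLInf 𝒢 D)
    {V : Type*} [Ring V] [Algebra k V] (𝒱 : ℤ → Submodule k V) [GradedAlgebra 𝒱] [GrComm 𝒱]
    (Δ : V →ₗ[k] HSeries 𝒱) (hΔ : IsBVInf 𝒱 Δ) :
    -- `S(𝔤[-1])` is a `BV∞`-algebra
    IsBVInf (GSym.grading (shift 𝒢 (-1))) (bvOfLInf 𝒢 D) ∧
    -- the brackets `l^ħₙ` are divisible by `ħ^{n-1}`, and the quotients `Lₙ` form an `L∞`-structure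
    (∀ n : ℕ, 1 ≤ n → ∀ x ∈ GSym.symPow (shift (hShift 𝒱) 1) n,
      (hBracket hΔ x : PowerSeries V) =
        PowerSeries.X ^ (n - 1) * (modifiedBracket hΔ x : PowerSeries V)) ∧
    IsLInf (hShift 𝒱) (derivedLInf hΔ) ∧
    -- the bijection `Hom(S(𝔤[-1]), V) ≅ Hom(𝔤, V[[ħ]][1])` and the formula for it
    Set.BijOn (adj 𝒢) {φ | IsBVMorphism (bvOfLInf 𝒢 D) Δ φ}
      {F | IsLInfMorphism D (derivedLInf hΔ) F} ∧
    (∀ φ, IsBVMorphism (bvOfLInf 𝒢 D) Δ φ → Corresponds 𝒢 φ (adj 𝒢 φ)) ∧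
    -- naturality in `𝔤`, with respect to `L∞`-morphisms `E : 𝔤' → 𝔤`
    (∀ {G' : Type*} [AddCommGroup G'] [Module k G'] (𝒢' : ℤ → Submodule k G')
      [DirectSum.Decomposition 𝒢'] (D' : GSym (shift 𝒢' 1) →ₗ[k] GSym (shift 𝒢' 1))
      (_ : IsLInf 𝒢' D') (E : GSym (shift 𝒢' 1) →ₗ[k] GSym (shift 𝒢 1))
      (_ : IsLInfMorphism D' D E),
      IsBVMorphism (bvOfLInf 𝒢' D') (bvOfLInf 𝒢 D) (bvOfLInfMorphism E) ∧
      ∀ (φ : GSym (shift 𝒢 (-1)) →ₗ[k] HSeries 𝒱) (hφ : IsBVMorphism (bvOfLInf 𝒢 D) Δ φ),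
        IsBVMorphism (bvOfLInf 𝒢' D') Δ (diamond hφ.homog (bvOfLInfMorphism E)) ∧
        adj 𝒢' (diamond hφ.homog (bvOfLInfMorphism E)) = adj 𝒢 φ ∘ₗ E) ∧
    -- naturality in `V`, with respect to `BV∞`-morphisms `ψ : S(U) → V`
    (∀ {U : Type*} [AddCommGroup U] [Module k U] (𝒰 : ℤ → Submodule k U)
      [DirectSum.Decomposition 𝒰] (Δ' : GSym 𝒰 →ₗ[k] HSeries (GSym.grading 𝒰))
      (hΔ' : IsBVInf (GSym.grading 𝒰) Δ') (ψ : GSym 𝒰 →ₗ[k] HSeries 𝒱)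
      (hψ : IsBVMorphism Δ' Δ ψ),
      IsLInfMorphism (derivedLInf hΔ') (derivedLInf hΔ) (inducedLInfMorphism hψ.homog) ∧
      Corresponds (hShift (GSym.grading 𝒰)) (diamondCounit hψ.homog)
        (inducedLInfMorphism hψ.homog) ∧
      ∀ φ : GSym (shift 𝒢 (-1)) →ₗ[k] HSeries (GSym.grading 𝒰),
        IsBVMorphism (bvOfLInf 𝒢 D) Δ' φ →
        IsBVMorphism (bvOfLInf 𝒢 D) Δ (diamond hψ.homog φ) ∧
        adj 𝒢 (diamond hψ.homog φ) = inducedLInfMorphism hψ.homog ∘ₗ adj 𝒢 φ) :=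
  ⟨isBVInf_bvOfLInf hD, fun _ _ _ hx => hBracket_eq_X_pow_mul hΔ hx, isLInf_derivedLInf hΔ,
    ⟨fun _ hφ => isLInfMorphism_adj hΔ hD hφ, adj_injOn, adj_surjOn hΔ hD⟩,
    fun _ hφ => corresponds_adj hφ.homog hφ.one hφ.order,
    fun _ _ _ hD' _ hE => ⟨isBVMorphism_bvOfLInfMorphism hD hD' hE,
      fun _ hφ => isBVMorphism_diamond_bvOfLInfMorphism hΔ hD hD' hE hφ⟩,
    fun _ _ _ hΔ' _ hψ => ⟨isLInfMorphism_inducedLInfMorphism hΔ' hΔ hψ,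
      corresponds_inducedLInfMorphism hψ,
      fun _ hφ => isBVMorphism_diamond hΔ' hΔ hD hψ hφ⟩⟩
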